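/- **Setting.** Let $H$ be a separable infinite-dimensional complex Hilbert space and let $\Phi:B(H)\to B(H)$ be a completely positive linear map that is normal ($\Phi(\sup_\lambda A_\lambda)=\sup_\lambda\Phi(A_\lambda)$ for increasing nets with a supremum) and subunital ($\Phi(I)\le I$). Let $\Phi_*$ be its predual map on trace class operators, $\operatorname{Tr}\Phi_*(\rho)A=\operatorname{Tr}\Phi(A)\rho$. Let $G$ be a positive (semidefinite) self-adjoint operator on $H$ with dense domain $D(G)$ such that $$\inf\{\|G\varphi\| : \varphi\in D(G),\ \|\varphi\|=1\}=0.$$ A state is a positive trace class operator $\rho$ with $\operatorname{Tr}\rho=1$. For a positive trace class operator $\rho=\sum_i|\varphi_i\rangle\langle\varphi_i|$ put $\operatorname{Tr}G\rho=\sum_i\|\sqrt G\varphi_i\|^2\in[0,\infty]$ (with $\|\sqrt G\varphi\|=\infty$ if $\varphi\notin D(\sqrt G)$). The map $\Phi$ is called $G$-limited if $\operatorname{Tr}G\Phi_*(\rho)<\infty$ for every state $\rho$ with $\operatorname{Tr}G\rho<\infty$. For $E>0$ put $$Y_\Phi(E)=\sup\{\operatorname{Tr}G\Phi_*(\rho):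 \rho \text{ a state},\ \operatorname{Tr}G\rho\le E\}.$$ A linear operator $A:D(\sqrt G)\to H$ is $\sqrt G$-bounded if, for some $a,b\ge 0$, $$\|A\varphi\|^2\le a^2\|\varphi\|^2+b^2\|\sqrt G\varphi\|^2\quad\text{for all }\varphi\in D(\sqrt G);$$ its $\sqrt G$-bound $b_{\sqrt G}(A)$ is the infimum of the $b\ge0$ that occur here, and $A$ is $\sqrt G$-infinitesimal if $b_{\sqrt G}(A)=0$. Let $B_G(H)$ be the space of $\sqrt G$-bounded operators (operators that coincide on $D(\sqrt G)$ are identified, and $B(H)$ is mapped into $B_G(H)$ by restriction), with the operator $E$-norms $$\|A\|_E^G=\sup\Big\{\sqrt{\operatorname{Tr}A\rho A^*}: \rho \text{ a state},\ \operatorname{Tr}G\rho\le E\Big\},\qquad \operatorname{Tr}A\rho A^*=\sum_i\|A\varphi_i\|^2\ \text{ for }\ \rho=\sum_i|\varphi_i\rangle\langle\varphi_i|$$ (the supremum of the empty set being $0$). A Stinespring representation of $\Phi$ is $\Phi(A)=V^*(A\otimes I_K)V$, $A\in B(H)$, with a separable Hilbert space $K$ and a bounded operator $V:H\to H\otimes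 K$; it is minimal if the linear span of the vectors $(A\otimes I_K)V\varphi$ is dense in $H\otimes K$, and the Choi rank of $\Phi$ is $\dim K$ for a minimal representation. **(A)** Suppose that $\Phi$ is $G$-limited. Then $\Phi$ is continuous on $B(H)$ with respect to the norm $\|\cdot\|_E^G$ for every $E>0$, and $Y_\Phi(E)<\infty$ for every $E>0$. Moreover, there is a linear map $\widehat\Phi:B_G(H)\to B_G(H)$ that extends $\Phi$ and has the following properties. 1. For every Stinespring representation $(K,V)$ of $\Phi$, $\widehat\Phi$ is the unique linear map on $B_G(H)$ given by $\widehat\Phi(A)\varphi=V^*(A\otimes I_K)V\varphi$ for $\varphi\in D(\sqrt G)$. Here $V$ maps $D(\sqrt G)$ into $D(\sqrt G\otimes I_K)$, and $A\otimes I_K$ denotes the unique $\sqrt G\otimes I_K$-bounded linear extension of $A\otimes I_K$ from $D(\sqrt G)\otimes K$ to $D(\sqrt G\otimes I_K)$. In particular $\widehat\Phi$ does not depend on the representation. 2. For all $E>0$ and $A\in B_G(H)$, $$\|\widehat\Phi(A)\|_E^G\le\sqrt{\|\Phi(I)\|}\,\|A\|^G_{Y_\Phi(E)}\le\sqrt{\max\{1,Y_\Phi(E)/E\}\,\|\Phi(I)\|}\;\|A\|_E^G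 .$$ 3. The limit $k_\Phi=\lim_{E\to+\infty}Y_\Phi(E)/E$ exists and is finite, and $b_{\sqrt G}(\widehat\Phi(A))\le\sqrt{k_\Phi\|\Phi(I)\|}\;b_{\sqrt G}(A)$ for all $A\in B_G(H)$. In particular, $\widehat\Phi$ maps $\sqrt G$-infinitesimal operators to $\sqrt G$-infinitesimal operators. **(B)** Suppose that $G$ is discrete, i.e. $G=\sum_{k\ge0}E_k|\tau_k\rangle\langle\tau_k|$ with an orthonormal basis $(\tau_k)$ of $H$, a nondecreasing sequence $E_k\to+\infty$, and $D(G)=\{\varphi:\sum_kE_k^2|\langle\tau_k|\varphi\rangle|^2<\infty\}$. Suppose also that $\Phi$ has finite Choi rank or that $\Phi(I)=\Phi(P)$ for some finite-rank orthogonal projector $P$. If $\Phi$ is continuous on $B(H)$ with respect to $\|\cdot\|_E^G$ for some $E>0$, then $\Phi$ is $G$-limited. -/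

import Mathlib

open scoped InnerProductSpace TensorProduct CStarAlgebra ENNReal Topology

namespace EnergyOp

/-- `G` is a positive (semidefinite) self-adjoint, in general unbounded, operator on `H`. Its domain
is automatically dense. -/
structure IsPosSelfAdjoint {H : Type*} [NormedAddCommGroup H] [InnerProductSpace ℂ H]
    [CompleteSpace H] (G : H →ₗ.[ℂ] H) : Prop where
  isSelfAdjoint : IsSelfAdjoint G
  nonneg : ∀ x : G.domain, 0 ≤ (⟪(x : H), G x⟫_ℂ).re

/-- `S = √G`: the operator `S` is positive, self-adjoint and `S² = G`, including domains. -/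
structure IsPosSqrt {H : Type*} [NormedAddCommGroup H] [InnerProductSpace ℂ H]
    [CompleteSpace H] (S G : H →ₗ.[ℂ] H) : Prop where
  posSelfAdjoint : IsPosSelfAdjoint S
  mem_domain : ∀ x : H, x ∈ G.domain ↔ ∃ hx : x ∈ S.domain, S ⟨x, hx⟩ ∈ S.domain
  apply_eq : ∀ (x : G.domain) (hx : (x : H) ∈ S.domain) (hSx : S ⟨x, hx⟩ ∈ S.domain),
    G x = S ⟨S ⟨x, hx⟩, hSx⟩

section Sqrt

variable {H : Type*} [NormedAddCommGroup H] [InnerProductSpace ℂ H] [CompleteSpace H]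

theorem IsPosSelfAdjoint.inner_symm {G : H →ₗ.[ℂ] H} (hG : IsPosSelfAdjoint G)
    (x y : G.domain) : ⟪G x, (y : H)⟫_ℂ = ⟪(x : H), G y⟫_ℂ := by
  have h := LinearPMap.adjoint_isFormalAdjoint hG.isSelfAdjoint.dense_domain
  rw [LinearPMap.isSelfAdjoint_def.1 hG.isSelfAdjoint] at h
  exact h x y

/-- The bounded inverse of `1 + G`. -/
theorem IsPosSelfAdjoint.exists_resolvent {G : H →ₗ.[ℂ] H} (hG : IsPosSelfAdjoint G) :
    ∃ R : H →L[ℂ] H, 0 ≤ R ∧ R ≤ 1 ∧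
      (∀ y : H, ∃ h : R y ∈ G.domain, G ⟨R y, h⟩ = y - R y) ∧
      ∀ x : G.domain, R (x + G x) = x := by
  have hadj := LinearPMap.isSelfAdjoint_def.1 hG.isSelfAdjoint
  have hd := hG.isSelfAdjoint.dense_domain
  let T : G.domain →ₗ[ℂ] H := G.domain.subtype + G.toFun
  have hT : ∀ x : G.domain, T x = x + G x := fun x => rfl
  have hlow : ∀ x : G.domain, ‖(x : H)‖ ≤ ‖T x‖ := by
    intro x
    by_cases hx : ‖(x : H)‖ = 0
    · rw [hx]; exact norm_nonneg _
    have h1 : ‖(x : H)‖ ^ 2 ≤ (⟪(x : H), T x⟫_ℂ).re := by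
      rw [hT, inner_add_right, Complex.add_re]
      have := inner_self_eq_norm_sq (𝕜 := ℂ) (x : H)
      have h2 := hG.nonneg x
      simp only [RCLike.re_to_complex] at this
      linarith
    have h2 : (⟪(x : H), T x⟫_ℂ).re ≤ ‖(x : H)‖ * ‖T x‖ :=
      (Complex.re_le_norm _).trans (norm_inner_le_norm _ _)
    have h3 : 0 < ‖(x : H)‖ := lt_of_le_of_ne (norm_nonneg _) (Ne.symm hx)
    nlinarith
  have hinj : Function.Injective T := by
    rw [← LinearMap.ker_eq_bot, LinearMap.ker_eq_bot']
    intro x hx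
    have := hlow x
    rw [hx, norm_zero] at this
    exact Subtype.ext (norm_le_zero_iff.1 this)
  have hclosed : IsClosed (LinearMap.range T : Set H) := by
    rw [← isSeqClosed_iff_isClosed]
    intro y y0 hy hlim
    choose x hx using hy
    have hc : CauchySeq fun n => (x n : H) := by
      have hc := hlim.cauchySeq
      rw [Metric.cauchySeq_iff'] at hc ⊢
      intro ε hε
      obtain ⟨N, hN⟩ := hc ε hε
      refine ⟨N, fun n hn => lt_of_le_of_lt ?_ (hN n hn)⟩
      rw [dist_eq_norm, dist_eq_norm, ← hx, ← hx, ← map_sub]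
      exact hlow (x n - x N)
    obtain ⟨x0, hx0⟩ := cauchySeq_tendsto_of_complete hc
    have hg : Filter.Tendsto (fun n => G (x n)) Filter.atTop (𝓝 (y0 - x0)) := by
      have := hlim.sub hx0
      refine this.congr fun n => ?_
      rw [← hx, hT]; abel
    have hmem : (x0, y0 - x0) ∈ G.graph :=
      hG.isSelfAdjoint.isClosed.isSeqClosed (x := fun n => ((x n : H), G (x n)))
        (fun n => G.mem_graph (x n)) (hx0.prodMk_nhds hg)
    obtain ⟨z, hz1, hz2⟩ := (LinearPMap.mem_graph_iff _).1 hmem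
    refine ⟨z, ?_⟩
    rw [hT, hz1, hz2]; exact add_sub_cancel x0 y0
  have hsurj : LinearMap.range T = ⊤ := by
    have : CompleteSpace (LinearMap.range T) := hclosed.completeSpace_coe
    rw [← Submodule.orthogonal_eq_bot_iff, Submodule.eq_bot_iff]
    intro y hy
    rw [Submodule.mem_orthogonal'] at hy
    have hy' : ∀ x : G.domain, ⟪-y, (x : H)⟫_ℂ = ⟪y, G x⟫_ℂ := by
      intro x
      have := hy (T x) ⟨x, rfl⟩
      rw [hT, inner_add_right] at this
      rw [inner_neg_left]
      linear_combination -this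
    have hyd : y ∈ G.adjoint.domain := LinearPMap.mem_adjoint_domain_of_exists y ⟨-y, hy'⟩
    have hGy := LinearPMap.adjoint_apply_eq hd ⟨y, hyd⟩ hy'
    have hyg : ∃ h : y ∈ G.domain, G ⟨y, h⟩ = -y := by
      rw [hadj] at hyd
      refine ⟨hyd, ?_⟩
      have h2 := @(LinearPMap.ext_iff.1 hadj.symm).2 y
      exact h2.trans hGy
    obtain ⟨h, hyy⟩ := hyg
    have := hlow ⟨y, h⟩
    rw [hT, hyy] at this
    simpa using this
  let e := LinearEquiv.ofBijective T ⟨hinj, LinearMap.range_eq_top.1 hsurj⟩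
  have he : ∀ y, ((e.symm y : G.domain) : H) + G (e.symm y) = y := fun y =>
    e.apply_symm_apply y
  let R : H →L[ℂ] H := LinearMap.mkContinuous (G.domain.subtype ∘ₗ e.symm.toLinearMap) 1 (by
    intro y
    have h := hlow (e.symm y)
    rw [hT, he] at h
    simpa using h)
  have hR : ∀ y, R y = (e.symm y : G.domain) := fun y => rfl
  have hre : ∀ y, ⟪R y, y⟫_ℂ = ⟪R y, R y⟫_ℂ + ⟪R y, G (e.symm y)⟫_ℂ := by
    intro y
    rw [← inner_add_right, hR, he]
  have hRpos : R.IsPositive := by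
    rw [ContinuousLinearMap.isPositive_def]
    refine ⟨?_, fun y => ?_⟩
    · intro y z
      change ⟪R y, z⟫_ℂ = ⟪y, R z⟫_ℂ
      conv_lhs => rw [← he z]
      conv_rhs => rw [← he y]
      rw [inner_add_left, inner_add_right, hR, hR, hG.inner_symm]
    · rw [ContinuousLinearMap.reApplyInnerSelf_apply, hre]
      have h1 := hG.nonneg (e.symm y)
      have h2 := inner_self_nonneg (𝕜 := ℂ) (x := R y)
      rw [map_add]
      exact add_nonneg h2 h1
  have hR1 : (1 - R).IsPositive := by
    rw [ContinuousLinearMap.isPositive_def]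
    refine ⟨?_, fun y => ?_⟩
    · intro y z
      have := hRpos.isSymmetric y z
      simp only [ContinuousLinearMap.coe_coe] at this
      simp [inner_sub_left, inner_sub_right, this]
    · rw [ContinuousLinearMap.reApplyInnerSelf_apply]
      have h0 : (1 - R) y = G (e.symm y) := by
        change y - R y = _
        rw [hR, sub_eq_iff_eq_add', he]
      have h1 := hG.nonneg (e.symm y)
      have h2 := inner_self_nonneg (𝕜 := ℂ) (x := G (e.symm y))
      have h3 : ⟪(1 - R) y, y⟫_ℂ = ⟪G (e.symm y), G (e.symm y)⟫_ℂ +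
          ⟪((e.symm y : G.domain) : H), G (e.symm y)⟫_ℂ := by
        rw [h0, ← hG.inner_symm, ← inner_add_right, add_comm, he]
      rw [h3, map_add]
      exact add_nonneg h2 h1
  refine ⟨R, (ContinuousLinearMap.nonneg_iff_isPositive R).2 hRpos,
    (ContinuousLinearMap.le_def R 1).2 hR1, fun y => ⟨(e.symm y).2, ?_⟩, fun x => ?_⟩
  · have := he y
    change G (e.symm y) = y - _
    rw [hR, eq_sub_iff_add_eq', this]
  · rw [hR]
    have : e.symm (x + G x) = x := e.symm_apply_apply x
    rw [this]

/-- Every positive self-adjoint operator has a positive square root. -/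
theorem IsPosSelfAdjoint.exists_posSqrt {G : H →ₗ.[ℂ] H} (hG : IsPosSelfAdjoint G) :
    ∃ S : H →ₗ.[ℂ] H, IsPosSqrt S G := by
  obtain ⟨R, hR0, hR1, hRG, hRx⟩ := hG.exists_resolvent
  have hR1' : 0 ≤ 1 - R := sub_nonneg.2 hR1
  let P := CFC.sqrt R
  let Q := CFC.sqrt (1 - R)
  have hPP : ∀ x, P (P x) = R x := fun x => by
    have := CFC.sqrt_mul_sqrt_self R hR0
    exact congrArg (fun T : H →L[ℂ] H => T x) this
  have hQQ : ∀ x, Q (Q x) = x - R x := fun x => by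
    have := CFC.sqrt_mul_sqrt_self (1 - R) hR1'
    exact congrArg (fun T : H →L[ℂ] H => T x) this
  have hcomm : Commute P Q := by
    have h1 : Commute R (1 - R) := (Commute.one_right R).sub_right (Commute.refl R)
    exact ((h1.cfcₙ_nnreal NNReal.sqrt).symm.cfcₙ_nnreal NNReal.sqrt).symm
  have hPQ : ∀ x, P (Q x) = Q (P x) := fun x =>
    congrArg (fun T : H →L[ℂ] H => T x) hcomm.eq
  have hPs : ∀ x y, ⟪P x, y⟫_ℂ = ⟪x, P y⟫_ℂ :=
    ((ContinuousLinearMap.nonneg_iff_isPositive P).1 (CFC.sqrt_nonneg R)).isSymmetric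
  have hQs : ∀ x y, ⟪Q x, y⟫_ℂ = ⟪x, Q y⟫_ℂ :=
    ((ContinuousLinearMap.nonneg_iff_isPositive Q).1 (CFC.sqrt_nonneg (1 - R))).isSymmetric
  have hsum : ∀ x, P (P x) + Q (Q x) = x := fun x => by rw [hPP, hQQ]; abel
  have hRinj : ∀ x, R x = 0 → x = 0 := by
    intro x hx
    obtain ⟨h, h'⟩ := hRG x
    have h0 : (⟨R x, h⟩ : G.domain) = 0 := Subtype.ext hx
    rw [h0, LinearPMap.map_zero, hx, sub_zero] at h'
    exact h'.symm
  have hPinj : Function.Injective P := by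
    rw [injective_iff_map_eq_zero]
    intro x hx
    exact hRinj x (by rw [← hPP, hx, map_zero])
  let e := LinearEquiv.ofInjective P.toLinearMap hPinj
  let S : H →ₗ.[ℂ] H := ⟨LinearMap.range P.toLinearMap, Q.toLinearMap ∘ₗ e.symm.toLinearMap⟩
  have hmem : ∀ x, P x ∈ S.domain := fun x => ⟨x, rfl⟩
  have hS : ∀ (x : H) (h : P x ∈ S.domain), S ⟨P x, h⟩ = Q x := by
    intro x h
    change Q (e.symm ⟨P x, h⟩) = Q x
    have : e.symm ⟨P x, h⟩ = x := by
      rw [LinearEquiv.symm_apply_eq]; rfl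
    rw [this]
  have hS' : ∀ y : S.domain, ∃ x, (y : H) = P x ∧ S y = Q x := by
    rintro ⟨y, hy⟩
    obtain ⟨x, hx⟩ := id hy
    change P x = y at hx
    subst hx
    exact ⟨x, rfl, hS x hy⟩
  have hdense : Dense (S.domain : Set H) := by
    rw [Submodule.dense_iff_topologicalClosure_eq_top,
      Submodule.topologicalClosure_eq_top_iff, Submodule.eq_bot_iff]
    intro y hy
    rw [Submodule.mem_orthogonal'] at hy
    apply hPinj
    rw [map_zero]
    have := hy _ (hmem (P y))
    rw [← hPs, inner_self_eq_zero] at this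
    exact this
  have hsym : S.IsFormalAdjoint S := by
    intro x' y'
    obtain ⟨x, hx, hSx⟩ := hS' x'
    obtain ⟨y, hy, hSy⟩ := hS' y'
    rw [hSx, hSy, hx, hy, hQs, hPs, hPQ]
  have hsa : IsSelfAdjoint S := by
    rw [LinearPMap.isSelfAdjoint_def]
    refine le_antisymm ?_ (hsym.le_adjoint hdense)
    have key : ∀ y : S.adjoint.domain,
        (y : H) = P (P y + Q (S.adjoint y)) ∧ S.adjoint y = Q (P y + Q (S.adjoint y)) := by
      intro y
      have h1 : P (S.adjoint y) = Q y := by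
        apply ext_inner_right ℂ
        intro z
        have := LinearPMap.adjoint_isFormalAdjoint hdense y ⟨P z, hmem z⟩
        rw [hS] at this
        rw [hPs, hQs]
        exact this
      constructor
      · rw [map_add, hPQ, h1, hsum]
      · rw [map_add, ← hPQ, ← h1, hsum]
    refine ⟨fun y hy => ?_, ?_⟩
    · have h := (key ⟨y, hy⟩).1
      change y = _ at h
      rw [h]; exact hmem _
    · rintro y ⟨z, hz⟩ hyz
      have h1 : (⟨z, hz⟩ : S.domain) = ⟨P (P y + Q (S.adjoint y)), hmem _⟩ :=
        Subtype.ext (hyz.symm.trans (key y).1)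
      rw [h1, hS]
      exact (key y).2
  have hpos : IsPosSelfAdjoint S := by
    refine ⟨hsa, ?_⟩
    intro x'
    obtain ⟨x, hx, hSx⟩ := hS' x'
    rw [hSx, hx]
    have hPQ0 : 0 ≤ P * Q := hcomm.mul_nonneg (CFC.sqrt_nonneg R) (CFC.sqrt_nonneg (1 - R))
    have := ((ContinuousLinearMap.nonneg_iff_isPositive _).1 hPQ0).re_inner_nonneg_right x
    rw [hPs]
    exact this
  have hdom : ∀ (x : H) (hx : x ∈ S.domain), S ⟨x, hx⟩ ∈ S.domain → ∃ z, x = R z := by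
    intro y hy hSy
    obtain ⟨x, hx, hSx⟩ := hS' ⟨y, hy⟩
    obtain ⟨z, hz, -⟩ := hS' ⟨_, hSy⟩
    change S ⟨y, hy⟩ = P z at hz
    change y = P x at hx
    rw [hSx] at hz
    refine ⟨P x + Q z, ?_⟩
    rw [hx, ← hPP]
    congr 1
    rw [map_add, hPQ, ← hz, hsum]
  refine ⟨S, hpos, fun x => ⟨fun hx => ?_, ?_⟩, ?_⟩
  · have hx' := hRx ⟨x, hx⟩
    rw [← hPP] at hx'
    change P (P _) = x at hx'
    rw [← hx']
    refine ⟨hmem _, ?_⟩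
    rw [hS, ← hPQ]
    exact hmem _
  · rintro ⟨hx, hSx⟩
    obtain ⟨z, rfl⟩ := hdom x hx hSx
    exact (hRG z).1
  · rintro ⟨x, hxG⟩ hx hSx
    obtain ⟨z, rfl⟩ := hdom x hx hSx
    have h1 : (⟨R z, hx⟩ : S.domain) = ⟨P (P z), hmem _⟩ := Subtype.ext (hPP z).symm
    have h2 : S ⟨R z, hx⟩ = P (Q z) := by rw [h1, hS, hPQ]
    have h3 : (⟨S ⟨R z, hx⟩, hSx⟩ : S.domain) = ⟨P (Q z), hmem _⟩ := Subtype.ext h2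
    rw [h3, hS, hQQ]
    exact (hRG z).2

/-- The positive square root `√G` of a positive self-adjoint operator `G`. -/
noncomputable def sqrtOp (G : H →ₗ.[ℂ] H) (hG : IsPosSelfAdjoint G) : H →ₗ.[ℂ] H :=
  hG.exists_posSqrt.choose

theorem sqrtOp_spec (G : H →ₗ.[ℂ] H) (hG : IsPosSelfAdjoint G) : IsPosSqrt (sqrtOp G hG) G :=
  hG.exists_posSqrt.choose_spec

end Sqrt

section Trace

variable {H : Type*} [NormedAddCommGroup H] [InnerProductSpace ℂ H] [CompleteSpace H]

/-- A fixed orthonormal basis of `H`; the traces below do not depend on it. -/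
noncomputable def stdBasis (H : Type*) [NormedAddCommGroup H] [InnerProductSpace ℂ H]
    [CompleteSpace H] : HilbertBasis (exists_hilbertBasis ℂ H).choose ℂ H :=
  (exists_hilbertBasis ℂ H).choose_spec.choose

/-- The trace `Tr X = ∑ᵢ ⟨eᵢ, X eᵢ⟩` (of a trace class operator `X`). -/
noncomputable def opTrace (X : H →L[ℂ] H) : ℂ :=
  ∑' i, ⟪stdBasis H i, X (stdBasis H i)⟫_ℂ

/-- `ρ` is a positive trace class operator. -/
def IsPosTraceClass (ρ : H →L[ℂ] H) : Prop :=
  0 ≤ ρ ∧ Summable fun i => ⟪stdBasis H i, ρ (stdBasis H i)⟫_ℂ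

/-- `ρ` is a state: a positive trace class operator of unit trace. -/
def IsState (ρ : H →L[ℂ] H) : Prop :=
  IsPosTraceClass ρ ∧ opTrace ρ = 1

open scoped Classical in
/-- `‖T φ‖² ∈ [0, ∞]`, which is `∞` for `φ` outside the domain of `T`. -/
noncomputable def sqNorm (T : H →ₗ.[ℂ] H) (φ : H) : ℝ≥0∞ :=
  if h : φ ∈ T.domain then ‖T ⟨φ, h⟩‖ₑ ^ 2 else ⊤

/-- `Tr T ρ T* ∈ [0, ∞]` for a positive operator `ρ`, computed as `∑ᵢ ‖T φᵢ‖²` from the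
decomposition `ρ = ∑ᵢ |φᵢ⟩⟨φᵢ|` with `φᵢ = √ρ eᵢ`. -/
noncomputable def trConj (T : H →ₗ.[ℂ] H) (ρ : H →L[ℂ] H) : ℝ≥0∞ :=
  ∑' i, sqNorm T (CFC.sqrt ρ (stdBasis H i))

/-- The energy `Tr G ρ ∈ [0, ∞]` of a positive operator `ρ`, i.e. `Tr √G ρ √G`. -/
noncomputable def energy (G : H →ₗ.[ℂ] H) (hG : IsPosSelfAdjoint G) (ρ : H →L[ℂ] H) : ℝ≥0∞ :=
  trConj (sqrtOp G hG) ρ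

end Trace

section RelBounded

variable {H : Type*} [NormedAddCommGroup H] [InnerProductSpace ℂ H]

/-- `‖A φ‖² ≤ a² ‖φ‖² + b² ‖S φ‖²` for all `φ` in the domain of `S`. -/
def RelBoundedWith (S : H →ₗ.[ℂ] H) (A : S.domain →ₗ[ℂ] H) (a b : ℝ) : Prop :=
  ∀ φ : S.domain, ‖A φ‖ ^ 2 ≤ a ^ 2 * ‖(φ : H)‖ ^ 2 + b ^ 2 * ‖S φ‖ ^ 2

/-- The linear space of `S`-bounded operators, where operators that coincide on the domain of `S`
are identified. -/
def relBounded (S : H →ₗ.[ℂ] H) : Submodule ℂ (S.domain →ₗ[ℂ] H) where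
  carrier := {A | ∃ a b : ℝ, 0 ≤ a ∧ 0 ≤ b ∧ RelBoundedWith S A a b}
  zero_mem' := ⟨0, 0, le_rfl, le_rfl, fun φ => by simp⟩
  add_mem' := by
    rintro A B ⟨a, b, ha, hb, hA⟩ ⟨c, d, hc, hd, hB⟩
    refine ⟨2 * (a + c), 2 * (b + d), by positivity, by positivity, fun φ => ?_⟩
    have h1 : ‖(A + B) φ‖ ≤ ‖A φ‖ + ‖B φ‖ := norm_add_le _ _
    have h2 : ‖(A + B) φ‖ ^ 2 ≤ (‖A φ‖ + ‖B φ‖) ^ 2 := pow_le_pow_left₀ (norm_nonneg _) h1 2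
    have h3 : (0 : ℝ) ≤ (4 * (a + c) ^ 2 - 2 * a ^ 2 - 2 * c ^ 2) * ‖(φ : H)‖ ^ 2 :=
      mul_nonneg (by nlinarith [mul_nonneg ha hc]) (sq_nonneg _)
    have h4 : (0 : ℝ) ≤ (4 * (b + d) ^ 2 - 2 * b ^ 2 - 2 * d ^ 2) * ‖S φ‖ ^ 2 :=
      mul_nonneg (by nlinarith [mul_nonneg hb hd]) (sq_nonneg _)
    nlinarith [hA φ, hB φ, sq_nonneg (‖A φ‖ - ‖B φ‖)]
  smul_mem' := by
    rintro c A ⟨a, b, ha, hb, hA⟩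
    refine ⟨‖c‖ * a, ‖c‖ * b, by positivity, by positivity, fun φ => ?_⟩
    have h := mul_le_mul_of_nonneg_left (hA φ) (sq_nonneg ‖c‖)
    rw [LinearMap.smul_apply, norm_smul]
    nlinarith

/-- The restriction of a bounded operator to the domain of `S`, as an `S`-bounded operator. -/
def ofBounded (S : H →ₗ.[ℂ] H) (A : H →L[ℂ] H) : relBounded S :=
  ⟨A.toLinearMap.domRestrict S.domain, ‖A‖, 0, norm_nonneg _, le_rfl, fun φ => by
    have h := pow_le_pow_left₀ (norm_nonneg _) (A.le_opNorm (φ : H)) 2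
    simpa [mul_pow] using h⟩

/-- The `S`-bound of an `S`-bounded operator. -/
noncomputable def relBound (S : H →ₗ.[ℂ] H) (A : relBounded S) : ℝ :=
  sInf {b | 0 ≤ b ∧ ∃ a, 0 ≤ a ∧ RelBoundedWith S A.1 a b}

variable [CompleteSpace H]

/-- The space of `√G`-bounded operators. -/
noncomputable abbrev BG (G : H →ₗ.[ℂ] H) (hG : IsPosSelfAdjoint G) : Submodule ℂ ((sqrtOp G hG).domain →ₗ[ℂ] H) :=
  relBounded (sqrtOp G hG)

/-- The operator `E`-norm `‖A‖_E^G`, the supremum of `√(Tr A ρ A*)` over all states `ρ` with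
`Tr G ρ ≤ E`. For a `√G`-bounded operator `A` these numbers are finite and bounded above. -/
noncomputable def eNorm (G : H →ₗ.[ℂ] H) (hG : IsPosSelfAdjoint G) (E : ℝ) (A : BG G hG) : ℝ :=
  sSup {r | ∃ ρ : H →L[ℂ] H, IsState ρ ∧ energy G hG ρ ≤ ENNReal.ofReal E ∧
    r = √(trConj ⟨(sqrtOp G hG).domain, A.1⟩ ρ).toReal}

end RelBounded

section Maps

variable {H : Type*} [NormedAddCommGroup H] [InnerProductSpace ℂ H] [CompleteSpace H]

/-- Normality: `Φ (sup A_λ) = sup Φ (A_λ)` for increasing nets of operators. -/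
def IsNormalMap (Φ : (H →L[ℂ] H) →CP (H →L[ℂ] H)) : Prop :=
  ∀ s : Set (H →L[ℂ] H), s.Nonempty → DirectedOn (· ≤ ·) s →
    ∀ A, IsLUB s A → IsLUB (Φ '' s) (Φ A)

/-- `σ = Φ_*(ρ)` for a positive trace class operator `ρ`: the operator `σ` is positive and trace
class and `Tr σ A = Tr Φ(A) ρ` for all bounded `A`. -/
def IsPredualAt (Φ : (H →L[ℂ] H) →CP (H →L[ℂ] H)) (ρ σ : H →L[ℂ] H) : Prop :=
  IsPosTraceClass σ ∧ ∀ A : H →L[ℂ] H, opTrace (σ * A) = opTrace (Φ A * ρ)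

/-- The predual map `Φ_*` on positive trace class operators (`σ` as above exists, since `Φ` is
normal, and is unique). -/
noncomputable def predual (Φ : (H →L[ℂ] H) →CP (H →L[ℂ] H)) (ρ : H →L[ℂ] H) : H →L[ℂ] H :=
  Classical.epsilon (IsPredualAt Φ ρ)

/-- `Φ` is `G`-limited: `Φ_*` maps states of finite energy to operators of finite energy. -/
def IsLimited (Φ : (H →L[ℂ] H) →CP (H →L[ℂ] H)) (G : H →ₗ.[ℂ] H) (hG : IsPosSelfAdjoint G) :
    Prop :=
  ∀ ρ, IsState ρ → energy G hG ρ < ⊤ → energy G hG (predual Φ ρ) < ⊤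

/-- `Y_Φ(E) = sup {Tr G Φ_*(ρ) | ρ a state, Tr G ρ ≤ E}`. -/
noncomputable def maxEnergy (Φ : (H →L[ℂ] H) →CP (H →L[ℂ] H)) (G : H →ₗ.[ℂ] H)
    (hG : IsPosSelfAdjoint G) (E : ℝ) : ℝ≥0∞ :=
  ⨆ (ρ : H →L[ℂ] H) (_ : IsState ρ) (_ : energy G hG ρ ≤ ENNReal.ofReal E),
    energy G hG (predual Φ ρ)

/-- Continuity of `Φ` on the bounded operators with respect to the norm `‖·‖_E^G`. -/
def IsENormContinuous (Φ : (H →L[ℂ] H) →CP (H →L[ℂ] H)) (G : H →ₗ.[ℂ] H)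
    (hG : IsPosSelfAdjoint G) (E : ℝ) : Prop :=
  ∀ A₀ : H →L[ℂ] H, ∀ ε > 0, ∃ δ > 0, ∀ A : H →L[ℂ] H,
    eNorm G hG E (ofBounded _ (A - A₀)) < δ → eNorm G hG E (ofBounded _ (Φ A - Φ A₀)) < ε

/-- `G = ∑ₖ Eₖ |τₖ⟩⟨τₖ|` with an orthonormal basis `τₖ` and a nondecreasing sequence of eigenvalues
`Eₖ` tending to infinity. -/
def IsDiscreteOp (G : H →ₗ.[ℂ] H) : Prop :=
  ∃ (τ : HilbertBasis ℕ ℂ H) (ev : ℕ → ℝ), Monotone ev ∧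
    Filter.Tendsto ev Filter.atTop Filter.atTop ∧
    (∀ φ : H, φ ∈ G.domain ↔ Summable fun k => ev k ^ 2 * ‖⟪τ k, φ⟫_ℂ‖ ^ 2) ∧
    ∀ φ : G.domain, HasSum (fun k => ((ev k : ℂ) * ⟪τ k, (φ : H)⟫_ℂ) • τ k) (G φ)

end Maps

section Stinespring

variable {H : Type*} [NormedAddCommGroup H] [InnerProductSpace ℂ H]

/-- The Hilbert space tensor product `H ⊗ K`: the completion of the algebraic one. -/
abbrev HTensor (H K : Type*) [NormedAddCommGroup H] [InnerProductSpace ℂ H]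
    [NormedAddCommGroup K] [InnerProductSpace ℂ K] : Type _ :=
  UniformSpace.Completion (H ⊗[ℂ] K)

/-- The vector `φ ⊗ ψ` in the Hilbert space tensor product. -/
noncomputable def pureTensor {K : Type*} [NormedAddCommGroup K] [InnerProductSpace ℂ K] (φ : H) (ψ : K) :
    HTensor H K :=
  ((φ ⊗ₜ[ℂ] ψ : H ⊗[ℂ] K) : HTensor H K)

/-- The bounded operator `A ⊗ I_K` for a bounded operator `A`. -/
noncomputable def ampl (K : Type*) [NormedAddCommGroup K] [InnerProductSpace ℂ K]
    (A : H →L[ℂ] H) : HTensor H K →L[ℂ] HTensor H K :=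
  (UniformSpace.Completion.toComplL.comp (A.rTensor K)).extend
    (UniformSpace.Completion.toComplL : H ⊗[ℂ] K →L[ℂ] HTensor H K)

/-- The operator `T ⊗ I_K` on the linear span of the vectors `φ ⊗ ψ` with `φ` in the domain of an
unbounded operator `T`. -/
noncomputable def algAmpl (K : Type*) [NormedAddCommGroup K] [InnerProductSpace ℂ K]
    (T : H →ₗ.[ℂ] H) : HTensor H K →ₗ.[ℂ] HTensor H K :=
  (Submodule.span ℂ {p : HTensor H K × HTensor H K | ∃ (φ : T.domain) (ψ : K),
    p = (pureTensor (φ : H) ψ, pureTensor (T φ) ψ)}).toLinearPMap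

/-- The closed operator `S ⊗ I_K`, for a closed operator `S`. -/
noncomputable def closedAmpl (K : Type*) [NormedAddCommGroup K] [InnerProductSpace ℂ K]
    (S : H →ₗ.[ℂ] H) : HTensor H K →ₗ.[ℂ] HTensor H K :=
  (algAmpl K S).closure

/-- `B` is an `S ⊗ I_K`-bounded extension of `A ⊗ I_K` to the domain of `S ⊗ I_K`, where `A` is an
operator defined on the domain of `S`. -/
def IsRelAmpl (K : Type*) [NormedAddCommGroup K] [InnerProductSpace ℂ K] (S : H →ₗ.[ℂ] H)
    (A : S.domain →ₗ[ℂ] H) (B : (closedAmpl K S).domain →ₗ[ℂ] HTensor H K) : Prop :=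
  B ∈ relBounded (closedAmpl K S) ∧ algAmpl K ⟨S.domain, A⟩ ≤ ⟨(closedAmpl K S).domain, B⟩

variable [CompleteSpace H] {K : Type*} [NormedAddCommGroup K] [InnerProductSpace ℂ K]

/-- Stinespring representation `Φ(A) = V* (A ⊗ I_K) V`. -/
def IsStinespring (Φ : (H →L[ℂ] H) →CP (H →L[ℂ] H)) (V : H →L[ℂ] HTensor H K) : Prop :=
  ∀ A : H →L[ℂ] H, Φ A = V.adjoint ∘L ampl K A ∘L V

/-- Minimality: the linear span of the vectors `(A ⊗ I_K) V φ` is dense. -/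
def IsMinimalStinespring (Φ : (H →L[ℂ] H) →CP (H →L[ℂ] H)) (V : H →L[ℂ] HTensor H K) : Prop :=
  IsStinespring Φ V ∧ Dense (Submodule.span ℂ
    {x : HTensor H K | ∃ (A : H →L[ℂ] H) (φ : H), x = ampl K A (V φ)} : Set (HTensor H K))

/-- The space `K` of a minimal Stinespring representation has finite dimension. -/
def HasFiniteChoiRank (Φ : (H →L[ℂ] H) →CP (H →L[ℂ] H)) : Prop :=
  ∃ (K : Type) (_ : NormedAddCommGroup K) (_ : InnerProductSpace ℂ K)
    (V : H →L[ℂ] HTensor H K), FiniteDimensional ℂ K ∧ IsMinimalStinespring Φ V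

/-- The map `Ψ` on `S`-bounded operators is given by the formula `Ψ(A) = V* (A ⊗ I_K) V`: every
`A ⊗ I_K` has a unique `S ⊗ I_K`-bounded extension `B` to the domain of `S ⊗ I_K`, the operator `V`
maps the domain of `S` to that of `S ⊗ I_K`, and `Ψ(A) φ = V* B V φ` on the domain of `S`. -/
def IsGivenBy (S : H →ₗ.[ℂ] H) (V : H →L[ℂ] HTensor H K) (Ψ : relBounded S → relBounded S) :
    Prop :=
  ∀ A : relBounded S, (∃! B, IsRelAmpl K S A.1 B) ∧
    ∀ B, IsRelAmpl K S A.1 B → ∀ φ : S.domain,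
      ∃ h : V φ ∈ (closedAmpl K S).domain, (Ψ A).1 φ = V.adjoint (B ⟨V φ, h⟩)

end Stinespring

end EnergyOp

open EnergyOp

set_option linter.unusedSectionVars false

/-! Write S = √G, R = (1 + S)⁻¹ and Q = 1 - R. Then 0 ≤ Q ≤ 1, R is injective, and S = Q + Q² + ...
on D(S), so ‖Sφ‖² = ∑ ⟨φ, Q^(i+j+2) φ⟩ over all i, j ≥ 0, with value ∞ exactly off D(S)
(`IsResolventCompl.sqNorm_eq`). The energy of ρ is thus a countable sum of traces of ρ against
bounded positive operators; it is additive in ρ and can be carried through Φ_* term by term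
(`IsResolventCompl.trConj_predual`).

S-bounded operators A correspond bijectively to bounded operators AR (`lift`). If ρ has finite
energy, then √ρ = RW with W Hilbert–Schmidt, and Tr AρA* is the squared Hilbert–Schmidt norm of
(AR)W (`IsResolventCompl.exists_factor`).

For (A), Banach–Steinhaus turns finiteness of the output energy on pure states into a uniform bound,
hence Y_Φ(E) < ∞. The extension is the strong limit of Φ(A(1 - Qⁿ)) on D(S). The Kadison–Schwarz
inequality gives Tr Φ(A)ρΦ(A)* ≤ ‖Φ(I)‖ Tr AΦ_*(ρ)A*, both for convergence and in the limit
(`IsResolventCompl.trConj_extend_le`). Mixing with a pure state of arbitrarily small energy replaces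
concavity: it shows that Y_Φ(E)/E is nonincreasing and lets operators of trace at most one stand in
for states; the bounds in 2 and 3 follow. For the Stinespring formula, the closure of S ⊗ I again
has the form treated above, with Q ⊗ I in place of Q (`IsResolventCompl.closedAmpl`), so the
extension of A ⊗ I corresponds to the bounded operator AR ⊗ I.

For (B), the operators |ψ⟩⟨Sχ| have E-norm at most √E ‖χ‖ ‖ψ‖. Continuity of Φ therefore makes χ ↦
⟨Φ_*(|φ⟩⟨φ|)ψ, Sχ⟩ bounded, so Φ_*(|φ⟩⟨φ|) has range in D(S* ) = D(S). The additional assumption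
makes this range finite-dimensional, so the output energy of pure states is finite, and the uniform
bound extends this to all states. -/

namespace EnergyOp

/-! ### Powers of a positive contraction and the quadratic form of (1 - Q)⁻¹ - 1. -/

section Contraction

variable {X : Type*} [NormedAddCommGroup X] [InnerProductSpace ℂ X] [CompleteSpace X]

theorem re_inner_nonneg_of_nonneg {B : X →L[ℂ] X} (hB : 0 ≤ B) (x : X) : 0 ≤ (⟪x, B x⟫_ℂ).re :=
  ((ContinuousLinearMap.nonneg_iff_isPositive B).1 hB).re_inner_nonneg_right x

theorem inner_symm_of_nonneg {B : X →L[ℂ] X} (hB : 0 ≤ B) (x y : X) : ⟪B x, y⟫_ℂ = ⟪x, B y⟫_ℂ :=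
  ((ContinuousLinearMap.nonneg_iff_isPositive B).1 hB).isSymmetric x y

/-- The quadratic form of an operator with values in `[0, ∞]`. -/
noncomputable def quad (B : X →L[ℂ] X) (x : X) : ℝ≥0∞ := ENNReal.ofReal (⟪x, B x⟫_ℂ).re

theorem enorm_sq_eq_ofReal {E : Type*} [NormedAddCommGroup E] (x : E) :
    ‖x‖ₑ ^ 2 = ENNReal.ofReal (‖x‖ ^ 2) := by
  rw [ENNReal.ofReal_pow (norm_nonneg x), ofReal_norm]

theorem re_inner_self_eq (x : X) : (⟪x, x⟫_ℂ).re = ‖x‖ ^ 2 := by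
  have := inner_self_eq_norm_sq (𝕜 := ℂ) x
  simpa using this

theorem quad_star_mul_self (T : X →L[ℂ] X) (x : X) : quad (star T * T) x = ‖T x‖ₑ ^ 2 := by
  have h : ⟪x, (star T * T) x⟫_ℂ = ⟪T x, T x⟫_ℂ := by
    change ⟪x, (ContinuousLinearMap.adjoint T) (T x)⟫_ℂ = _
    rw [ContinuousLinearMap.adjoint_inner_right]
  rw [quad, enorm_sq_eq_ofReal, h, re_inner_self_eq]

theorem norm_sqrt_apply_sq {B : X →L[ℂ] X} (hB : 0 ≤ B) (x : X) :
    ‖CFC.sqrt B x‖ ^ 2 = (⟪x, B x⟫_ℂ).re := by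
  have h : CFC.sqrt B (CFC.sqrt B x) = B x :=
    congrArg (fun T : X →L[ℂ] X => T x) (CFC.sqrt_mul_sqrt_self B hB)
  rw [← h, ← inner_symm_of_nonneg (CFC.sqrt_nonneg B), re_inner_self_eq]

theorem enorm_sqrt_apply_sq {B : X →L[ℂ] X} (hB : 0 ≤ B) (x : X) :
    ‖CFC.sqrt B x‖ₑ ^ 2 = quad B x := by
  rw [enorm_sq_eq_ofReal, norm_sqrt_apply_sq hB, quad]

theorem quad_sum {ι : Type*} (s : Finset ι) {B : ι → X →L[ℂ] X} (hB : ∀ i, 0 ≤ B i) (x : X) :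
    quad (∑ i ∈ s, B i) x = ∑ i ∈ s, quad (B i) x := by
  simp only [quad]
  rw [← ENNReal.ofReal_sum_of_nonneg fun i _ => re_inner_nonneg_of_nonneg (hB i) x]
  congr 1
  rw [sum_apply, inner_sum, Complex.re_sum]

theorem quad_mono {B C : X →L[ℂ] X} (h : B ≤ C) (x : X) : quad B x ≤ quad C x := by
  apply ENNReal.ofReal_le_ofReal
  have := re_inner_nonneg_of_nonneg (sub_nonneg.2 h) x
  rw [sub_apply, inner_sub_right, Complex.sub_re] at this
  linarith

theorem opNorm_le_one_of_nonneg_le_one {Q : X →L[ℂ] X} (h0 : 0 ≤ Q) (h1 : Q ≤ 1) : ‖Q‖ ≤ 1 := by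
  rw [CStarAlgebra.norm_le_one_iff_of_nonneg Q h0]
  exact h1

theorem norm_pow_apply_le {Q : X →L[ℂ] X} (h0 : 0 ≤ Q) (h1 : Q ≤ 1) (n : ℕ) (x : X) :
    ‖(Q ^ n) x‖ ≤ ‖x‖ := by
  have h := opNorm_le_one_of_nonneg_le_one (CStarAlgebra.pow_nonneg h0 n)
    ((CStarAlgebra.pow_antitone h0 h1 (Nat.zero_le n)).trans_eq (pow_zero Q))
  simpa using (Q ^ n).le_of_opNorm_le h x

theorem denseRange_of_nonneg_of_injective {R : X →L[ℂ] X} (h0 : 0 ≤ R)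
    (hR : Function.Injective R) : DenseRange R := by
  have h : Dense (LinearMap.range R.toLinearMap : Set X) := by
    rw [Submodule.dense_iff_topologicalClosure_eq_top,
      Submodule.topologicalClosure_eq_top_iff, Submodule.eq_bot_iff]
    intro y hy
    rw [Submodule.mem_orthogonal'] at hy
    apply hR
    have := hy (R (R y)) ⟨R y, rfl⟩
    rw [← inner_symm_of_nonneg h0, inner_self_eq_zero] at this
    rw [this, map_zero]
  exact h

theorem inner_pow_apply {Q : X →L[ℂ] X} (h0 : 0 ≤ Q) (m n : ℕ) (x y : X) :
    ⟪(Q ^ m) x, (Q ^ n) y⟫_ℂ = ⟪x, (Q ^ (m + n)) y⟫_ℂ := by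
  rw [inner_symm_of_nonneg (CStarAlgebra.pow_nonneg h0 m), pow_add]
  rfl

/-- The numbers ⟨z, Qⁿz⟩ decrease and hence converge, and ‖Qⁿ(1 - Q)z‖² is a second difference of
them, so it tends to 0. The range of 1 - Q is dense, and ‖Qⁿ‖ ≤ 1 carries the convergence to every
vector. -/
theorem tendsto_pow_apply_zero {Q : X →L[ℂ] X} (h0 : 0 ≤ Q) (h1 : Q ≤ 1)
    (hinj : Function.Injective (1 - Q : X →L[ℂ] X)) (y : X) :
    Filter.Tendsto (fun n => (Q ^ n) y) Filter.atTop (𝓝 0) := by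
  have hrange : ∀ z : X, Filter.Tendsto (fun n => (Q ^ n) ((1 - Q : X →L[ℂ] X) z))
      Filter.atTop (𝓝 0) := by
    intro z
    let a : ℕ → ℝ := fun n => (⟪z, (Q ^ n) z⟫_ℂ).re
    have hanti : Antitone a := by
      intro m n hmn
      have h := re_inner_nonneg_of_nonneg (sub_nonneg.2 (CStarAlgebra.pow_antitone h0 h1 hmn)) z
      simp only [sub_apply, inner_sub_right, Complex.sub_re] at h
      exact sub_nonneg.1 h
    have hbdd : BddBelow (Set.range a) :=
      ⟨0, by rintro _ ⟨n, rfl⟩; exact re_inner_nonneg_of_nonneg (CStarAlgebra.pow_nonneg h0 n) z⟩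
    obtain ⟨l, hl⟩ : ∃ l, Filter.Tendsto a Filter.atTop (𝓝 l) :=
      ⟨_, tendsto_atTop_ciInf hanti hbdd⟩
    have heq : ∀ n, ‖(Q ^ n) ((1 - Q : X →L[ℂ] X) z)‖ ^ 2
        = a (2 * n) - 2 * a (2 * n + 1) + a (2 * n + 2) := by
      intro n
      have h2 : (Q ^ n) ((1 - Q : X →L[ℂ] X) z) = (Q ^ n) z - (Q ^ (n + 1)) z := by
        rw [sub_apply, map_sub, pow_succ]; rfl
      rw [← re_inner_self_eq, h2, inner_sub_left, inner_sub_right, inner_sub_right,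
        inner_pow_apply h0, inner_pow_apply h0, inner_pow_apply h0, inner_pow_apply h0]
      have e1 : n + n = 2 * n := by ring
      have e2 : n + (n + 1) = 2 * n + 1 := by ring
      have e3 : n + 1 + n = 2 * n + 1 := by ring
      have e4 : n + 1 + (n + 1) = 2 * n + 2 := by ring
      rw [e1, e2, e3, e4]
      simp only [Complex.sub_re, a]
      ring
    have hlim : Filter.Tendsto (fun n => a (2 * n) - 2 * a (2 * n + 1) + a (2 * n + 2))
        Filter.atTop (𝓝 (l - 2 * l + l)) := by
      have t : ∀ c, Filter.Tendsto (fun n : ℕ => 2 * n + c) Filter.atTop Filter.atTop := fun c =>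
        Filter.tendsto_atTop_mono (fun n => by simp only [id]; omega) Filter.tendsto_id
      exact ((hl.comp (t 0)).sub ((hl.comp (t 1)).const_mul 2)).add (hl.comp (t 2))
    rw [tendsto_zero_iff_norm_tendsto_zero]
    have h3 : Filter.Tendsto (fun n => ‖(Q ^ n) ((1 - Q : X →L[ℂ] X) z)‖ ^ 2)
        Filter.atTop (𝓝 0) := by
      have : l - 2 * l + l = 0 := by ring
      rw [this] at hlim
      exact hlim.congr fun n => (heq n).symm
    have h4 := (Real.continuous_sqrt.tendsto 0).comp h3
    rw [Real.sqrt_zero] at h4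
    refine h4.congr fun n => ?_
    simp [Real.sqrt_sq]
  have hd := denseRange_of_nonneg_of_injective (sub_nonneg.2 h1) hinj
  rw [Metric.tendsto_atTop]
  intro ε hε
  obtain ⟨z, hz⟩ := Metric.denseRange_iff.1 hd y (ε / 2) (by positivity)
  obtain ⟨N, hN⟩ := Metric.tendsto_atTop.1 (hrange z) (ε / 2) (by positivity)
  refine ⟨N, fun n hn => ?_⟩
  have h2 := hN n hn
  rw [dist_zero_right] at h2 ⊢
  have h3 : (Q ^ n) y = (Q ^ n) (y - (1 - Q : X →L[ℂ] X) z) + (Q ^ n) ((1 - Q : X →L[ℂ] X) z) := by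
    rw [← map_add, sub_add_cancel]
  have h4 := norm_pow_apply_le h0 h1 n (y - (1 - Q : X →L[ℂ] X) z)
  rw [dist_eq_norm] at hz
  rw [h3]
  refine (norm_add_le _ _).trans_lt ?_
  linarith

/-- The partial sums of the Neumann series of `(1 - Q)⁻¹`. -/
noncomputable def neumann (Q : X →L[ℂ] X) (n : ℕ) : X →L[ℂ] X := ∑ k ∈ Finset.range n, Q ^ k

theorem neumann_mul_one_sub (Q : X →L[ℂ] X) (n : ℕ) : neumann Q n * (1 - Q) = 1 - Q ^ n :=
  geom_sum_mul_neg Q n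

theorem one_sub_mul_neumann (Q : X →L[ℂ] X) (n : ℕ) : (1 - Q) * neumann Q n = 1 - Q ^ n :=
  mul_neg_geom_sum Q n

/-- The case l = 1 approximates the form of S; the case l = 0 gives the Gram matrix of the partial
sums. All terms on the right are nonnegative. -/
theorem inner_neumann {Q : X →L[ℂ] X} (h0 : 0 ≤ Q) (l m n : ℕ) (x : X) :
    (⟪(Q ^ l) (neumann Q m x), (Q ^ l) (neumann Q n x)⟫_ℂ).re =
      ∑ p ∈ Finset.range m ×ˢ Finset.range n, (⟪x, (Q ^ (p.1 + p.2 + 2 * l)) x⟫_ℂ).re := by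
  simp only [neumann, sum_apply, map_sum]
  rw [sum_inner, Complex.re_sum, Finset.sum_product]
  refine Finset.sum_congr rfl fun i _ => ?_
  rw [inner_sum, Complex.re_sum]
  refine Finset.sum_congr rfl fun j _ => ?_
  have h : ∀ i, (Q ^ l) ((Q ^ i) x) = (Q ^ (i + l)) x := fun i => by
    rw [add_comm, pow_add]; rfl
  rw [h, h, inner_pow_apply h0]
  congr 3
  congr 1
  ring

theorem tendsto_range_prod_range_atTop :
    Filter.Tendsto (fun n => Finset.range n ×ˢ Finset.range n) Filter.atTop
      (Filter.atTop : Filter (Finset (ℕ × ℕ))) := by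
  refine Filter.tendsto_atTop_finset_of_monotone ?_ ?_
  · intro m n h
    exact Finset.product_subset_product (Finset.range_mono h) (Finset.range_mono h)
  · rintro ⟨i, j⟩
    refine ⟨i + j + 1, ?_⟩
    simp only [Finset.mem_product, Finset.mem_range]
    omega

theorem enorm_pow_neumann_sq {Q : X →L[ℂ] X} (h0 : 0 ≤ Q) (l n : ℕ) (x : X) :
    ‖(Q ^ l) (neumann Q n x)‖ₑ ^ 2 =
      ∑ p ∈ Finset.range n ×ˢ Finset.range n, quad (Q ^ (p.1 + p.2 + 2 * l)) x := by
  rw [enorm_sq_eq_ofReal, ← re_inner_self_eq, inner_neumann h0, ENNReal.ofReal_sum_of_nonneg]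
  · rfl
  · exact fun p _ => re_inner_nonneg_of_nonneg (CStarAlgebra.pow_nonneg h0 _) x

/-- The energy form of `S = (1 - Q)⁻¹ - 1` on the range of `1 - Q`. -/
theorem tsum_quad_one_sub_apply {Q : X →L[ℂ] X} (h0 : 0 ≤ Q) (h1 : Q ≤ 1)
    (hinj : Function.Injective (1 - Q : X →L[ℂ] X)) (y : X) :
    ∑' p : ℕ × ℕ, quad (Q ^ (p.1 + p.2 + 2)) ((1 - Q : X →L[ℂ] X) y) = ‖Q y‖ₑ ^ 2 := by
  -- The terms are nonnegative, so summing over squares [0, n)² computes the double series, and each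
  -- such sum is a single squared norm.
  have h2 := (ENNReal.summable (f := fun p : ℕ × ℕ =>
    quad (Q ^ (p.1 + p.2 + 2)) ((1 - Q : X →L[ℂ] X) y))).hasSum.comp
      tendsto_range_prod_range_atTop
  refine tendsto_nhds_unique h2 ?_
  have h3 : ∀ n, Q (neumann Q n ((1 - Q : X →L[ℂ] X) y)) = Q y - Q ((Q ^ n) y) := by
    intro n
    have := congrArg (fun T : X →L[ℂ] X => T y) (neumann_mul_one_sub Q n)
    change neumann Q n ((1 - Q : X →L[ℂ] X) y) = y - (Q ^ n) y at this
    rw [this, map_sub]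
  have h4 : Filter.Tendsto (fun n => ‖Q y - Q ((Q ^ n) y)‖ₑ ^ 2) Filter.atTop
      (𝓝 (‖Q y‖ₑ ^ 2)) := by
    have h5 := (Q.continuous.tendsto 0).comp (tendsto_pow_apply_zero h0 h1 hinj y)
    rw [map_zero] at h5
    have h6 := (tendsto_const_nhds (x := Q y)).sub h5
    rw [sub_zero] at h6
    exact ENNReal.Tendsto.pow h6.enorm
  refine h4.congr fun n => ?_
  have := enorm_pow_neumann_sq h0 1 n ((1 - Q : X →L[ℂ] X) y)
  rw [pow_one, h3] at this
  rw [this]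
  rfl

/-- The candidate preimage is the limit of yₙ = (1 + Q + ... + Qⁿ⁻¹)x. Finite energy bounds Qyₙ, and
the recursion yₙ = x + Qyₙ₋₁ then bounds yₙ. Since the Gram entries increase with the indices, ‖yₙ -
yₘ‖² ≤ ‖yₙ‖² - ‖yₘ‖² for m ≤ n, so yₙ is Cauchy, and (1 - Q)yₙ = x - Qⁿx tends to x. -/
theorem mem_range_one_sub_of_tsum_quad_ne_top {Q : X →L[ℂ] X} (h0 : 0 ≤ Q) (h1 : Q ≤ 1)
    (hinj : Function.Injective (1 - Q : X →L[ℂ] X)) {x : X}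
    (hx : ∑' p : ℕ × ℕ, quad (Q ^ (p.1 + p.2 + 2)) x ≠ ⊤) :
    ∃ y, (1 - Q : X →L[ℂ] X) y = x := by
  let y : ℕ → X := fun n => neumann Q n x
  have hb : ∀ n, ‖Q (y n)‖ₑ ^ 2 ≤ ∑' p : ℕ × ℕ, quad (Q ^ (p.1 + p.2 + 2)) x := by
    intro n
    have h := enorm_pow_neumann_sq h0 1 n x
    rw [pow_one] at h
    rw [h]
    exact ENNReal.sum_le_tsum _
  obtain ⟨C, hC⟩ : ∃ C : ℝ, ∀ n, ‖y n‖ ^ 2 ≤ C := by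
    refine ⟨(‖x‖ + √(∑' p : ℕ × ℕ, quad (Q ^ (p.1 + p.2 + 2)) x).toReal) ^ 2, fun n => ?_⟩
    refine pow_le_pow_left₀ (norm_nonneg _) ?_ 2
    -- For n = 0 the truncated index n - 1 is again 0 and y 0 = 0, hence the case distinction.
    have h2' : y n = (if n = 0 then 0 else x) + Q (y (n - 1)) := by
      rcases n with _ | n
      · simp [y, neumann]
      · simp only [y, neumann, Nat.add_sub_cancel, Finset.sum_range_succ', pow_zero]
        simp [map_sum, pow_succ', add_comm]
    have h3 : ‖Q (y (n - 1))‖ ≤ √(∑' p : ℕ × ℕ, quad (Q ^ (p.1 + p.2 + 2)) x).toReal := by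
      apply Real.le_sqrt_of_sq_le
      rw [← ENNReal.ofReal_le_iff_le_toReal hx, ← enorm_sq_eq_ofReal]
      exact hb _
    rw [h2']
    refine (norm_add_le _ _).trans (add_le_add ?_ h3)
    split_ifs <;> simp
  have hin : ∀ {m n}, m ≤ n → ‖y m‖ ^ 2 ≤ (⟪y m, y n⟫_ℂ).re ∧ ‖y m‖ ^ 2 ≤ ‖y n‖ ^ 2 := by
    intro m n hmn
    have h := inner_neumann h0 0
    simp only [pow_zero, one_apply_eq_self, mul_zero, add_zero] at h
    have hnn : ∀ p : ℕ × ℕ, 0 ≤ (⟪x, (Q ^ (p.1 + p.2)) x⟫_ℂ).re := fun p =>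
      re_inner_nonneg_of_nonneg (CStarAlgebra.pow_nonneg h0 _) x
    simp only [← re_inner_self_eq, y, h]
    exact ⟨Finset.sum_le_sum_of_subset_of_nonneg
        (Finset.product_subset_product le_rfl (Finset.range_mono hmn)) fun p _ _ => hnn p,
      Finset.sum_le_sum_of_subset_of_nonneg
        (Finset.product_subset_product (Finset.range_mono hmn) (Finset.range_mono hmn))
        fun p _ _ => hnn p⟩
  have hmono : Monotone fun n => ‖y n‖ ^ 2 := fun m n hmn => (hin hmn).2
  have hcs : CauchySeq fun n => ‖y n‖ ^ 2 :=
    (tendsto_atTop_ciSup hmono ⟨C, by rintro _ ⟨n, rfl⟩; exact hC n⟩).cauchySeq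
  have hc : CauchySeq y := by
    rw [Metric.cauchySeq_iff'] at hcs ⊢
    intro ε hε
    obtain ⟨N, hN⟩ := hcs (ε ^ 2) (by positivity)
    refine ⟨N, fun n hn => ?_⟩
    have h2 := hN n hn
    rw [Real.dist_eq, abs_of_nonneg (sub_nonneg.2 (hmono hn))] at h2
    have h3 : ‖y n - y N‖ ^ 2 = ‖y n‖ ^ 2 - 2 * (⟪y N, y n⟫_ℂ).re + ‖y N‖ ^ 2 := by
      have := @norm_sub_sq ℂ X _ _ _ (y n) (y N)
      rw [this, inner_re_symm]; rfl
    rw [dist_eq_norm]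
    have h4 := (hin hn).1
    exact lt_of_pow_lt_pow_left₀ 2 hε.le (by linarith)
  obtain ⟨z, hz⟩ := cauchySeq_tendsto_of_complete hc
  refine ⟨z, tendsto_nhds_unique (((1 - Q : X →L[ℂ] X).continuous.tendsto z).comp hz) ?_⟩
  have h5 := (tendsto_const_nhds (x := x)).sub (tendsto_pow_apply_zero h0 h1 hinj x)
  rw [sub_zero] at h5
  refine h5.congr fun n => ?_
  exact (congrArg (fun T : X →L[ℂ] X => T x) (one_sub_mul_neumann Q n)).symm

end Contraction

end EnergyOp

namespace EnergyOp

/-! ### Hilbert–Schmidt norms and traces against bounded operators. -/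

section TraceForm

variable {H : Type*} [NormedAddCommGroup H] [InnerProductSpace ℂ H] [CompleteSpace H]

theorem re_inner_mul_inner_symm (x y : H) : (⟪x, y⟫_ℂ * ⟪y, x⟫_ℂ).re = ‖⟪x, y⟫_ℂ‖ ^ 2 := by
  have h := inner_mul_symm_re_eq_norm (𝕜 := ℂ) x y
  rw [norm_mul, norm_inner_symm y x, ← sq] at h
  exact h

theorem tsum_enorm_inner_sq {ι : Type*} (b : HilbertBasis ι ℂ H) (x : H) :
    ∑' i, ‖⟪b i, x⟫_ℂ‖ₑ ^ 2 = ‖x‖ₑ ^ 2 := by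
  have h : HasSum (fun i => ‖⟪b i, x⟫_ℂ‖ ^ 2) (‖x‖ ^ 2) := by
    have h1 := Complex.hasSum_re (b.hasSum_inner_mul_inner x x)
    rw [re_inner_self_eq] at h1
    convert h1 using 2 with i
    rw [re_inner_mul_inner_symm, norm_inner_symm]
  simp only [enorm_sq_eq_ofReal]
  rw [← h.tsum_eq, ENNReal.ofReal_tsum_of_nonneg (fun i => by positivity) h.summable]

theorem enorm_inner_comm (x y : H) : ‖⟪x, y⟫_ℂ‖ₑ = ‖⟪y, x⟫_ℂ‖ₑ := by
  rw [← ofReal_norm, norm_inner_symm, ofReal_norm]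

/-- The square of the Hilbert–Schmidt norm. -/
noncomputable def hsq (T : H →L[ℂ] H) : ℝ≥0∞ := ∑' i, ‖T (stdBasis H i)‖ₑ ^ 2

theorem hsq_star (T : H →L[ℂ] H) : hsq (star T) = hsq T := by
  simp only [hsq, ← tsum_enorm_inner_sq (stdBasis H)]
  rw [ENNReal.tsum_comm]
  refine tsum_congr fun i => tsum_congr fun j => ?_
  rw [ContinuousLinearMap.star_eq_adjoint, ContinuousLinearMap.adjoint_inner_right,
    enorm_inner_comm]

theorem enorm_apply_sq_le (A : H →L[ℂ] H) (x : H) : ‖A x‖ₑ ^ 2 ≤ ‖A‖ₑ ^ 2 * ‖x‖ₑ ^ 2 := by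
  rw [← mul_pow]
  exact pow_le_pow_left' (A.le_opENorm x) 2

theorem hsq_mul_le (A T : H →L[ℂ] H) : hsq (A * T) ≤ ‖A‖ₑ ^ 2 * hsq T := by
  rw [hsq, hsq, ← ENNReal.tsum_mul_left]
  exact ENNReal.tsum_le_tsum fun i => enorm_apply_sq_le A _

theorem hsq_mul_le' (A T : H →L[ℂ] H) : hsq (T * A) ≤ ‖A‖ₑ ^ 2 * hsq T := by
  rw [← hsq_star, star_mul, ← hsq_star T]
  refine (hsq_mul_le _ _).trans_eq ?_
  rw [enorm_eq_nnnorm, nnnorm_star, ← enorm_eq_nnnorm]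

theorem mul_ne_top_of_hsq {A T : H →L[ℂ] H} (h : hsq T ≠ ⊤) : ‖A‖ₑ ^ 2 * hsq T ≠ ⊤ :=
  ENNReal.mul_ne_top (ENNReal.pow_ne_top enorm_ne_top) h

theorem summable_norm_sq_of_tsum {ι E : Type*} [NormedAddCommGroup E] {f : ι → E}
    (h : ∑' i, ‖f i‖ₑ ^ 2 ≠ ⊤) : Summable fun i => ‖f i‖ ^ 2 := by
  have h1 : ∑' i, ‖‖f i‖ ^ 2‖ₑ ≠ ⊤ := by
    convert h using 3 with i
    rw [enorm_pow, enorm_norm]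
  exact Summable.of_enorm h1

theorem summable_of_hsq {T : H →L[ℂ] H} (h : hsq T ≠ ⊤) :
    Summable fun i => ‖T (stdBasis H i)‖ ^ 2 := summable_norm_sq_of_tsum h

theorem summable_inner_of_hsq {X Y : H →L[ℂ] H} (hX : hsq X ≠ ⊤) (hY : hsq Y ≠ ⊤) :
    Summable fun i => ⟪X (stdBasis H i), Y (stdBasis H i)⟫_ℂ := by
  refine Summable.of_norm_bounded ((summable_of_hsq hX).add (summable_of_hsq hY)) fun i => ?_
  have h := norm_inner_le_norm (𝕜 := ℂ) (X (stdBasis H i)) (Y (stdBasis H i))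
  nlinarith [sq_nonneg (‖X (stdBasis H i)‖ - ‖Y (stdBasis H i)‖),
    sq_nonneg (‖X (stdBasis H i)‖ + ‖Y (stdBasis H i)‖)]

/-- The Hilbert–Schmidt inner product is invariant under taking adjoints. -/
theorem tsum_inner_eq_tsum_inner_star {X Y : H →L[ℂ] H} (hX : hsq X ≠ ⊤) (hY : hsq Y ≠ ⊤) :
    ∑' i, ⟪X (stdBasis H i), Y (stdBasis H i)⟫_ℂ =
      ∑' i, ⟪star Y (stdBasis H i), star X (stdBasis H i)⟫_ℂ := by
  set e := stdBasis H
  have hs : ∀ {T : H →L[ℂ] H}, hsq T ≠ ⊤ →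
      Summable fun p : (exists_hilbertBasis ℂ H).choose × (exists_hilbertBasis ℂ H).choose =>
        ‖⟪e p.2, T (e p.1)⟫_ℂ‖ ^ 2 := by
    intro T hT
    apply summable_norm_sq_of_tsum
    rw [ENNReal.tsum_prod (f := fun i j => ‖⟪e j, T (e i)⟫_ℂ‖ₑ ^ 2)]
    simp only [tsum_enorm_inner_sq]
    exact hT
  have hsum : Summable fun p : (exists_hilbertBasis ℂ H).choose × (exists_hilbertBasis ℂ H).choose =>
      ⟪X (e p.1), e p.2⟫_ℂ * ⟪e p.2, Y (e p.1)⟫_ℂ := by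
    refine Summable.of_norm_bounded ((hs hX).add (hs hY)) fun p => ?_
    rw [norm_mul, norm_inner_symm]
    nlinarith [sq_nonneg (‖⟪e p.2, X (e p.1)⟫_ℂ‖ - ‖⟪e p.2, Y (e p.1)⟫_ℂ‖),
      sq_nonneg (‖⟪e p.2, X (e p.1)⟫_ℂ‖ + ‖⟪e p.2, Y (e p.1)⟫_ℂ‖)]
  have hcomm := Summable.tsum_comm (f := fun i j => ⟪X (e i), e j⟫_ℂ * ⟪e j, Y (e i)⟫_ℂ) hsum
  have h1 : ∀ i, ∑' j, ⟪X (e i), e j⟫_ℂ * ⟪e j, Y (e i)⟫_ℂ = ⟪X (e i), Y (e i)⟫_ℂ := fun i =>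
    e.tsum_inner_mul_inner _ _
  have h2 : ∀ j, ∑' i, ⟪X (e i), e j⟫_ℂ * ⟪e j, Y (e i)⟫_ℂ = ⟪star Y (e j), star X (e j)⟫_ℂ := by
    intro j
    rw [← e.tsum_inner_mul_inner]
    refine tsum_congr fun i => ?_
    simp only [ContinuousLinearMap.star_eq_adjoint, ContinuousLinearMap.adjoint_inner_right,
      ContinuousLinearMap.adjoint_inner_left]
    ring
  simp only [h1, h2] at hcomm
  exact hcomm.symm

theorem star_sqrt (ρ : H →L[ℂ] H) : star (CFC.sqrt ρ) = CFC.sqrt ρ :=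
  (IsSelfAdjoint.of_nonneg (CFC.sqrt_nonneg ρ)).star_eq

theorem sqrt_sqrt_apply {ρ : H →L[ℂ] H} (h : 0 ≤ ρ) (x : H) :
    CFC.sqrt ρ (CFC.sqrt ρ x) = ρ x :=
  congrArg (fun T : H →L[ℂ] H => T x) (CFC.sqrt_mul_sqrt_self ρ h)

theorem inner_sqrt (ρ : H →L[ℂ] H) (x y : H) : ⟪CFC.sqrt ρ x, y⟫_ℂ = ⟪x, CFC.sqrt ρ y⟫_ℂ :=
  inner_symm_of_nonneg (CFC.sqrt_nonneg ρ) x y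

/-- `Tr ρ B` for positive `ρ` and `B`. -/
noncomputable def ptr (ρ B : H →L[ℂ] H) : ℝ≥0∞ := ∑' i, quad B (CFC.sqrt ρ (stdBasis H i))

theorem ptr_star_mul_self (ρ T : H →L[ℂ] H) : ptr ρ (star T * T) = hsq (T * CFC.sqrt ρ) := by
  simp only [ptr, quad_star_mul_self]
  rfl

theorem ptr_one (ρ : H →L[ℂ] H) : ptr ρ 1 = hsq (CFC.sqrt ρ) := by
  have := ptr_star_mul_self ρ 1
  simpa using this

theorem ptr_star_mul_self' {ρ : H →L[ℂ] H} (hρ : 0 ≤ ρ) (T : H →L[ℂ] H) :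
    ptr ρ (star T * T) = ∑' i, quad ρ (star T (stdBasis H i)) := by
  rw [ptr_star_mul_self, ← hsq_star, star_mul, star_sqrt]
  exact tsum_congr fun i => enorm_sqrt_apply_sq hρ _

theorem star_sqrt_mul_sqrt {B : H →L[ℂ] H} (hB : 0 ≤ B) :
    star (CFC.sqrt B) * CFC.sqrt B = B := by
  rw [star_sqrt, CFC.sqrt_mul_sqrt_self B hB]

theorem ptr_eq_hsq (ρ : H →L[ℂ] H) {B : H →L[ℂ] H} (hB : 0 ≤ B) :
    ptr ρ B = hsq (CFC.sqrt B * CFC.sqrt ρ) := by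
  rw [← ptr_star_mul_self, star_sqrt_mul_sqrt hB]

/-- The definition of `ptr` involves √ρ, which is not linear in ρ. Passing to the adjoint of √B √ρ
makes ρ appear linearly, which is what additivity, homogeneity and monotonicity in ρ rest on. -/
theorem ptr_eq_tsum_quad {ρ B : H →L[ℂ] H} (hρ : 0 ≤ ρ) (hB : 0 ≤ B) :
    ptr ρ B = ∑' i, quad ρ (CFC.sqrt B (stdBasis H i)) := by
  have := ptr_star_mul_self' hρ (CFC.sqrt B)
  rwa [star_sqrt_mul_sqrt hB, star_sqrt] at this

theorem quad_add {B C : H →L[ℂ] H} (hB : 0 ≤ B) (hC : 0 ≤ C) (x : H) :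
    quad (B + C) x = quad B x + quad C x := by
  rw [quad, add_apply, inner_add_right, Complex.add_re, ENNReal.ofReal_add
    (re_inner_nonneg_of_nonneg hB x) (re_inner_nonneg_of_nonneg hC x)]
  rfl

theorem quad_smul {c : ℝ} (hc : 0 ≤ c) (B : H →L[ℂ] H) (x : H) :
    quad ((c : ℂ) • B) x = ENNReal.ofReal c * quad B x := by
  rw [quad, quad, ← ENNReal.ofReal_mul hc]
  congr 1
  change (⟪x, (c : ℂ) • B x⟫_ℂ).re = _
  rw [inner_smul_right, Complex.re_ofReal_mul]

theorem ptr_mono_right (ρ : H →L[ℂ] H) {B C : H →L[ℂ] H} (h : B ≤ C) : ptr ρ B ≤ ptr ρ C :=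
  ENNReal.tsum_le_tsum fun _ => quad_mono h _

theorem ptr_mono_left {ρ σ B : H →L[ℂ] H} (hρ : 0 ≤ ρ) (h : ρ ≤ σ) (hB : 0 ≤ B) :
    ptr ρ B ≤ ptr σ B := by
  rw [ptr_eq_tsum_quad hρ hB, ptr_eq_tsum_quad (hρ.trans h) hB]
  exact ENNReal.tsum_le_tsum fun _ => quad_mono h _

theorem ptr_add_left {ρ σ B : H →L[ℂ] H} (hρ : 0 ≤ ρ) (hσ : 0 ≤ σ) (hB : 0 ≤ B) :
    ptr (ρ + σ) B = ptr ρ B + ptr σ B := by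
  rw [ptr_eq_tsum_quad hρ hB, ptr_eq_tsum_quad hσ hB, ptr_eq_tsum_quad (add_nonneg hρ hσ) hB,
    ← ENNReal.tsum_add]
  exact tsum_congr fun _ => quad_add hρ hσ _

theorem smul_nonneg_of_real {c : ℝ} (hc : 0 ≤ c) {ρ : H →L[ℂ] H} (hρ : 0 ≤ ρ) :
    0 ≤ (c : ℂ) • ρ := by
  rw [ContinuousLinearMap.nonneg_iff_isPositive] at hρ ⊢
  exact hρ.smul_of_nonneg (by exact_mod_cast hc)

theorem ptr_smul_left {c : ℝ} (hc : 0 ≤ c) {ρ B : H →L[ℂ] H} (hρ : 0 ≤ ρ) (hB : 0 ≤ B) :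
    ptr ((c : ℂ) • ρ) B = ENNReal.ofReal c * ptr ρ B := by
  rw [ptr_eq_tsum_quad hρ hB, ptr_eq_tsum_quad (smul_nonneg_of_real hc hρ) hB,
    ← ENNReal.tsum_mul_left]
  exact tsum_congr fun _ => quad_smul hc _ _

/-- The projector (up to a factor) on the line spanned by `φ`. -/
noncomputable abbrev pure (φ : H) : H →L[ℂ] H := InnerProductSpace.rankOne ℂ φ φ

theorem pure_nonneg (φ : H) : 0 ≤ pure φ :=
  (ContinuousLinearMap.nonneg_iff_isPositive _).2 (InnerProductSpace.isPositive_rankOne_self φ)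

theorem quad_pure (φ x : H) : quad (pure φ) x = ‖⟪φ, x⟫_ℂ‖ₑ ^ 2 := by
  rw [quad, enorm_sq_eq_ofReal, InnerProductSpace.rankOne_apply, inner_smul_right]
  rw [re_inner_mul_inner_symm]

theorem ptr_pure (φ : H) {B : H →L[ℂ] H} (hB : 0 ≤ B) : ptr (pure φ) B = quad B φ := by
  rw [ptr_eq_tsum_quad (pure_nonneg φ) hB, ← enorm_sqrt_apply_sq hB,
    ← tsum_enorm_inner_sq (stdBasis H)]
  refine tsum_congr fun i => ?_
  rw [quad_pure, ← inner_sqrt, enorm_inner_comm]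

theorem isPosTraceClass_iff {ρ : H →L[ℂ] H} :
    IsPosTraceClass ρ ↔ 0 ≤ ρ ∧ hsq (CFC.sqrt ρ) ≠ ⊤ := by
  refine and_congr_right fun hρ => ?_
  have h : ∀ i, ⟪stdBasis H i, ρ (stdBasis H i)⟫_ℂ =
      ⟪CFC.sqrt ρ (stdBasis H i), CFC.sqrt ρ (stdBasis H i)⟫_ℂ := fun i => by
    rw [inner_sqrt, sqrt_sqrt_apply hρ]
  simp only [h]
  refine ⟨fun hs => ?_, fun hs => summable_inner_of_hsq hs hs⟩
  have h2 := (tsum_enorm_ne_top_iff_summable_norm).2 hs.norm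
  convert h2 using 1
  refine tsum_congr fun i => ?_
  rw [inner_self_eq_norm_sq_to_K, enorm_pow]
  congr 1
  rw [← ofReal_norm, ← ofReal_norm]
  simp

/-- `∑ᵢ ⟨√ρ eᵢ, A √ρ eᵢ⟩`, which is `Tr ρ A` for a positive trace class operator `ρ`. -/
noncomputable def expect (ρ A : H →L[ℂ] H) : ℂ :=
  ∑' i, ⟪CFC.sqrt ρ (stdBasis H i), A (CFC.sqrt ρ (stdBasis H i))⟫_ℂ

theorem summable_expect {ρ : H →L[ℂ] H} (hρ : hsq (CFC.sqrt ρ) ≠ ⊤) (A : H →L[ℂ] H) :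
    Summable fun i => ⟪CFC.sqrt ρ (stdBasis H i), A (CFC.sqrt ρ (stdBasis H i))⟫_ℂ :=
  summable_inner_of_hsq (Y := A * CFC.sqrt ρ) hρ
    (ne_top_of_le_ne_top (mul_ne_top_of_hsq hρ) (hsq_mul_le A _))

/-- Splitting ρ = √ρ √ρ reduces the cyclicity of the trace to the invariance of the Hilbert–Schmidt
inner product under adjoints. -/
theorem opTrace_mul_eq_expect {ρ : H →L[ℂ] H} (hρ : IsPosTraceClass ρ) (A : H →L[ℂ] H) :
    opTrace (ρ * A) = expect ρ A := by
  obtain ⟨h0, hs⟩ := isPosTraceClass_iff.1 hρ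
  have h1 : opTrace (ρ * A) =
      ∑' i, ⟪CFC.sqrt ρ (stdBasis H i), (CFC.sqrt ρ * A) (stdBasis H i)⟫_ℂ := by
    refine tsum_congr fun i => ?_
    change ⟪_, ρ (A (stdBasis H i))⟫_ℂ = ⟪_, CFC.sqrt ρ (A (stdBasis H i))⟫_ℂ
    rw [inner_sqrt, sqrt_sqrt_apply h0]
  rw [h1, tsum_inner_eq_tsum_inner_star hs
    (ne_top_of_le_ne_top (mul_ne_top_of_hsq hs) (hsq_mul_le' A _))]
  refine tsum_congr fun i => ?_
  rw [star_mul, star_sqrt, ContinuousLinearMap.star_eq_adjoint]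
  exact ContinuousLinearMap.adjoint_inner_left A _ _

theorem opTrace_mul_eq_expect' {ρ : H →L[ℂ] H} (hρ : IsPosTraceClass ρ) (A : H →L[ℂ] H) :
    opTrace (A * ρ) = expect ρ A := by
  obtain ⟨h0, hs⟩ := isPosTraceClass_iff.1 hρ
  have h1 : opTrace (A * ρ) =
      ∑' i, ⟪(CFC.sqrt ρ * star A) (stdBasis H i), CFC.sqrt ρ (stdBasis H i)⟫_ℂ := by
    refine tsum_congr fun i => ?_
    change ⟪_, A (ρ (stdBasis H i))⟫_ℂ = ⟪CFC.sqrt ρ (star A (stdBasis H i)), _⟫_ℂ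
    rw [inner_sqrt, sqrt_sqrt_apply h0, ContinuousLinearMap.star_eq_adjoint,
      ContinuousLinearMap.adjoint_inner_left]
  rw [h1, tsum_inner_eq_tsum_inner_star
    (ne_top_of_le_ne_top (mul_ne_top_of_hsq hs) (hsq_mul_le' (star A) _)) hs]
  refine tsum_congr fun i => ?_
  rw [star_mul, star_sqrt, star_star]
  rfl

theorem inner_eq_ofReal_of_nonneg {B : H →L[ℂ] H} (hB : 0 ≤ B) (x : H) :
    ⟪x, B x⟫_ℂ = ((quad B x).toReal : ℂ) := by
  rw [quad, ENNReal.toReal_ofReal (re_inner_nonneg_of_nonneg hB x), ← sqrt_sqrt_apply hB,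
    ← inner_sqrt, re_inner_self_eq, inner_self_eq_norm_sq_to_K]
  push_cast
  rfl

theorem expect_eq_ptr {ρ : H →L[ℂ] H} {B : H →L[ℂ] H} (hB : 0 ≤ B) :
    expect ρ B = ((ptr ρ B).toReal : ℂ) := by
  rw [ptr, ENNReal.tsum_toReal_eq fun i => by exact ENNReal.ofReal_ne_top, Complex.ofReal_tsum]
  exact tsum_congr fun i => inner_eq_ofReal_of_nonneg hB _

theorem ptr_ne_top {ρ : H →L[ℂ] H} (hρ : hsq (CFC.sqrt ρ) ≠ ⊤) {B : H →L[ℂ] H} (hB : 0 ≤ B) :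
    ptr ρ B ≠ ⊤ := by
  rw [ptr_eq_hsq ρ hB]
  exact ne_top_of_le_ne_top (mul_ne_top_of_hsq hρ) (hsq_mul_le _ _)

theorem isState_iff {ρ : H →L[ℂ] H} : IsState ρ ↔ 0 ≤ ρ ∧ ptr ρ 1 = 1 := by
  have h1 : (0 : H →L[ℂ] H) ≤ 1 := zero_le_one
  constructor
  · rintro ⟨h, h2⟩
    refine ⟨h.1, ?_⟩
    have h3 := opTrace_mul_eq_expect h 1
    rw [mul_one, h2, expect_eq_ptr h1] at h3
    have h4 : (ptr ρ 1).toReal = 1 := by exact_mod_cast h3.symm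
    rwa [ENNReal.toReal_eq_one_iff] at h4
  · rintro ⟨h, h2⟩
    have h3 : IsPosTraceClass ρ := isPosTraceClass_iff.2 ⟨h, by rw [← ptr_one, h2]; simp⟩
    refine ⟨h3, ?_⟩
    have h4 := opTrace_mul_eq_expect h3 1
    rw [mul_one, expect_eq_ptr h1, h2] at h4
    simpa using h4

theorem isState_pure {φ : H} (hφ : ‖φ‖ = 1) : IsState (pure φ) := by
  rw [isState_iff]
  refine ⟨pure_nonneg φ, ?_⟩
  rw [ptr_pure φ zero_le_one, quad, one_apply_eq_self, re_inner_self_eq, hφ]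
  simp

theorem sqrt_pure {φ : H} (hφ : ‖φ‖ = 1) : CFC.sqrt (pure φ) = pure φ :=
  CFC.sqrt_unique (InnerProductSpace.isIdempotentElem_rankOne_self hφ) (pure_nonneg φ)

end TraceForm

end EnergyOp

namespace EnergyOp

/-! ### The Kadison–Schwarz inequality and the existence of the predual map. -/

section Predual

variable {H : Type*} [NormedAddCommGroup H] [InnerProductSpace ℂ H] [CompleteSpace H]

theorem CompletelyPositiveMap.nonneg (Φ : (H →L[ℂ] H) →CP (H →L[ℂ] H)) {A : H →L[ℂ] H}
    (hA : 0 ≤ A) : 0 ≤ Φ A := by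
  have := OrderHomClass.mono Φ hA
  rwa [map_zero] at this

theorem CompletelyPositiveMap.exists_norm_apply_le (Φ : (H →L[ℂ] H) →CP (H →L[ℂ] H)) :
    ∃ C : ℝ, 0 ≤ C ∧ ∀ A, ‖Φ A‖ ≤ C * ‖A‖ := by
  obtain ⟨C, hC⟩ := PositiveLinearMap.exists_norm_apply_le
    (⟨Φ.toLinearMap, OrderHomClass.mono Φ⟩ : (H →L[ℂ] H) →ₚ[ℂ] (H →L[ℂ] H))
  exact ⟨C, C.2, hC⟩

/-- A positive matrix lies in the additive monoid generated by the N*N, and for N*N the expression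
is ∑ₖ ‖Nₖ₀x + Nₖ₁y‖². Doubling the real part of one off-diagonal term accounts for the other. -/
theorem cstarMatrix_quadratic_nonneg {M : CStarMatrix (Fin 2) (Fin 2) (H →L[ℂ] H)} (hM : 0 ≤ M)
    (x y : H) :
    0 ≤ (⟪x, M 0 0 x⟫_ℂ).re + 2 * (⟪x, M 0 1 y⟫_ℂ).re + (⟪y, M 1 1 y⟫_ℂ).re := by
  rw [StarOrderedRing.nonneg_iff] at hM
  induction hM using AddSubmonoid.closure_induction with
  | mem M hM =>
    obtain ⟨N, rfl⟩ := hM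
    have hexp : ∀ k i j (z w : H), ⟪z, (star (N k i) * N k j) w⟫_ℂ = ⟪N k i z, N k j w⟫_ℂ := by
      intro k i j z w
      change ⟪z, ContinuousLinearMap.adjoint (N k i) (N k j w)⟫_ℂ = _
      rw [ContinuousLinearMap.adjoint_inner_right]
    have hsq : ∀ k, 0 ≤ (⟪N k 0 x, N k 0 x⟫_ℂ).re + 2 * (⟪N k 0 x, N k 1 y⟫_ℂ).re
        + (⟪N k 1 y, N k 1 y⟫_ℂ).re := by
      intro k
      rw [re_inner_self_eq, re_inner_self_eq]
      have h := @norm_add_sq ℂ H _ _ _ (N k 0 x) (N k 1 y)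
      have h2 : 0 ≤ ‖N k 0 x + N k 1 y‖ ^ 2 := sq_nonneg _
      rw [h] at h2
      exact h2
    simp only [CStarMatrix.mul_apply, Fin.sum_univ_two, CStarMatrix.star_apply, add_apply,
      inner_add_right, Complex.add_re, hexp]
    have h0 := hsq 0
    have h1 := hsq 1
    linarith
  | zero => simp
  | add M N _ _ hM hN =>
    simp only [CStarMatrix.add_apply, add_apply, inner_add_right, Complex.add_re]
    linarith

theorem CompletelyPositiveMap.two_positive (Φ : (H →L[ℂ] H) →CP (H →L[ℂ] H)) (A : H →L[ℂ] H)
    (x y : H) :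
    0 ≤ (⟪x, Φ 1 x⟫_ℂ).re + 2 * (⟪x, Φ A y⟫_ℂ).re + (⟪y, Φ (star A * A) y⟫_ℂ).re := by
  -- The row (1, A), padded by zeros; v*v has the entries 1, A, A*, A*A.
  let v : CStarMatrix (Fin 2) (Fin 2) (H →L[ℂ] H) := CStarMatrix.ofMatrix !![1, A; 0, 0]
  have h := cstarMatrix_quadratic_nonneg
    (Φ.map_cstarMatrix_nonneg _ (star_mul_self_nonneg v)) x y
  have hvv : ∀ i j, (star v * v) i j = star (v 0 i) * v 0 j + star (v 1 i) * v 1 j := by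
    intro i j
    rw [CStarMatrix.mul_apply, Fin.sum_univ_two, CStarMatrix.star_apply, CStarMatrix.star_apply]
  simp only [CStarMatrix.map_apply, hvv] at h
  simpa [v] using h

/-- The Kadison–Schwarz inequality. -/
theorem CompletelyPositiveMap.kadison_schwarz (Φ : (H →L[ℂ] H) →CP (H →L[ℂ] H))
    (A : H →L[ℂ] H) (y : H) :
    ‖Φ A y‖ ^ 2 ≤ ‖Φ 1‖ * (⟪y, Φ (star A * A) y⟫_ℂ).re := by
  -- Two-positivity at the vector x = -tΦ(A)y gives a quadratic inequality in t; the optimal value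
  -- is t = 1/‖Φ(I)‖.
  have key : ∀ t : ℝ, 0 ≤ t ^ 2 * (‖Φ 1‖ * ‖Φ A y‖ ^ 2) - 2 * t * ‖Φ A y‖ ^ 2
      + (⟪y, Φ (star A * A) y⟫_ℂ).re := by
    intro t
    have h := CompletelyPositiveMap.two_positive Φ A ((-t : ℂ) • Φ A y) y
    rw [map_smul, inner_smul_left, inner_smul_left, inner_smul_right] at h
    have h1 : (⟪Φ A y, Φ 1 (Φ A y)⟫_ℂ).re ≤ ‖Φ 1‖ * ‖Φ A y‖ ^ 2 := by
      refine (Complex.re_le_norm _).trans ((norm_inner_le_norm _ _).trans ?_)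
      have := (Φ 1).le_opNorm (Φ A y)
      nlinarith [norm_nonneg (Φ A y)]
    have e1 : ((starRingEnd ℂ) (-t : ℂ) * ((-t : ℂ) * ⟪Φ A y, Φ 1 (Φ A y)⟫_ℂ)).re =
        t ^ 2 * (⟪Φ A y, Φ 1 (Φ A y)⟫_ℂ).re := by
      have : (starRingEnd ℂ) (-t : ℂ) * ((-t : ℂ) * ⟪Φ A y, Φ 1 (Φ A y)⟫_ℂ) =
          ((t ^ 2 : ℝ) : ℂ) * ⟪Φ A y, Φ 1 (Φ A y)⟫_ℂ := by
        rw [map_neg, Complex.conj_ofReal]; push_cast; ring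
      rw [this, Complex.re_ofReal_mul]
    have e2 : ((starRingEnd ℂ) (-t : ℂ) * ⟪Φ A y, Φ A y⟫_ℂ).re = -t * ‖Φ A y‖ ^ 2 := by
      have : (starRingEnd ℂ) (-t : ℂ) * ⟪Φ A y, Φ A y⟫_ℂ = ((-t : ℝ) : ℂ) * ⟪Φ A y, Φ A y⟫_ℂ := by
        rw [map_neg, Complex.conj_ofReal]; push_cast; ring
      rw [this, Complex.re_ofReal_mul, re_inner_self_eq]
    rw [e1, e2] at h
    nlinarith [mul_le_mul_of_nonneg_left h1 (sq_nonneg t)]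
  have hq : 0 ≤ (⟪y, Φ (star A * A) y⟫_ℂ).re :=
    re_inner_nonneg_of_nonneg (CompletelyPositiveMap.nonneg Φ (star_mul_self_nonneg A)) y
  rcases (norm_nonneg (Φ 1)).eq_or_lt with h0 | h0
  · rw [← h0, zero_mul]
    by_contra! hpos
    -- When ‖Φ(I)‖ = 0 the inequality is affine in t. With q = Re⟨y, Φ(A*A)y⟩, this t makes the
    -- right-hand side equal to -q - 2 < 0.
    have h := key (((⟪y, Φ (star A * A) y⟫_ℂ).re + 1) / ‖Φ A y‖ ^ 2)
    rw [← h0, zero_mul, mul_zero, mul_assoc, div_mul_cancel₀ _ hpos.ne'] at h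
    linarith
  · have h := key (1 / ‖Φ 1‖)
    have h2 : (1 / ‖Φ 1‖) ^ 2 * (‖Φ 1‖ * ‖Φ A y‖ ^ 2) - 2 * (1 / ‖Φ 1‖) * ‖Φ A y‖ ^ 2 =
        -(‖Φ A y‖ ^ 2 / ‖Φ 1‖) := by
      field_simp; ring
    rw [h2] at h
    have h3 : ‖Φ A y‖ ^ 2 / ‖Φ 1‖ ≤ (⟪y, Φ (star A * A) y⟫_ℂ).re := by linarith
    rwa [div_le_iff₀' h0] at h3

theorem CompletelyPositiveMap.enorm_apply_sq_le (Φ : (H →L[ℂ] H) →CP (H →L[ℂ] H))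
    (A : H →L[ℂ] H) (y : H) : ‖Φ A y‖ₑ ^ 2 ≤ ‖Φ 1‖ₑ * quad (Φ (star A * A)) y := by
  rw [enorm_sq_eq_ofReal, quad, ← ofReal_norm, ← ENNReal.ofReal_mul (norm_nonneg _)]
  exact ENNReal.ofReal_le_ofReal (CompletelyPositiveMap.kadison_schwarz Φ A y)

/-- A bounded operator from a bounded sesquilinear form. -/
theorem exists_operator_of_form {f : H → H → ℂ} {C : ℝ}
    (h1 : ∀ x y z, f (x + y) z = f x z + f y z)
    (h2 : ∀ (c : ℂ) x z, f (c • x) z = starRingEnd ℂ c * f x z)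
    (h3 : ∀ x y z, f x (y + z) = f x y + f x z)
    (h4 : ∀ (c : ℂ) x y, f x (c • y) = c * f x y)
    (hC : ∀ x y, ‖f x y‖ ≤ C * ‖x‖ * ‖y‖) :
    ∃ B : H →L[ℂ] H, ∀ x y, ⟪B x, y⟫_ℂ = f x y :=
  ⟨InnerProductSpace.continuousLinearMapOfBilin
      (LinearMap.mkContinuous₂ (LinearMap.mk₂'ₛₗ (starRingEnd ℂ) (RingHom.id ℂ) f h1 h2 h3 h4) C hC),
    fun x y => by rw [InnerProductSpace.continuousLinearMapOfBilin_apply]; rfl⟩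

/-- A bounded operator whose quadratic form is a sum of positive bounded quadratic forms is their
least upper bound. -/
theorem quad_eq_tsum_of_isLUB {ι : Type*} {Y : ι → H →L[ℂ] H} (hY : ∀ i, 0 ≤ Y i)
    {B : H →L[ℂ] H} (hB : IsLUB (Set.range fun F : Finset ι => ∑ i ∈ F, Y i) B) (x : H) :
    quad B x = ∑' i, quad (Y i) x := by
  have hle : ∀ F : Finset ι, ∑ i ∈ F, Y i ≤ B := fun F => hB.1 ⟨F, rfl⟩
  have hsumle : ∀ x, ∑' i, quad (Y i) x ≤ quad B x := by
    intro x
    rw [ENNReal.tsum_eq_iSup_sum]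
    refine iSup_le fun F => ?_
    rw [← quad_sum F hY]
    exact quad_mono (hle F) x
  have hfin : ∀ x, ∑' i, ‖CFC.sqrt (Y i) x‖ₑ ^ 2 ≠ ⊤ := by
    intro x
    simp only [enorm_sqrt_apply_sq (hY _)]
    exact ne_top_of_le_ne_top ENNReal.ofReal_ne_top (hsumle x)
  have hsum : ∀ x y, Summable fun i => ⟪Y i x, y⟫_ℂ := by
    intro x y
    refine Summable.of_norm_bounded ((summable_norm_sq_of_tsum (hfin x)).add
      (summable_norm_sq_of_tsum (hfin y))) fun i => ?_
    rw [← sqrt_sqrt_apply (hY i), inner_sqrt]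
    have h := norm_inner_le_norm (𝕜 := ℂ) (CFC.sqrt (Y i) x) (CFC.sqrt (Y i) y)
    nlinarith [sq_nonneg (‖CFC.sqrt (Y i) x‖ - ‖CFC.sqrt (Y i) y‖),
      sq_nonneg (‖CFC.sqrt (Y i) x‖ + ‖CFC.sqrt (Y i) y‖)]
  -- B' is the operator whose form is the sum of the forms of the Yᵢ. It dominates every partial
  -- sum, so B ≤ B' by leastness, while the form of B' is below that of B because all partial sums
  -- are.
  obtain ⟨B', hB'⟩ := exists_operator_of_form (f := fun x y => ∑' i, ⟪Y i x, y⟫_ℂ) (C := ‖B‖)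
    (fun x y z => by
      simp only [map_add, inner_add_left]
      exact (hsum x z).tsum_add (hsum y z))
    (fun c x z => by
      simp only [map_smul, inner_smul_left]
      exact tsum_mul_left)
    (fun x y z => by
      simp only [inner_add_right]
      exact (hsum x y).tsum_add (hsum x z))
    (fun c x y => by
      simp only [inner_smul_right]
      exact tsum_mul_left)
    (fun x y => by
      refine le_of_tendsto (hsum x y).hasSum.norm (Filter.Eventually.of_forall fun F => ?_)
      rw [← sum_inner, ← sum_apply]
      refine (norm_inner_le_norm _ _).trans (mul_le_mul_of_nonneg_right ?_ (norm_nonneg _))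
      exact ContinuousLinearMap.le_of_opNorm_le _ (CStarAlgebra.norm_le_norm_of_nonneg_of_le
        (Finset.sum_nonneg fun i _ => hY i) (hle F)) x)
  have hB'x : ∀ x, ⟪B' x, x⟫_ℂ = ((∑' i, quad (Y i) x).toReal : ℂ) := by
    intro x
    rw [hB', ENNReal.tsum_toReal_eq fun i => by exact ENNReal.ofReal_ne_top, Complex.ofReal_tsum]
    refine tsum_congr fun i => ?_
    rw [inner_symm_of_nonneg (hY i), inner_eq_ofReal_of_nonneg (hY i)]
  have hBB' : B ≤ B' := by
    refine hB.2 ?_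
    rintro _ ⟨F, rfl⟩
    rw [ContinuousLinearMap.le_def, ContinuousLinearMap.isPositive_iff_complex]
    intro x
    have h1 : ⟪(B' - ∑ i ∈ F, Y i) x, x⟫_ℂ =
        (((∑' i, quad (Y i) x).toReal - (∑ i ∈ F, quad (Y i) x).toReal : ℝ) : ℂ) := by
      rw [sub_apply, inner_sub_left, hB'x,
        inner_symm_of_nonneg (Finset.sum_nonneg fun i _ => hY i),
        inner_eq_ofReal_of_nonneg (Finset.sum_nonneg fun i _ => hY i), quad_sum F hY]
      push_cast
      rfl
    rw [h1]
    refine ⟨by simp, ?_⟩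
    simp only [RCLike.re_to_complex, Complex.ofReal_re, sub_nonneg]
    exact ENNReal.toReal_mono (ne_top_of_le_ne_top ENNReal.ofReal_ne_top (hsumle x))
      (ENNReal.sum_le_tsum F)
  refine le_antisymm ((quad_mono hBB' x).trans_eq ?_) (hsumle x)
  have h2 : (⟪x, B' x⟫_ℂ).re = (∑' i, quad (Y i) x).toReal := by
    have h3 := hB'x x
    rw [← inner_conj_symm] at h3
    have h4 := congrArg Complex.re h3
    rwa [Complex.conj_re, Complex.ofReal_re] at h4
  rw [quad, h2, ENNReal.ofReal_toReal (ne_top_of_le_ne_top ENNReal.ofReal_ne_top (hsumle x))]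

theorem quad_sum_pure (T : H →L[ℂ] H) (F : Finset (exists_hilbertBasis ℂ H).choose) (x : H) :
    quad (∑ i ∈ F, pure (star T (stdBasis H i))) x = ∑ i ∈ F, ‖⟪stdBasis H i, T x⟫_ℂ‖ₑ ^ 2 := by
  rw [quad_sum F fun i => pure_nonneg _]
  refine Finset.sum_congr rfl fun i _ => ?_
  rw [quad_pure, ContinuousLinearMap.star_eq_adjoint, ContinuousLinearMap.adjoint_inner_left]

theorem le_of_quad_le {B C : H →L[ℂ] H} (hB : 0 ≤ B) (hC : 0 ≤ C) (h : ∀ x, quad B x ≤ quad C x) :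
    B ≤ C := by
  rw [ContinuousLinearMap.le_def, ContinuousLinearMap.isPositive_def]
  refine ⟨?_, fun x => ?_⟩
  · intro x y
    have h1 := inner_symm_of_nonneg hB x y
    have h2 := inner_symm_of_nonneg hC x y
    change ⟪C x - B x, y⟫_ℂ = ⟪x, C y - B y⟫_ℂ
    rw [inner_sub_left, inner_sub_right, h1, h2]
  · rw [ContinuousLinearMap.reApplyInnerSelf_apply, inner_re_symm]
    have h3 := (ENNReal.ofReal_le_ofReal_iff (re_inner_nonneg_of_nonneg hC x)).1 (h x)
    rw [sub_apply, inner_sub_right, map_sub]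
    exact sub_nonneg.2 h3

/-- `T* T` is the supremum of the increasing net `T* P_F T`, where `P_F` are finite-rank
projectors. -/
theorem isLUB_sum_pure (T : H →L[ℂ] H) :
    IsLUB (Set.range fun F : Finset (exists_hilbertBasis ℂ H).choose =>
      ∑ i ∈ F, pure (star T (stdBasis H i))) (star T * T) := by
  have hnn : ∀ F : Finset (exists_hilbertBasis ℂ H).choose,
      0 ≤ ∑ i ∈ F, pure (star T (stdBasis H i)) := fun F =>
    Finset.sum_nonneg fun i _ => pure_nonneg _
  constructor
  · rintro _ ⟨F, rfl⟩
    refine le_of_quad_le (hnn F) (star_mul_self_nonneg T) fun x => ?_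
    rw [quad_sum_pure, quad_star_mul_self, ← tsum_enorm_inner_sq (stdBasis H)]
    exact ENNReal.sum_le_tsum F
  · intro C hC
    have hC0 : 0 ≤ C := by
      have := hC ⟨∅, rfl⟩
      simpa using this
    refine le_of_quad_le (star_mul_self_nonneg T) hC0 fun x => ?_
    rw [quad_star_mul_self, ← tsum_enorm_inner_sq (stdBasis H), ENNReal.tsum_eq_iSup_sum]
    refine iSup_le fun F => ?_
    rw [← quad_sum_pure]
    exact quad_mono (hC ⟨F, rfl⟩) x

/-- This is where normality is applied directly: Φ may be taken inside the expansion of T*T into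
rank-one operators along a basis. -/
theorem IsNormalMap.quad_star_mul_self {Φ : (H →L[ℂ] H) →CP (H →L[ℂ] H)} (hΦ : IsNormalMap Φ)
    (T : H →L[ℂ] H) (x : H) :
    quad (Φ (star T * T)) x = ∑' i, quad (Φ (pure (star T (stdBasis H i)))) x := by
  refine quad_eq_tsum_of_isLUB (fun i => CompletelyPositiveMap.nonneg Φ (pure_nonneg _)) ?_ x
  have h := hΦ _ (Set.range_nonempty _) ?_ _ (isLUB_sum_pure T)
  · convert h using 1
    rw [← Set.range_comp]
    congr 1
    ext1 F
    simp
  · rw [directedOn_range]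
    refine Monotone.directed_le fun F G hFG => ?_
    exact Finset.sum_le_sum_of_subset_of_nonneg hFG fun i _ _ => pure_nonneg _

theorem expect_add {ρ : H →L[ℂ] H} (hρ : hsq (CFC.sqrt ρ) ≠ ⊤) (A B : H →L[ℂ] H) :
    expect ρ (A + B) = expect ρ A + expect ρ B := by
  simp only [expect, add_apply, inner_add_right]
  exact (summable_expect hρ A).tsum_add (summable_expect hρ B)

theorem expect_smul (ρ : H →L[ℂ] H) (c : ℂ) (A : H →L[ℂ] H) :
    expect ρ (c • A) = c * expect ρ A := by
  simp only [expect, smul_apply, inner_smul_right]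
  exact tsum_mul_left

theorem norm_expect_le {ρ : H →L[ℂ] H} (hρ : hsq (CFC.sqrt ρ) ≠ ⊤) (A : H →L[ℂ] H) :
    ‖expect ρ A‖ ≤ ‖A‖ * (hsq (CFC.sqrt ρ)).toReal := by
  have hs := summable_of_hsq hρ
  have h1 : (hsq (CFC.sqrt ρ)).toReal = ∑' i, ‖CFC.sqrt ρ (stdBasis H i)‖ ^ 2 := by
    rw [hsq, ENNReal.tsum_toReal_eq fun i => ENNReal.pow_ne_top enorm_ne_top]
    exact tsum_congr fun i => by simp
  rw [h1, ← tsum_mul_left]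
  refine tsum_of_norm_bounded (hs.mul_left ‖A‖).hasSum fun i => ?_
  refine (norm_inner_le_norm _ _).trans ?_
  have := A.le_opNorm (CFC.sqrt ρ (stdBasis H i))
  nlinarith [norm_nonneg (CFC.sqrt ρ (stdBasis H i))]

/-- The matrix elements of σ are prescribed by rank-one operators. Normality extends the trace
identity to all T*T, that is, to all positive operators, and these span B(H). -/
theorem IsNormalMap.exists_isPredualAt {Φ : (H →L[ℂ] H) →CP (H →L[ℂ] H)} (hΦ : IsNormalMap Φ)
    {ρ : H →L[ℂ] H} (hρ : IsPosTraceClass ρ) : ∃ σ, IsPredualAt Φ ρ σ := by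
  obtain ⟨h0, hs⟩ := isPosTraceClass_iff.1 hρ
  obtain ⟨C, hC0, hC⟩ := CompletelyPositiveMap.exists_norm_apply_le Φ
  obtain ⟨σ, hσ⟩ := exists_operator_of_form
    (f := fun x y => expect ρ (Φ (InnerProductSpace.rankOne ℂ y x)))
    (C := C * (hsq (CFC.sqrt ρ)).toReal)
    (fun x y z => by rw [map_add, map_add, expect_add hs])
    (fun c x z => by rw [map_smulₛₗ, map_smul, expect_smul])
    (fun x y z => by rw [map_add, add_apply, map_add, expect_add hs])
    (fun c x y => by rw [map_smul, smul_apply, map_smul, expect_smul])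
    (fun x y => by
      refine (norm_expect_le hs _).trans ?_
      have := hC (InnerProductSpace.rankOne ℂ y x)
      rw [InnerProductSpace.norm_rankOne] at this
      calc _ ≤ C * (‖y‖ * ‖x‖) * (hsq (CFC.sqrt ρ)).toReal :=
            mul_le_mul_of_nonneg_right this ENNReal.toReal_nonneg
        _ = _ := by ring)
  have hΦpure : ∀ x, 0 ≤ Φ (pure x) := fun x => CompletelyPositiveMap.nonneg Φ (pure_nonneg x)
  have hσx : ∀ x, ⟪σ x, x⟫_ℂ = ((ptr ρ (Φ (pure x))).toReal : ℂ) := fun x => by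
    rw [hσ, expect_eq_ptr (hΦpure x)]
  have hσ0 : 0 ≤ σ := by
    rw [ContinuousLinearMap.nonneg_iff_isPositive, ContinuousLinearMap.isPositive_iff_complex]
    intro x
    rw [hσx]
    exact ⟨by simp, by simp⟩
  have hquad : ∀ x, quad σ x = ptr ρ (Φ (pure x)) := by
    intro x
    have h1 := hσx x
    rw [inner_symm_of_nonneg hσ0] at h1
    rw [quad, h1, Complex.ofReal_re, ENNReal.ofReal_toReal (ptr_ne_top hs (hΦpure x))]
  have hptr : ∀ T : H →L[ℂ] H, ptr σ (star T * T) = ptr ρ (Φ (star T * T)) := by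
    intro T
    rw [ptr_star_mul_self' hσ0]
    simp only [hquad, ptr, hΦ.quad_star_mul_self]
    rw [ENNReal.tsum_comm]
  have hptr' : ∀ {B : H →L[ℂ] H}, 0 ≤ B → ptr σ B = ptr ρ (Φ B) := by
    intro B hB
    have := hptr (CFC.sqrt B)
    rwa [star_sqrt_mul_sqrt hB] at this
  have hσs : hsq (CFC.sqrt σ) ≠ ⊤ := by
    rw [← ptr_one, hptr' zero_le_one]
    exact ptr_ne_top hs (CompletelyPositiveMap.nonneg Φ zero_le_one)
  have hσT : IsPosTraceClass σ := isPosTraceClass_iff.2 ⟨hσ0, hσs⟩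
  refine ⟨σ, hσT, fun A => ?_⟩
  rw [opTrace_mul_eq_expect hσT, opTrace_mul_eq_expect' hρ]
  have hA : A ∈ Submodule.span ℂ {a : H →L[ℂ] H | 0 ≤ a} := by
    rw [CStarAlgebra.span_nonneg]; trivial
  induction hA using Submodule.span_induction with
  | mem B hB =>
    rw [expect_eq_ptr hB, expect_eq_ptr (CompletelyPositiveMap.nonneg Φ hB), hptr' hB]
  | zero => simp [expect]
  | add B D _ _ h1 h2 => rw [map_add, expect_add hs, expect_add hσs, h1, h2]
  | smul c B _ h1 => rw [map_smul, expect_smul, expect_smul, h1]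

theorem IsNormalMap.predual_spec {Φ : (H →L[ℂ] H) →CP (H →L[ℂ] H)} (hΦ : IsNormalMap Φ)
    {ρ : H →L[ℂ] H} (hρ : IsPosTraceClass ρ) : IsPredualAt Φ ρ (predual Φ ρ) :=
  Classical.epsilon_spec (hΦ.exists_isPredualAt hρ)

theorem IsNormalMap.expect_predual {Φ : (H →L[ℂ] H) →CP (H →L[ℂ] H)} (hΦ : IsNormalMap Φ)
    {ρ : H →L[ℂ] H} (hρ : IsPosTraceClass ρ) (A : H →L[ℂ] H) :
    expect (predual Φ ρ) A = expect ρ (Φ A) := by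
  have h := hΦ.predual_spec hρ
  rw [← opTrace_mul_eq_expect h.1, ← opTrace_mul_eq_expect' hρ, h.2]

theorem IsNormalMap.ptr_predual {Φ : (H →L[ℂ] H) →CP (H →L[ℂ] H)} (hΦ : IsNormalMap Φ)
    {ρ : H →L[ℂ] H} (hρ : IsPosTraceClass ρ) {B : H →L[ℂ] H} (hB : 0 ≤ B) :
    ptr (predual Φ ρ) B = ptr ρ (Φ B) := by
  have h := hΦ.expect_predual hρ B
  have hΦB := CompletelyPositiveMap.nonneg Φ hB
  rw [expect_eq_ptr hB, expect_eq_ptr hΦB] at h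
  have h1 := ptr_ne_top (isPosTraceClass_iff.1 (hΦ.predual_spec hρ).1).2 hB
  have h2 := ptr_ne_top (isPosTraceClass_iff.1 hρ).2 hΦB
  rw [← ENNReal.toReal_eq_toReal_iff' h1 h2]
  exact_mod_cast h

end Predual

end EnergyOp

namespace EnergyOp

/-! ### Resolvents, energy as a sum of bounded forms, and operators of finite energy. -/

section FiniteEnergy

variable {H : Type*} [NormedAddCommGroup H] [InnerProductSpace ℂ H] [CompleteSpace H]

/-- `Q = 1 - (1 + S)⁻¹` for a positive self-adjoint operator `S`. -/
structure IsResolventCompl (S : H →ₗ.[ℂ] H) (Q : H →L[ℂ] H) : Prop where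
  nonneg : 0 ≤ Q
  le_one : Q ≤ 1
  injective : Function.Injective (1 - Q : H →L[ℂ] H)
  mem : ∀ y, (1 - Q : H →L[ℂ] H) y ∈ S.domain
  apply_eq : ∀ y, S ⟨(1 - Q : H →L[ℂ] H) y, mem y⟩ = Q y
  left_inv : ∀ x : S.domain, (1 - Q : H →L[ℂ] H) (x + S x) = x

theorem IsPosSelfAdjoint.exists_isResolventCompl {S : H →ₗ.[ℂ] H} (hS : IsPosSelfAdjoint S) :
    ∃ Q, IsResolventCompl S Q := by
  obtain ⟨R, h0, h1, h2, h3⟩ := hS.exists_resolvent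
  have hR : (1 - (1 - R) : H →L[ℂ] H) = R := sub_sub_cancel 1 R
  refine ⟨1 - R, sub_nonneg.2 h1, sub_le_self 1 h0, ?_, ?_, ?_, ?_⟩
  · rw [hR, injective_iff_map_eq_zero]
    intro x hx
    obtain ⟨h, h'⟩ := h2 x
    have h0 : (⟨R x, h⟩ : S.domain) = 0 := Subtype.ext hx
    rw [h0, LinearPMap.map_zero, hx, sub_zero] at h'
    exact h'.symm
  · rw [hR]; exact fun y => (h2 y).1
  · simp only [hR]; exact fun y => (h2 y).2
  · rw [hR]; exact h3

variable {S : H →ₗ.[ℂ] H} {Q : H →L[ℂ] H}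

theorem sqNorm_of_mem {T : H →ₗ.[ℂ] H} {φ : H} (h : φ ∈ T.domain) :
    sqNorm T φ = ‖T ⟨φ, h⟩‖ₑ ^ 2 := dif_pos h

theorem sqNorm_of_notMem {T : H →ₗ.[ℂ] H} {φ : H} (h : φ ∉ T.domain) : sqNorm T φ = ⊤ := dif_neg h

theorem mem_of_sqNorm_ne_top {T : H →ₗ.[ℂ] H} {φ : H} (h : sqNorm T φ ≠ ⊤) : φ ∈ T.domain := by
  by_contra h2
  exact h (sqNorm_of_notMem h2)

/-- The domain of S is the range of 1 - Q. On it the series sums to ‖Qy‖² = ‖S(1 - Q)y‖²; off it the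
series cannot converge, so both sides are ∞. -/
theorem IsResolventCompl.sqNorm_eq (hQ : IsResolventCompl S Q) (φ : H) :
    sqNorm S φ = ∑' p : ℕ × ℕ, quad (Q ^ (p.1 + p.2 + 2)) φ := by
  by_cases h : ∃ y, (1 - Q : H →L[ℂ] H) y = φ
  · obtain ⟨y, rfl⟩ := h
    rw [tsum_quad_one_sub_apply hQ.nonneg hQ.le_one hQ.injective, sqNorm_of_mem (hQ.mem y),
      hQ.apply_eq]
  · rw [sqNorm_of_notMem]
    · symm
      by_contra h2
      exact h (mem_range_one_sub_of_tsum_quad_ne_top hQ.nonneg hQ.le_one hQ.injective h2)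
    · exact fun h2 => h ⟨_, hQ.left_inv ⟨φ, h2⟩⟩

/-- Energy becomes a countable sum of traces against bounded positive operators, so it inherits
their additivity in ρ and their behaviour under the predual. -/
theorem IsResolventCompl.trConj_eq (hQ : IsResolventCompl S Q) (ρ : H →L[ℂ] H) :
    trConj S ρ = ∑' p : ℕ × ℕ, ptr ρ (Q ^ (p.1 + p.2 + 2)) := by
  simp only [trConj, ptr, hQ.sqNorm_eq]
  rw [ENNReal.tsum_comm]

theorem IsResolventCompl.trConj_pure (hQ : IsResolventCompl S Q) (φ : H) :
    trConj S (pure φ) = sqNorm S φ := by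
  rw [hQ.trConj_eq, hQ.sqNorm_eq]
  exact tsum_congr fun p => ptr_pure φ (CStarAlgebra.pow_nonneg hQ.nonneg _)

theorem IsResolventCompl.trConj_add (hQ : IsResolventCompl S Q) {ρ σ : H →L[ℂ] H} (hρ : 0 ≤ ρ)
    (hσ : 0 ≤ σ) : trConj S (ρ + σ) = trConj S ρ + trConj S σ := by
  rw [hQ.trConj_eq, hQ.trConj_eq, hQ.trConj_eq, ← ENNReal.tsum_add]
  exact tsum_congr fun p => ptr_add_left hρ hσ (CStarAlgebra.pow_nonneg hQ.nonneg _)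

theorem IsResolventCompl.trConj_smul (hQ : IsResolventCompl S Q) {c : ℝ} (hc : 0 ≤ c)
    {ρ : H →L[ℂ] H} (hρ : 0 ≤ ρ) :
    trConj S ((c : ℂ) • ρ) = ENNReal.ofReal c * trConj S ρ := by
  rw [hQ.trConj_eq, hQ.trConj_eq, ← ENNReal.tsum_mul_left]
  exact tsum_congr fun p => ptr_smul_left hc hρ (CStarAlgebra.pow_nonneg hQ.nonneg _)

/-- The bounded operator `A (1 + S)⁻¹` for an `S`-bounded operator `A`. -/
noncomputable def IsResolventCompl.lift (hQ : IsResolventCompl S Q) (A : relBounded S) :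
    H →L[ℂ] H :=
  LinearMap.mkContinuousOfExistsBound
    (A.1 ∘ₗ LinearMap.codRestrict S.domain (1 - Q : H →L[ℂ] H).toLinearMap hQ.mem) (by
      obtain ⟨a, b, ha, hb, hA⟩ := A.2
      refine ⟨a * ‖(1 - Q : H →L[ℂ] H)‖ + b * ‖Q‖, fun y => ?_⟩
      have h := hA ⟨(1 - Q : H →L[ℂ] H) y, hQ.mem y⟩
      rw [hQ.apply_eq] at h
      change ‖A.1 ⟨(1 - Q : H →L[ℂ] H) y, hQ.mem y⟩‖ ^ 2 ≤
        a ^ 2 * ‖(1 - Q : H →L[ℂ] H) y‖ ^ 2 + b ^ 2 * ‖Q y‖ ^ 2 at h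
      change ‖A.1 ⟨(1 - Q : H →L[ℂ] H) y, hQ.mem y⟩‖ ≤ _
      have h1 := mul_le_mul_of_nonneg_left ((1 - Q : H →L[ℂ] H).le_opNorm y) ha
      have h2 := mul_le_mul_of_nonneg_left (Q.le_opNorm y) hb
      have h3 : 0 ≤ a * ‖(1 - Q : H →L[ℂ] H) y‖ := by positivity
      have h4 : 0 ≤ b * ‖Q y‖ := by positivity
      have h5 : ‖A.1 ⟨(1 - Q : H →L[ℂ] H) y, hQ.mem y⟩‖ ≤
          a * ‖(1 - Q : H →L[ℂ] H) y‖ + b * ‖Q y‖ :=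
        abs_le_of_sq_le_sq' (by nlinarith) (by positivity) |>.2
      linarith)

theorem IsResolventCompl.lift_apply (hQ : IsResolventCompl S Q) (A : relBounded S) (y : H) :
    hQ.lift A y = A.1 ⟨(1 - Q : H →L[ℂ] H) y, hQ.mem y⟩ := rfl

theorem IsResolventCompl.apply_eq_lift (hQ : IsResolventCompl S Q) (A : relBounded S)
    {φ : S.domain} {y : H} (h : (φ : H) = (1 - Q : H →L[ℂ] H) y) : A.1 φ = hQ.lift A y := by
  rw [hQ.lift_apply]
  congr 1
  exact Subtype.ext h

theorem IsResolventCompl.lift_ofBounded (hQ : IsResolventCompl S Q) (A : H →L[ℂ] H) :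
    hQ.lift (ofBounded S A) = A * (1 - Q) := by
  ext y
  rw [hQ.lift_apply]
  rfl

theorem IsResolventCompl.lift_add (hQ : IsResolventCompl S Q) (A B : relBounded S) :
    hQ.lift (A + B) = hQ.lift A + hQ.lift B := by
  ext y
  rw [add_apply]
  simp only [hQ.lift_apply]
  rfl

theorem IsResolventCompl.lift_smul (hQ : IsResolventCompl S Q) (c : ℂ) (A : relBounded S) :
    hQ.lift (c • A) = c • hQ.lift A := by
  ext y
  rw [smul_apply]
  simp only [hQ.lift_apply]
  rfl

theorem enorm_apply_sq_le_hsq (T : H →L[ℂ] H) (x : H) : ‖T x‖ₑ ^ 2 ≤ hsq T * ‖x‖ₑ ^ 2 := by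
  rw [← tsum_enorm_inner_sq (stdBasis H), ← hsq_star, hsq, ← ENNReal.tsum_mul_right]
  refine ENNReal.tsum_le_tsum fun i => ?_
  rw [← ContinuousLinearMap.adjoint_inner_left, ← mul_pow]
  refine pow_le_pow_left' ?_ 2
  rw [← ofReal_norm, ← ofReal_norm, ← ofReal_norm, ← ENNReal.ofReal_mul (norm_nonneg _)]
  exact ENNReal.ofReal_le_ofReal (norm_inner_le_norm _ _)

theorem enorm_add_sq_le {E : Type*} [NormedAddCommGroup E] (x y : E) :
    ‖x + y‖ₑ ^ 2 ≤ 2 * (‖x‖ₑ ^ 2 + ‖y‖ₑ ^ 2) := by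
  have h2 : (2 : ℝ≥0∞) = ENNReal.ofReal 2 := by simp
  rw [enorm_sq_eq_ofReal, enorm_sq_eq_ofReal, enorm_sq_eq_ofReal, h2, ← ENNReal.ofReal_add
    (by positivity) (by positivity), ← ENNReal.ofReal_mul (by positivity)]
  apply ENNReal.ofReal_le_ofReal
  have := pow_le_pow_left₀ (norm_nonneg _) (norm_add_le x y) 2
  nlinarith [sq_nonneg (‖x‖ - ‖y‖)]

theorem quad_sqrt_apply_le (ρ : H →L[ℂ] H) {B : H →L[ℂ] H} (hB : 0 ≤ B) (x : H) :
    quad B (CFC.sqrt ρ x) ≤ ptr ρ B * ‖x‖ₑ ^ 2 := by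
  rw [ptr_eq_hsq ρ hB, ← enorm_sqrt_apply_sq hB]
  exact enorm_apply_sq_le_hsq (CFC.sqrt B * CFC.sqrt ρ) x

/-- The Hilbert–Schmidt norm dominates the operator norm, term by term. If ρ has finite energy, then
√ρ maps all of H into the domain of S and S√ρ is bounded. -/
theorem IsResolventCompl.sqNorm_sqrt_le (hQ : IsResolventCompl S Q) (ρ : H →L[ℂ] H) (x : H) :
    sqNorm S (CFC.sqrt ρ x) ≤ trConj S ρ * ‖x‖ₑ ^ 2 := by
  rw [hQ.sqNorm_eq, hQ.trConj_eq, ← ENNReal.tsum_mul_right]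
  exact ENNReal.tsum_le_tsum fun p =>
    quad_sqrt_apply_le ρ (CStarAlgebra.pow_nonneg hQ.nonneg (p.1 + p.2 + 2)) x

/-- For `ρ` of finite energy, `√ρ = (1 + S)⁻¹ W` with a Hilbert–Schmidt operator `W`. -/
theorem IsResolventCompl.exists_factor (hQ : IsResolventCompl S Q) {ρ : H →L[ℂ] H}
    (hE : trConj S ρ ≠ ⊤) :
    ∃ W : H →L[ℂ] H, CFC.sqrt ρ = (1 - Q) * W ∧
      hsq W ≤ 2 * (ptr ρ 1 + trConj S ρ) ∧ trConj S ρ = hsq (Q * W) ∧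
      ∀ A : relBounded S, trConj ⟨S.domain, A.1⟩ ρ = hsq (hQ.lift A * W) := by
  have hfin : ∀ x, sqNorm S (CFC.sqrt ρ x) ≠ ⊤ := fun x =>
    ne_top_of_le_ne_top (ENNReal.mul_ne_top hE (ENNReal.pow_ne_top enorm_ne_top))
      (hQ.sqNorm_sqrt_le ρ x)
  have hmem : ∀ x, CFC.sqrt ρ x ∈ S.domain := fun x => mem_of_sqNorm_ne_top (hfin x)
  let T : H →ₗ[ℂ] H := S.toFun ∘ₗ LinearMap.codRestrict S.domain (CFC.sqrt ρ).toLinearMap hmem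
  have hT : ∀ x, T x = S ⟨CFC.sqrt ρ x, hmem x⟩ := fun x => rfl
  let T' : H →L[ℂ] H := T.mkContinuous √(trConj S ρ).toReal (by
    intro x
    have h := hQ.sqNorm_sqrt_le ρ x
    rw [sqNorm_of_mem (hmem x), ← hT] at h
    have h2 := ENNReal.toReal_mono
      (ENNReal.mul_ne_top hE (ENNReal.pow_ne_top enorm_ne_top)) h
    rw [ENNReal.toReal_mul, ENNReal.toReal_pow, ENNReal.toReal_pow, toReal_enorm,
      toReal_enorm] at h2
    refine abs_le_of_sq_le_sq' ?_ (by positivity) |>.2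
    rw [mul_pow, Real.sq_sqrt ENNReal.toReal_nonneg]
    exact h2)
  have hT' : ∀ x, T' x = S ⟨CFC.sqrt ρ x, hmem x⟩ := fun x => rfl
  -- Here T' = S√ρ, so W = (1 + S)√ρ.
  let W : H →L[ℂ] H := CFC.sqrt ρ + T'
  have hRW : ∀ x, (1 - Q : H →L[ℂ] H) (W x) = CFC.sqrt ρ x := fun x =>
    hQ.left_inv ⟨CFC.sqrt ρ x, hmem x⟩
  have hQW : ∀ x, Q (W x) = T' x := by
    intro x
    have h := hRW x
    rw [sub_apply, one_apply_eq_self, sub_eq_iff_eq_add] at h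
    have h2 : W x = CFC.sqrt ρ x + T' x := rfl
    rw [h] at h2
    exact add_left_cancel h2
  have htr : trConj S ρ = hsq T' := tsum_congr fun i => by
    rw [sqNorm_of_mem (hmem _), hT']
  refine ⟨W, ?_, ?_, ?_, fun A => ?_⟩
  · ext x; exact (hRW x).symm
  · rw [ptr_one, htr, hsq, hsq, hsq, ← ENNReal.tsum_add, ← ENNReal.tsum_mul_left]
    exact ENNReal.tsum_le_tsum fun i => enorm_add_sq_le _ _
  · rw [htr]
    exact tsum_congr fun i => by
      rw [← hQW]; rfl
  · refine tsum_congr fun i => ?_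
    rw [sqNorm_of_mem (T := ⟨S.domain, A.1⟩) (hmem _)]
    congr 2
    exact hQ.apply_eq_lift A (φ := ⟨_, hmem _⟩) (hRW _).symm

theorem norm_star_apply_sq_le_of_dense {W W' R : H →L[ℂ] H} (hR : DenseRange R) {c : ℝ}
    (h : ∀ x, c * ‖star W (R x)‖ ^ 2 ≤ ‖star W' (R x)‖ ^ 2) (y : H) :
    c * ‖star W y‖ ^ 2 ≤ ‖star W' y‖ ^ 2 := by
  have hcl : IsClosed {y | c * ‖star W y‖ ^ 2 ≤ ‖star W' y‖ ^ 2} := by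
    refine isClosed_le ?_ ?_
    · fun_prop
    · fun_prop
  exact hR.induction_on (p := fun y => c * ‖star W y‖ ^ 2 ≤ ‖star W' y‖ ^ 2) y hcl h

/-- Monotonicity of `ρ ↦ Tr A ρ A*` for an `S`-bounded operator `A`. -/
theorem IsResolventCompl.mul_trConj_le (hQ : IsResolventCompl S Q) {ρ σ : H →L[ℂ] H}
    (hρ : 0 ≤ ρ) (hσ : 0 ≤ σ) (hEρ : trConj S ρ ≠ ⊤) (hEσ : trConj S σ ≠ ⊤) {c : ℝ} (hc : 0 ≤ c)
    (h : (c : ℂ) • ρ ≤ σ) (A : relBounded S) :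
    ENNReal.ofReal c * trConj ⟨S.domain, A.1⟩ ρ ≤ trConj ⟨S.domain, A.1⟩ σ := by
  obtain ⟨W, hW, -, -, hA⟩ := hQ.exists_factor hEρ
  obtain ⟨W', hW', -, -, hA'⟩ := hQ.exists_factor hEσ
  have hR0 : (0 : H →L[ℂ] H) ≤ 1 - Q := sub_nonneg.2 hQ.le_one
  have hstar : star (1 - Q : H →L[ℂ] H) = 1 - Q := (IsSelfAdjoint.of_nonneg hR0).star_eq
  -- If √τ = (1 - Q)V, then V*(1 - Q) = √τ. The order relation between ρ and σ thus becomes one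
  -- between W* and W'* on the dense range of 1 - Q; it extends to all vectors and is summed over
  -- the vectors (AR)*eᵢ.
  have key : ∀ {τ V : H →L[ℂ] H}, 0 ≤ τ → CFC.sqrt τ = (1 - Q) * V → ∀ x,
      ‖star V ((1 - Q : H →L[ℂ] H) x)‖ₑ ^ 2 = quad τ x := by
    intro τ V hτ hV x
    rw [← enorm_sqrt_apply_sq hτ, ← star_sqrt, hV, star_mul, hstar]
    rfl
  have hle : ∀ y, c * ‖star W y‖ ^ 2 ≤ ‖star W' y‖ ^ 2 := by
    refine norm_star_apply_sq_le_of_dense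
      (denseRange_of_nonneg_of_injective hR0 hQ.injective) fun x => ?_
    rw [← ENNReal.ofReal_le_ofReal_iff (by positivity), ENNReal.ofReal_mul hc,
      ← enorm_sq_eq_ofReal, ← enorm_sq_eq_ofReal, key hρ hW, key hσ hW', ← quad_smul hc]
    exact quad_mono h x
  rw [hA, hA', ← hsq_star, star_mul, ← hsq_star (hQ.lift A * W'), star_mul, hsq, hsq,
    ← ENNReal.tsum_mul_left]
  refine ENNReal.tsum_le_tsum fun i => ?_
  rw [enorm_sq_eq_ofReal, enorm_sq_eq_ofReal, ← ENNReal.ofReal_mul hc]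
  exact ENNReal.ofReal_le_ofReal (hle _)

theorem trConj_le_of_relBoundedWith {ρ : H →L[ℂ] H} (hE : trConj S ρ ≠ ⊤)
    {A : S.domain →ₗ[ℂ] H} {a b : ℝ} (hA : RelBoundedWith S A a b) :
    trConj ⟨S.domain, A⟩ ρ ≤
      ENNReal.ofReal (a ^ 2) * ptr ρ 1 + ENNReal.ofReal (b ^ 2) * trConj S ρ := by
  rw [ptr_one, trConj, trConj, hsq, ← ENNReal.tsum_mul_left, ← ENNReal.tsum_mul_left,
    ← ENNReal.tsum_add]
  refine ENNReal.tsum_le_tsum fun i => ?_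
  have hmem : CFC.sqrt ρ (stdBasis H i) ∈ S.domain :=
    mem_of_sqNorm_ne_top (ENNReal.ne_top_of_tsum_ne_top hE i)
  rw [sqNorm_of_mem hmem, sqNorm_of_mem (T := ⟨S.domain, A⟩) hmem, enorm_sq_eq_ofReal,
    enorm_sq_eq_ofReal, enorm_sq_eq_ofReal, ← ENNReal.ofReal_mul (by positivity),
    ← ENNReal.ofReal_mul (by positivity), ← ENNReal.ofReal_add (by positivity) (by positivity)]
  exact ENNReal.ofReal_le_ofReal (hA ⟨_, hmem⟩)

theorem trConj_pure_of_mem {T : H →ₗ.[ℂ] H} {φ : H} (hφ : ‖φ‖ = 1) (h : φ ∈ T.domain) :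
    trConj T (pure φ) = ‖T ⟨φ, h⟩‖ₑ ^ 2 := by
  have h1 : ∀ i, sqNorm T (CFC.sqrt (pure φ) (stdBasis H i)) =
      ‖⟪stdBasis H i, φ⟫_ℂ‖ₑ ^ 2 * ‖T ⟨φ, h⟩‖ₑ ^ 2 := by
    intro i
    rw [sqrt_pure hφ, InnerProductSpace.rankOne_apply,
      sqNorm_of_mem (T.domain.smul_mem _ h), enorm_inner_comm, ← mul_pow, ← enorm_smul,
      ← LinearPMap.map_smul]
    rfl
  rw [trConj]
  simp only [h1]
  rw [ENNReal.tsum_mul_right, tsum_enorm_inner_sq, enorm_sq_eq_ofReal φ, hφ]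
  simp

/-- Mixing an operator of bounded energy with a pure state of low energy. -/
theorem IsResolventCompl.exists_state_ge (hQ : IsResolventCompl S Q)
    (hlow : ∀ δ > 0, ∃ φ : H, ‖φ‖ = 1 ∧ sqNorm S φ ≤ ENNReal.ofReal δ) {σ : H →L[ℂ] H}
    (hσ : 0 ≤ σ) (htr : ptr σ 1 ≤ 1) {c E F : ℝ} (hc : 0 ≤ c) (hc1 : c ≤ 1) (hE : 0 ≤ E)
    (hσE : trConj S σ ≤ ENNReal.ofReal E) (hF : c * E < F) :
    ∃ ρ, IsState ρ ∧ (c : ℂ) • σ ≤ ρ ∧ trConj S ρ ≤ ENNReal.ofReal F := by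
  -- The strict inequality leaves the energy budget F - cE for a pure state, whose weight 1 - c Tr σ
  -- restores the unit trace.
  obtain ⟨φ, hφ, hφE⟩ := hlow (F - c * E) (sub_pos.2 hF)
  have htop : ptr σ 1 ≠ ⊤ := ne_top_of_le_ne_top ENNReal.one_ne_top htr
  set t := (ptr σ 1).toReal with ht
  have ht0 : 0 ≤ t := ENNReal.toReal_nonneg
  have ht1 : t ≤ 1 := by
    have := ENNReal.toReal_mono ENNReal.one_ne_top htr
    simpa using this
  have hs0 : 0 ≤ 1 - c * t := by nlinarith
  have hs1 : 1 - c * t ≤ 1 := by nlinarith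
  have hσt : ptr σ 1 = ENNReal.ofReal t := (ENNReal.ofReal_toReal htop).symm
  have hcσ := smul_nonneg_of_real hc hσ
  have hpφ := smul_nonneg_of_real hs0 (pure_nonneg φ)
  have hp1 : ptr (pure φ) 1 = 1 := (isState_iff.1 (isState_pure hφ)).2
  refine ⟨(c : ℂ) • σ + ((1 - c * t : ℝ) : ℂ) • pure φ, ?_, le_add_of_nonneg_right hpφ, ?_⟩
  · rw [isState_iff]
    refine ⟨add_nonneg hcσ hpφ, ?_⟩
    rw [ptr_add_left hcσ hpφ zero_le_one, ptr_smul_left hc hσ zero_le_one,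
      ptr_smul_left hs0 (pure_nonneg φ) zero_le_one, hp1, mul_one, hσt, ← ENNReal.ofReal_mul hc,
      ← ENNReal.ofReal_add (by positivity) hs0]
    simp
  · rw [hQ.trConj_add hcσ hpφ, hQ.trConj_smul hc hσ, hQ.trConj_smul hs0 (pure_nonneg φ),
      hQ.trConj_pure]
    have h1 : ENNReal.ofReal c * trConj S σ ≤ ENNReal.ofReal (c * E) := by
      rw [ENNReal.ofReal_mul hc]
      exact mul_le_mul_right hσE _
    have h2 : ENNReal.ofReal (1 - c * t) * sqNorm S φ ≤ ENNReal.ofReal (F - c * E) := by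
      refine le_trans ?_ hφE
      refine mul_le_of_le_one_left (zero_le) ?_
      exact ENNReal.ofReal_le_one.2 hs1
    refine (add_le_add h1 h2).trans_eq ?_
    rw [← ENNReal.ofReal_add (by positivity) (by linarith)]
    congr 1; ring

variable {Φ : (H →L[ℂ] H) →CP (H →L[ℂ] H)}

theorem IsResolventCompl.trConj_predual (hQ : IsResolventCompl S Q) (hΦ : IsNormalMap Φ)
    {ρ : H →L[ℂ] H} (hρ : IsPosTraceClass ρ) :
    trConj S (predual Φ ρ) = ∑' p : ℕ × ℕ, ptr ρ (Φ (Q ^ (p.1 + p.2 + 2))) := by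
  rw [hQ.trConj_eq]
  exact tsum_congr fun p => hΦ.ptr_predual hρ (CStarAlgebra.pow_nonneg hQ.nonneg _)

theorem quad_smul_vec (B : H →L[ℂ] H) (c : ℂ) (x : H) : quad B (c • x) = ‖c‖ₑ ^ 2 * quad B x := by
  rw [quad, quad, enorm_sq_eq_ofReal, ← ENNReal.ofReal_mul (by positivity), map_smul,
    inner_smul_left, inner_smul_right, ← mul_assoc, mul_comm (starRingEnd ℂ c), Complex.mul_conj,
    Complex.re_ofReal_mul, Complex.normSq_eq_norm_sq]

/-- If `Φ_*` maps pure states of finite energy to operators of finite energy, then it does so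
uniformly for all states. -/
theorem IsResolventCompl.exists_energy_bound (hQ : IsResolventCompl S Q) (hΦ : IsNormalMap Φ)
    (h : ∀ φ ∈ S.domain, ‖φ‖ = 1 → trConj S (predual Φ (pure φ)) ≠ ⊤) :
    ∃ C : ℝ≥0∞, C ≠ ⊤ ∧ ∀ ρ, IsPosTraceClass ρ → trConj S ρ ≠ ⊤ →
      trConj S (predual Φ ρ) ≤ C * (ptr ρ 1 + trConj S ρ) := by
  have hX : ∀ p : ℕ × ℕ, 0 ≤ Φ (Q ^ (p.1 + p.2 + 2)) := fun p =>
    CompletelyPositiveMap.nonneg Φ (CStarAlgebra.pow_nonneg hQ.nonneg _)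
  have hq : ∀ φ ∈ S.domain, ∑' p : ℕ × ℕ, quad (Φ (Q ^ (p.1 + p.2 + 2))) φ ≠ ⊤ := by
    intro φ hφ
    by_cases h0 : φ = 0
    · simp [h0, quad]
    have hn : ‖φ‖ ≠ 0 := norm_ne_zero_iff.2 h0
    have hc : ((‖φ‖ : ℂ)) ≠ 0 := by exact_mod_cast hn
    have hu : ‖((‖φ‖ : ℂ)⁻¹ • φ)‖ = 1 := by
      rw [norm_smul, norm_inv, Complex.norm_real, norm_norm, inv_mul_cancel₀ hn]
    have h1 := h ((‖φ‖ : ℂ)⁻¹ • φ) (S.domain.smul_mem _ hφ) hu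
    rw [hQ.trConj_predual hΦ (isState_pure hu).1] at h1
    have h2 : φ = (‖φ‖ : ℂ) • ((‖φ‖ : ℂ)⁻¹ • φ) := by rw [smul_smul, mul_inv_cancel₀ hc, one_smul]
    rw [h2]
    simp only [quad_smul_vec _ (‖φ‖ : ℂ)]
    rw [ENNReal.tsum_mul_left]
    refine ENNReal.mul_ne_top (ENNReal.pow_ne_top enorm_ne_top) ?_
    convert h1 using 3 with p
    exact (ptr_pure _ (hX p)).symm
  let GF : Finset (ℕ × ℕ) → H →L[ℂ] H := fun F => ∑ p ∈ F, Φ (Q ^ (p.1 + p.2 + 2))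
  have hGF : ∀ F, 0 ≤ GF F := fun F => Finset.sum_nonneg fun p _ => hX p
  -- For fixed y the vector (1 - Q)y lies in the domain, so its total output energy bounds all
  -- finite partial sums. The resulting uniform bound C on ‖√GF (1 - Q)‖ is combined below with √ρ =
  -- (1 - Q)W.
  obtain ⟨C, hC⟩ := banach_steinhaus (g := fun F => CFC.sqrt (GF F) * (1 - Q)) (by
    intro y
    refine ⟨√(∑' p : ℕ × ℕ, quad (Φ (Q ^ (p.1 + p.2 + 2))) ((1 - Q : H →L[ℂ] H) y)).toReal,
      fun F => ?_⟩
    have hfin := hq _ (hQ.mem y)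
    apply Real.le_sqrt_of_sq_le
    rw [← ENNReal.ofReal_le_iff_le_toReal hfin, ← enorm_sq_eq_ofReal]
    change ‖CFC.sqrt (GF F) ((1 - Q : H →L[ℂ] H) y)‖ₑ ^ 2 ≤ _
    rw [enorm_sqrt_apply_sq (hGF F), quad_sum F hX]
    exact ENNReal.sum_le_tsum F)
  refine ⟨ENNReal.ofReal C ^ 2 * 2, ENNReal.mul_ne_top (ENNReal.pow_ne_top ENNReal.ofReal_ne_top)
    (by simp), fun ρ hρ hE => ?_⟩
  obtain ⟨W, hW, hW2, -, -⟩ := hQ.exists_factor hE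
  rw [hQ.trConj_predual hΦ hρ, ENNReal.tsum_eq_iSup_sum]
  refine iSup_le fun F => ?_
  have h1 : ∑ p ∈ F, ptr ρ (Φ (Q ^ (p.1 + p.2 + 2))) = ptr ρ (GF F) := by
    simp only [ptr, GF, quad_sum F hX]
    rw [Summable.tsum_finsetSum fun p _ => ENNReal.summable]
  rw [h1, ptr_eq_hsq ρ (hGF F), hW, ← mul_assoc, mul_assoc (ENNReal.ofReal C ^ 2)]
  refine (hsq_mul_le _ _).trans (mul_le_mul' ?_ hW2)
  refine pow_le_pow_left' ?_ 2
  rw [← ofReal_norm]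
  exact ENNReal.ofReal_le_ofReal (hC F)

end FiniteEnergy

end EnergyOp

namespace EnergyOp

/-! ### Extending Φ to relatively bounded operators as a strong limit. -/

section Extension

variable {H : Type*} [NormedAddCommGroup H] [InnerProductSpace ℂ H] [CompleteSpace H]

theorem hsq_eq_ofReal {T : H →L[ℂ] H} (h : hsq T ≠ ⊤) :
    hsq T = ENNReal.ofReal (∑' i, ‖T (stdBasis H i)‖ ^ 2) := by
  rw [ENNReal.ofReal_tsum_of_nonneg (fun i => by positivity) (summable_of_hsq h)]
  exact tsum_congr fun i => enorm_sq_eq_ofReal _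

theorem hsq_mul_ne_top (T : H →L[ℂ] H) {W : H →L[ℂ] H} (hW : hsq W ≠ ⊤) : hsq (T * W) ≠ ⊤ :=
  ne_top_of_le_ne_top (mul_ne_top_of_hsq hW) (hsq_mul_le T W)

/-- Strong convergence of `T n` implies Hilbert–Schmidt convergence of norms of `T n * W`. -/
theorem tendsto_hsq_mul {T : ℕ → H →L[ℂ] H} {T' W : H →L[ℂ] H} (hW : hsq W ≠ ⊤) {K : ℝ}
    (hK : ∀ n x, ‖T n x‖ ≤ K * ‖x‖)
    (hT : ∀ x, Filter.Tendsto (fun n => T n x) Filter.atTop (𝓝 (T' x))) :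
    Filter.Tendsto (fun n => hsq (T n * W)) Filter.atTop (𝓝 (hsq (T' * W))) := by
  simp only [hsq_eq_ofReal (hsq_mul_ne_top _ hW)]
  refine ENNReal.tendsto_ofReal ?_
  refine tendsto_tsum_of_dominated_convergence
    (bound := fun i => K ^ 2 * ‖W (stdBasis H i)‖ ^ 2) ((summable_of_hsq hW).mul_left _)
    (fun i => ((hT (W (stdBasis H i))).norm).pow 2) (Filter.Eventually.of_forall fun n i => ?_)
  rw [norm_pow, norm_norm, ← mul_pow]
  exact pow_le_pow_left₀ (norm_nonneg _) (hK n _) 2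

theorem hsq_sub_le (X Y : H →L[ℂ] H) : hsq (X - Y) ≤ 2 * (hsq X + hsq Y) := by
  rw [hsq, hsq, hsq, ← ENNReal.tsum_add, ← ENNReal.tsum_mul_left]
  refine ENNReal.tsum_le_tsum fun i => ?_
  have h := enorm_add_sq_le (X (stdBasis H i)) (-Y (stdBasis H i))
  rwa [enorm_neg, ← sub_eq_add_neg] at h

theorem isPosTraceClass_pure (φ : H) : IsPosTraceClass (pure φ) := by
  rw [isPosTraceClass_iff, ← ptr_one, ptr_pure φ zero_le_one]
  exact ⟨pure_nonneg φ, ENNReal.ofReal_ne_top⟩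

variable {S : H →ₗ.[ℂ] H} {Q : H →L[ℂ] H} {Φ : (H →L[ℂ] H) →CP (H →L[ℂ] H)}

/-- Kadison–Schwarz summed over the vectors √ρ eᵢ, followed by duality for the positive operator
B*B. -/
theorem hsq_map_mul_sqrt_le (hΦ : IsNormalMap Φ) {ρ : H →L[ℂ] H} (hρ : IsPosTraceClass ρ)
    (B : H →L[ℂ] H) :
    hsq (Φ B * CFC.sqrt ρ) ≤ ‖Φ 1‖ₑ * hsq (B * CFC.sqrt (predual Φ ρ)) := by
  rw [← ptr_star_mul_self (predual Φ ρ), hΦ.ptr_predual hρ (star_mul_self_nonneg B), ptr, hsq,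
    ← ENNReal.tsum_mul_left]
  exact ENNReal.tsum_le_tsum fun i => CompletelyPositiveMap.enorm_apply_sq_le Φ B _

/-- It reduces strong convergence of Φ(Bₙ) at φ to Hilbert–Schmidt convergence of Bₙ√Φ_*(|φ⟩⟨φ|). -/
theorem enorm_map_apply_sq_le (hΦ : IsNormalMap Φ) (B : H →L[ℂ] H) (φ : H) :
    ‖Φ B φ‖ₑ ^ 2 ≤ ‖Φ 1‖ₑ * hsq (B * CFC.sqrt (predual Φ (pure φ))) := by
  rw [← ptr_star_mul_self, hΦ.ptr_predual (isPosTraceClass_pure φ) (star_mul_self_nonneg B),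
    ptr_pure φ (CompletelyPositiveMap.nonneg Φ (star_mul_self_nonneg B))]
  exact CompletelyPositiveMap.enorm_apply_sq_le Φ B φ

theorem tendsto_zero_of_enorm_sq_le {u : ℕ → H} {f : ℕ → ℝ≥0∞}
    (hf : Filter.Tendsto f Filter.atTop (𝓝 0)) (h : ∀ n, ‖u n‖ₑ ^ 2 ≤ f n) :
    Filter.Tendsto u Filter.atTop (𝓝 0) := by
  have h1 : Filter.Tendsto (fun n => ‖u n‖ₑ ^ 2) Filter.atTop (𝓝 0) :=
    tendsto_of_tendsto_of_tendsto_of_le_of_le tendsto_const_nhds hf (fun n => zero_le) h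
  have h2 := (ENNReal.tendsto_toReal ENNReal.zero_ne_top).comp h1
  have h3 := (Real.continuous_sqrt.tendsto _).comp h2
  simp only [ENNReal.toReal_zero, Real.sqrt_zero] at h3
  rw [tendsto_zero_iff_norm_tendsto_zero]
  refine h3.congr fun n => ?_
  simp [Real.sqrt_sq]

theorem cauchySeq_of_enorm_sub_sq_le {u : ℕ → H} {f : ℕ → ℝ≥0∞}
    (hf : Filter.Tendsto f Filter.atTop (𝓝 0)) (h : ∀ m n, ‖u m - u n‖ₑ ^ 2 ≤ f m + f n) :
    CauchySeq u := by
  rw [Metric.cauchySeq_iff]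
  intro ε hε
  have hε2 : 0 < ENNReal.ofReal (ε ^ 2 / 2) := ENNReal.ofReal_pos.2 (by positivity)
  obtain ⟨N, hN⟩ := Filter.eventually_atTop.1 (hf.eventually_lt_const hε2)
  refine ⟨N, fun m hm n hn => ?_⟩
  have h1 := (h m n).trans_lt (ENNReal.add_lt_add (hN m hm) (hN n hn))
  rw [← ENNReal.ofReal_add (by positivity) (by positivity), add_halves, enorm_sq_eq_ofReal] at h1
  rw [dist_eq_norm]
  exact lt_of_pow_lt_pow_left₀ 2 hε.le ((ENNReal.ofReal_lt_ofReal_iff (by positivity)).1 h1)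

/-- Bounded approximations of an `S`-bounded operator. -/
noncomputable def IsResolventCompl.approx (hQ : IsResolventCompl S Q) (A : relBounded S) (n : ℕ) :
    H →L[ℂ] H := hQ.lift A * neumann Q n

/-- The approximants are A(1 - Qⁿ): they are bounded because 1 - Qⁿ = (1 - Q)(1 + ... + Qⁿ⁻¹) maps H
into the domain of S. This form is the one that meets the factor 1 - Q of a finite-energy √ρ. -/
theorem IsResolventCompl.approx_mul (hQ : IsResolventCompl S Q) (A : relBounded S) (n : ℕ) :
    hQ.approx A n * (1 - Q) = hQ.lift A * (1 - Q ^ n) := by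
  rw [approx, mul_assoc, neumann_mul_one_sub]

theorem IsResolventCompl.norm_mul_pow_apply_le (hQ : IsResolventCompl S Q) (A : H →L[ℂ] H) (n : ℕ)
    (x : H) : ‖(A * Q ^ n) x‖ ≤ ‖A‖ * ‖x‖ :=
  (A.le_opNorm _).trans (mul_le_mul_of_nonneg_left
    (norm_pow_apply_le hQ.nonneg hQ.le_one n x) (norm_nonneg _))

theorem IsResolventCompl.tendsto_mul_pow_apply (hQ : IsResolventCompl S Q) (A : H →L[ℂ] H)
    (x : H) : Filter.Tendsto (fun n => (A * Q ^ n) x) Filter.atTop (𝓝 0) := by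
  have h := (A.continuous.tendsto 0).comp
    (tendsto_pow_apply_zero hQ.nonneg hQ.le_one hQ.injective x)
  rwa [map_zero] at h

theorem IsResolventCompl.tendsto_hsq_mul_pow (hQ : IsResolventCompl S Q) (A : H →L[ℂ] H)
    {W : H →L[ℂ] H} (hW : hsq W ≠ ⊤) :
    Filter.Tendsto (fun n => hsq (A * Q ^ n * W)) Filter.atTop (𝓝 0) := by
  have h := tendsto_hsq_mul (T' := 0) hW (hQ.norm_mul_pow_apply_le A) (hQ.tendsto_mul_pow_apply A)
  have h0 : hsq (0 * W) = 0 := by simp [hsq]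
  rwa [h0] at h

theorem IsResolventCompl.tendsto_hsq_mul_one_sub_pow (hQ : IsResolventCompl S Q) (A : H →L[ℂ] H)
    {W : H →L[ℂ] H} (hW : hsq W ≠ ⊤) :
    Filter.Tendsto (fun n => hsq (A * (1 - Q ^ n) * W)) Filter.atTop (𝓝 (hsq (A * W))) := by
  refine tendsto_hsq_mul hW (K := 2 * ‖A‖) (fun n x => ?_) (fun x => ?_)
  · rw [mul_sub, mul_one, sub_apply]
    refine (norm_sub_le _ _).trans ?_
    have h1 := A.le_opNorm x
    have h2 := hQ.norm_mul_pow_apply_le A n x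
    linarith
  · simp only [mul_sub, mul_one, sub_apply]
    simpa using (tendsto_const_nhds (x := A x)).sub (hQ.tendsto_mul_pow_apply A x)

/-- `Φ_*` maps operators of finite energy to operators of finite energy. -/
def PreservesFiniteEnergy (Φ : (H →L[ℂ] H) →CP (H →L[ℂ] H)) (S : H →ₗ.[ℂ] H) : Prop :=
  ∀ ρ, IsPosTraceClass ρ → trConj S ρ ≠ ⊤ → trConj S (predual Φ ρ) ≠ ⊤

theorem ptr_predual_one_le (hΦ : IsNormalMap Φ) (hsub : Φ 1 ≤ 1) {ρ : H →L[ℂ] H}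
    (hρ : IsPosTraceClass ρ) : ptr (predual Φ ρ) 1 ≤ ptr ρ 1 := by
  rw [hΦ.ptr_predual hρ zero_le_one]
  exact ptr_mono_right ρ hsub

theorem IsResolventCompl.exists_factor_predual (hQ : IsResolventCompl S Q) (hΦ : IsNormalMap Φ)
    (hpres : PreservesFiniteEnergy Φ S) {ρ : H →L[ℂ] H} (hρ : IsPosTraceClass ρ)
    (hE : trConj S ρ ≠ ⊤) :
    ∃ W : H →L[ℂ] H, hsq W ≠ ⊤ ∧ CFC.sqrt (predual Φ ρ) = (1 - Q) * W ∧
      ∀ A : relBounded S, trConj ⟨S.domain, A.1⟩ (predual Φ ρ) = hsq (hQ.lift A * W) := by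
  have hE' := hpres ρ hρ hE
  obtain ⟨W, h1, h2, -, h3⟩ := hQ.exists_factor hE'
  refine ⟨W, ne_top_of_le_ne_top (ENNReal.mul_ne_top (by simp) (ENNReal.add_ne_top.2 ⟨?_, hE'⟩)) h2,
    h1, h3⟩
  rw [ptr_one]
  exact (isPosTraceClass_iff.1 (hΦ.predual_spec hρ).1).2

theorem IsResolventCompl.trConj_pure_ne_top (hQ : IsResolventCompl S Q) (φ : S.domain) :
    trConj S (pure (φ : H)) ≠ ⊤ := by
  rw [hQ.trConj_pure, sqNorm_of_mem φ.2]
  exact ENNReal.pow_ne_top enorm_ne_top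

/-- With √Φ_*(|φ⟩⟨φ|) = (1 - Q)W, the difference of two approximants acts as AR(Qⁿ - Qᵐ)W. This is
small in Hilbert–Schmidt norm, since Qⁿ → 0 strongly and W is Hilbert–Schmidt. -/
theorem IsResolventCompl.cauchySeq_approx (hQ : IsResolventCompl S Q) (hΦ : IsNormalMap Φ)
    (hpres : PreservesFiniteEnergy Φ S) (A : relBounded S) (φ : S.domain) :
    CauchySeq fun n => Φ (hQ.approx A n) (φ : H) := by
  obtain ⟨W, hW, hσ, -⟩ := hQ.exists_factor_predual hΦ hpres (isPosTraceClass_pure (φ : H))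
    (hQ.trConj_pure_ne_top φ)
  have hlim : Filter.Tendsto (fun n => ‖Φ 1‖ₑ * (2 * hsq (hQ.lift A * Q ^ n * W))) Filter.atTop
      (𝓝 0) := by
    have h := ENNReal.Tendsto.const_mul (a := 2)
      (hQ.tendsto_hsq_mul_pow (hQ.lift A) hW) (Or.inr (by simp))
    have h2 := ENNReal.Tendsto.const_mul (a := ‖Φ 1‖ₑ) h (Or.inr enorm_ne_top)
    simpa using h2
  refine cauchySeq_of_enorm_sub_sq_le hlim fun m n => ?_
  have h1 : Φ (hQ.approx A m) (φ : H) - Φ (hQ.approx A n) (φ : H) =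
      Φ (hQ.approx A m - hQ.approx A n) (φ : H) := by rw [map_sub, sub_apply]
  rw [h1, ← mul_add, ← mul_add]
  refine (enorm_map_apply_sq_le hΦ _ _).trans (mul_le_mul_right ?_ _)
  have h2 : (hQ.approx A m - hQ.approx A n) * CFC.sqrt (predual Φ (pure (φ : H))) =
      hQ.lift A * Q ^ n * W - hQ.lift A * Q ^ m * W := by
    rw [hσ, ← mul_assoc, sub_mul, hQ.approx_mul, hQ.approx_mul]
    noncomm_ring
  rw [h2, add_comm]
  exact hsq_sub_le _ _

/-- The extension of `Φ` to an `S`-bounded operator, as a linear map on the domain of `S`. -/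
noncomputable def IsResolventCompl.extend (hQ : IsResolventCompl S Q) (hΦ : IsNormalMap Φ)
    (hpres : PreservesFiniteEnergy Φ S) (A : relBounded S) : S.domain →ₗ[ℂ] H where
  toFun φ := Filter.limUnder Filter.atTop fun n => Φ (hQ.approx A n) (φ : H)
  map_add' φ ψ := by
    refine Filter.Tendsto.limUnder_eq ?_
    refine ((hQ.cauchySeq_approx hΦ hpres A φ).tendsto_limUnder.add
      (hQ.cauchySeq_approx hΦ hpres A ψ).tendsto_limUnder).congr fun n => ?_
    rw [Submodule.coe_add, map_add]
  map_smul' c φ := by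
    refine Filter.Tendsto.limUnder_eq ?_
    refine ((hQ.cauchySeq_approx hΦ hpres A φ).tendsto_limUnder.const_smul c).congr fun n => ?_
    rw [Submodule.coe_smul, map_smul]

theorem IsResolventCompl.tendsto_extend (hQ : IsResolventCompl S Q) (hΦ : IsNormalMap Φ)
    (hpres : PreservesFiniteEnergy Φ S) (A : relBounded S) (φ : S.domain) :
    Filter.Tendsto (fun n => Φ (hQ.approx A n) (φ : H)) Filter.atTop
      (𝓝 (hQ.extend hΦ hpres A φ)) :=
  (hQ.cauchySeq_approx hΦ hpres A φ).tendsto_limUnder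

theorem IsResolventCompl.extend_add (hQ : IsResolventCompl S Q) (hΦ : IsNormalMap Φ)
    (hpres : PreservesFiniteEnergy Φ S) (A B : relBounded S) :
    hQ.extend hΦ hpres (A + B) = hQ.extend hΦ hpres A + hQ.extend hΦ hpres B := by
  ext φ
  refine tendsto_nhds_unique (hQ.tendsto_extend hΦ hpres (A + B) φ) ?_
  refine ((hQ.tendsto_extend hΦ hpres A φ).add (hQ.tendsto_extend hΦ hpres B φ)).congr fun n => ?_
  rw [approx, approx, approx, hQ.lift_add, add_mul, map_add, add_apply]

theorem IsResolventCompl.extend_smul (hQ : IsResolventCompl S Q) (hΦ : IsNormalMap Φ)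
    (hpres : PreservesFiniteEnergy Φ S) (c : ℂ) (A : relBounded S) :
    hQ.extend hΦ hpres (c • A) = c • hQ.extend hΦ hpres A := by
  ext φ
  refine tendsto_nhds_unique (hQ.tendsto_extend hΦ hpres (c • A) φ) ?_
  refine ((hQ.tendsto_extend hΦ hpres A φ).const_smul c).congr fun n => ?_
  rw [approx, approx, hQ.lift_smul, smul_mul_assoc, map_smul, smul_apply]

/-- For bounded A the approximants are A - AQⁿ, and Φ(AQⁿ)φ → 0 by the same Hilbert–Schmidt
estimate. -/
theorem IsResolventCompl.extend_ofBounded (hQ : IsResolventCompl S Q) (hΦ : IsNormalMap Φ)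
    (hpres : PreservesFiniteEnergy Φ S) (A : H →L[ℂ] H) (φ : S.domain) :
    hQ.extend hΦ hpres (ofBounded S A) φ = Φ A (φ : H) := by
  refine tendsto_nhds_unique (hQ.tendsto_extend hΦ hpres _ φ) ?_
  have hσ := (isPosTraceClass_iff.1 (hΦ.predual_spec (isPosTraceClass_pure (φ : H))).1).2
  have h1 : Filter.Tendsto (fun n => Φ (A * Q ^ n) (φ : H)) Filter.atTop (𝓝 0) := by
    refine tendsto_zero_of_enorm_sq_le ?_ fun n => enorm_map_apply_sq_le hΦ _ _
    have h2 := ENNReal.Tendsto.const_mul (a := ‖Φ 1‖ₑ) (hQ.tendsto_hsq_mul_pow A hσ)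
      (Or.inr enorm_ne_top)
    simpa using h2
  have h3 := (tendsto_const_nhds (x := Φ A (φ : H))).sub h1
  rw [sub_zero] at h3
  refine h3.congr fun n => ?_
  rw [approx, hQ.lift_ofBounded, mul_assoc, one_sub_mul_neumann, mul_sub, mul_one, map_sub,
    sub_apply]

/-- The basic inequality behind all bounds on the extension. It holds for the approximants; a
Fatou-type argument over finite sets of basis vectors passes it to the limit. -/
theorem IsResolventCompl.trConj_extend_le (hQ : IsResolventCompl S Q) (hΦ : IsNormalMap Φ)
    (hpres : PreservesFiniteEnergy Φ S) (A : relBounded S) {ρ : H →L[ℂ] H}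
    (hρ : IsPosTraceClass ρ) (hE : trConj S ρ ≠ ⊤) :
    trConj ⟨S.domain, hQ.extend hΦ hpres A⟩ ρ ≤
      ‖Φ 1‖ₑ * trConj ⟨S.domain, A.1⟩ (predual Φ ρ) := by
  obtain ⟨W, hW, hσ, hA⟩ := hQ.exists_factor_predual hΦ hpres hρ hE
  rw [hA, trConj, ENNReal.tsum_eq_iSup_sum]
  refine iSup_le fun F => ?_
  have hmem : ∀ i, CFC.sqrt ρ (stdBasis H i) ∈ S.domain := fun i =>
    mem_of_sqNorm_ne_top (ENNReal.ne_top_of_tsum_ne_top hE i)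
  have h1 : Filter.Tendsto
      (fun n => ∑ i ∈ F, ‖Φ (hQ.approx A n) (CFC.sqrt ρ (stdBasis H i))‖ₑ ^ 2) Filter.atTop
      (𝓝 (∑ i ∈ F, sqNorm ⟨S.domain, hQ.extend hΦ hpres A⟩ (CFC.sqrt ρ (stdBasis H i)))) := by
    refine tendsto_finsetSum F fun i _ => ?_
    rw [sqNorm_of_mem (T := ⟨S.domain, hQ.extend hΦ hpres A⟩) (hmem i)]
    exact ENNReal.Tendsto.pow (hQ.tendsto_extend hΦ hpres A ⟨_, hmem i⟩).enorm
  have h2 := ENNReal.Tendsto.const_mul (a := ‖Φ 1‖ₑ)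
    (hQ.tendsto_hsq_mul_one_sub_pow (hQ.lift A) hW) (Or.inr enorm_ne_top)
  refine le_of_tendsto_of_tendsto' h1 h2 fun n => ?_
  refine (ENNReal.sum_le_tsum F).trans ?_
  have h3 := hsq_map_mul_sqrt_le hΦ hρ (hQ.approx A n)
  rw [hσ, ← mul_assoc, hQ.approx_mul] at h3
  exact h3

end Extension

end EnergyOp

namespace EnergyOp

/-! ### Growth of the maximal output energy, E-norm inequalities and relative bounds. -/

section Estimates

variable {H : Type*} [NormedAddCommGroup H] [InnerProductSpace ℂ H] [CompleteSpace H]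
  {G : H →ₗ.[ℂ] H} {hG : IsPosSelfAdjoint G} {Q : H →L[ℂ] H}
  {Φ : (H →L[ℂ] H) →CP (H →L[ℂ] H)}

theorem exists_unit_sqNorm_le [Nontrivial H]
    (hG0 : sInf {r : ℝ | ∃ φ : G.domain, ‖(φ : H)‖ = 1 ∧ r = ‖G φ‖} = 0) :
    ∀ δ > 0, ∃ φ : H, ‖φ‖ = 1 ∧ sqNorm (sqrtOp G hG) φ ≤ ENNReal.ofReal δ := by
  intro δ hδ
  -- The infimum of the empty set of reals is 0 by convention, so the hypothesis alone does not
  -- supply a unit vector; density of the domain does.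
  have hne : {r : ℝ | ∃ φ : G.domain, ‖(φ : H)‖ = 1 ∧ r = ‖G φ‖}.Nonempty := by
    obtain ⟨ψ, hψ⟩ : ∃ ψ : G.domain, (ψ : H) ≠ 0 := by
      by_contra! h
      have hd := hG.isSelfAdjoint.dense_domain
      obtain ⟨x, hx⟩ := exists_ne (0 : H)
      have hbot : (G.domain : Set H) ⊆ {0} := fun y hy => h ⟨y, hy⟩
      have := closure_minimal hbot isClosed_singleton (hd x)
      exact hx this
    refine ⟨_, (‖(ψ : H)‖ : ℂ)⁻¹ • ψ, ?_, rfl⟩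
    rw [Submodule.coe_smul, norm_smul, norm_inv, Complex.norm_real, norm_norm,
      inv_mul_cancel₀ (norm_ne_zero_iff.2 hψ)]
  obtain ⟨r, ⟨φ, hφ, rfl⟩, hr⟩ := exists_lt_of_csInf_lt hne (hG0.trans_lt hδ)
  refine ⟨φ, hφ, ?_⟩
  have hs := sqrtOp_spec G hG
  obtain ⟨hx, hSx⟩ := (hs.mem_domain φ).1 φ.2
  rw [sqNorm_of_mem hx, enorm_sq_eq_ofReal]
  refine ENNReal.ofReal_le_ofReal ?_
  -- For a unit vector in D(G), ‖√Gφ‖² = ⟨φ, Gφ⟩ ≤ ‖Gφ‖.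
  have h1 := hs.posSelfAdjoint.inner_symm ⟨φ, hx⟩ ⟨_, hSx⟩
  rw [← hs.apply_eq φ hx hSx] at h1
  rw [← re_inner_self_eq]
  change (⟪sqrtOp G hG ⟨φ, hx⟩, sqrtOp G hG ⟨φ, hx⟩⟫_ℂ) = ⟪(φ : H), G φ⟫_ℂ at h1
  rw [h1]
  refine (Complex.re_le_norm _).trans ((norm_inner_le_norm _ _).trans ?_)
  rw [hφ, one_mul]
  exact hr.le

/-- Mixing needs room for a state of small but possibly positive energy, so it only reaches weights
c < d; this closes the gap. -/
theorem mul_le_of_forall_mul_le {d e y : ℝ} (hd : 0 < d) (he : 0 ≤ e) (hy : 0 ≤ y)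
    (h : ∀ c, 0 ≤ c → c < d → c * e ≤ y) : d * e ≤ y := by
  by_contra! hlt
  have he0 : 0 < e := by
    rcases he.eq_or_lt with h0 | h0
    · rw [← h0, mul_zero] at hlt; linarith
    · exact h0
  have h1 : y / e < d := (div_lt_iff₀ he0).2 hlt
  have h2 : 0 ≤ y / e := by positivity
  have h3 := h ((y / e + d) / 2) (by linarith) (by linarith)
  have h4 : y / e * e = y := div_mul_cancel₀ y he0.ne'
  nlinarith

theorem energy_predual_le_maxEnergy {ρ : H →L[ℂ] H} (hρ : IsState ρ) {E : ℝ}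
    (hE : energy G hG ρ ≤ ENNReal.ofReal E) :
    energy G hG (predual Φ ρ) ≤ maxEnergy Φ G hG E :=
  le_iSup_of_le ρ (le_iSup_of_le hρ (le_iSup_of_le hE le_rfl))

theorem IsLimited.exists_energy_bound (hlim : IsLimited Φ G hG) (hΦ : IsNormalMap Φ)
    (hQ : IsResolventCompl (sqrtOp G hG) Q) :
    ∃ C : ℝ≥0∞, C ≠ ⊤ ∧ ∀ ρ, IsPosTraceClass ρ → energy G hG ρ ≠ ⊤ →
      energy G hG (predual Φ ρ) ≤ C * (ptr ρ 1 + energy G hG ρ) :=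
  hQ.exists_energy_bound hΦ fun φ hφ hn =>
    (hlim (pure φ) (isState_pure hn) (lt_top_iff_ne_top.2 (hQ.trConj_pure_ne_top ⟨φ, hφ⟩))).ne

theorem IsLimited.preservesFiniteEnergy (hlim : IsLimited Φ G hG) (hΦ : IsNormalMap Φ)
    (hQ : IsResolventCompl (sqrtOp G hG) Q) : PreservesFiniteEnergy Φ (sqrtOp G hG) := by
  obtain ⟨C, hC, h⟩ := hlim.exists_energy_bound hΦ hQ
  intro ρ hρ hE
  refine ne_top_of_le_ne_top (ENNReal.mul_ne_top hC (ENNReal.add_ne_top.2 ⟨?_, hE⟩)) (h ρ hρ hE)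
  rw [ptr_one]
  exact (isPosTraceClass_iff.1 hρ).2

theorem IsLimited.maxEnergy_lt_top (hlim : IsLimited Φ G hG) (hΦ : IsNormalMap Φ) (E : ℝ) :
    maxEnergy Φ G hG E < ⊤ := by
  obtain ⟨Q, hQ⟩ := (sqrtOp_spec G hG).posSelfAdjoint.exists_isResolventCompl
  obtain ⟨C, hC, h⟩ := hlim.exists_energy_bound hΦ hQ
  refine lt_of_le_of_lt (b := C * (1 + ENNReal.ofReal E)) ?_
    (ENNReal.mul_lt_top hC.lt_top (by simp))
  refine iSup_le fun ρ => iSup_le fun hρ => iSup_le fun hE => ?_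
  refine (h ρ hρ.1 (ne_top_of_le_ne_top ENNReal.ofReal_ne_top hE)).trans ?_
  rw [(isState_iff.1 hρ).2]
  exact mul_le_mul_right (add_le_add le_rfl hE) _

/-- Equivalently, Y_Φ(E)/E is nonincreasing. A state of energy at most F, scaled by c < E/F and
completed by a low-energy pure state, is admissible at level E, and the completion can only increase
the output energy. -/
theorem maxEnergy_le_mul (hΦ : IsNormalMap Φ) (hQ : IsResolventCompl (sqrtOp G hG) Q)
    (hlow : ∀ δ > 0, ∃ φ : H, ‖φ‖ = 1 ∧ sqNorm (sqrtOp G hG) φ ≤ ENNReal.ofReal δ)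
    (hfin : ∀ E, maxEnergy Φ G hG E < ⊤) {E F : ℝ} (hE : 0 < E) (hEF : E ≤ F) :
    (maxEnergy Φ G hG F).toReal ≤ F / E * (maxEnergy Φ G hG E).toReal := by
  have hF : 0 < F := hE.trans_le hEF
  have hy : 0 ≤ (maxEnergy Φ G hG E).toReal := ENNReal.toReal_nonneg
  refine ENNReal.toReal_le_of_le_ofReal (by positivity) ?_
  refine iSup_le fun ρ => iSup_le fun hρ => iSup_le fun hρE => ?_
  obtain ⟨hρ0, hρ1⟩ := isState_iff.1 hρ
  have hefin : energy G hG (predual Φ ρ) ≠ ⊤ :=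
    ne_top_of_le_ne_top (hfin F).ne (energy_predual_le_maxEnergy hρ hρE)
  rw [ENNReal.le_ofReal_iff_toReal_le hefin (by positivity)]
  have hd1 : E / F ≤ 1 := (div_le_one hF).2 hEF
  have key : E / F * (energy G hG (predual Φ ρ)).toReal ≤ (maxEnergy Φ G hG E).toReal := by
    refine mul_le_of_forall_mul_le (by positivity) ENNReal.toReal_nonneg hy fun c hc hcd => ?_
    obtain ⟨ρ', hρ', hle, hE'⟩ := hQ.exists_state_ge hlow hρ0 hρ1.le hc (hcd.le.trans hd1) hF.le
      hρE ((lt_div_iff₀ hF).1 hcd)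
    have h1 : ENNReal.ofReal c * energy G hG (predual Φ ρ) ≤ maxEnergy Φ G hG E := by
      refine le_trans ?_ (energy_predual_le_maxEnergy hρ' hE')
      rw [energy, energy, hQ.trConj_predual hΦ hρ.1, hQ.trConj_predual hΦ hρ'.1,
        ← ENNReal.tsum_mul_left]
      refine ENNReal.tsum_le_tsum fun p => ?_
      have hX := CompletelyPositiveMap.nonneg Φ
        (CStarAlgebra.pow_nonneg hQ.nonneg (p.1 + p.2 + 2))
      rw [← ptr_smul_left hc hρ0 hX]
      exact ptr_mono_left (smul_nonneg_of_real hc hρ0) hle hX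
    have h2 := ENNReal.toReal_mono (hfin E).ne h1
    rwa [ENNReal.toReal_mul, ENNReal.toReal_ofReal hc] at h2
  calc (energy G hG (predual Φ ρ)).toReal
      = F / E * (E / F * (energy G hG (predual Φ ρ)).toReal) := by field_simp
    _ ≤ _ := mul_le_mul_of_nonneg_left key (by positivity)

theorem eNorm_nonneg (E : ℝ) (A : BG G hG) : 0 ≤ eNorm G hG E A := by
  refine Real.sSup_nonneg ?_
  rintro _ ⟨ρ, -, -, rfl⟩
  positivity

theorem trConj_le_eNorm_sq {E : ℝ} (hE0 : 0 ≤ E) (A : BG G hG) {ρ : H →L[ℂ] H} (hρ : IsState ρ)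
    (hE : energy G hG ρ ≤ ENNReal.ofReal E) :
    trConj ⟨(sqrtOp G hG).domain, A.1⟩ ρ ≤ ENNReal.ofReal (eNorm G hG E A ^ 2) := by
  obtain ⟨a, b, ha, hb, hA⟩ := A.2
  have hbound : ∀ ρ : H →L[ℂ] H, IsState ρ → energy G hG ρ ≤ ENNReal.ofReal E →
      trConj ⟨(sqrtOp G hG).domain, A.1⟩ ρ ≤ ENNReal.ofReal (a ^ 2 + b ^ 2 * E) := by
    intro ρ hρ hE
    refine (trConj_le_of_relBoundedWith (ne_top_of_le_ne_top ENNReal.ofReal_ne_top hE) hA).trans ?_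
    rw [(isState_iff.1 hρ).2, mul_one, ENNReal.ofReal_add (by positivity) (by positivity),
      ENNReal.ofReal_mul (by positivity)]
    exact add_le_add le_rfl (mul_le_mul_right hE _)
  -- The supremum of an unbounded set of reals is 0 by convention, so the E-norm dominates its
  -- competitors only because of this bound.
  have hbdd : BddAbove {r | ∃ ρ : H →L[ℂ] H, IsState ρ ∧ energy G hG ρ ≤ ENNReal.ofReal E ∧
      r = √(trConj ⟨(sqrtOp G hG).domain, A.1⟩ ρ).toReal} := by
    refine ⟨√(a ^ 2 + b ^ 2 * E), ?_⟩
    rintro _ ⟨ρ, hρ, hE, rfl⟩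
    exact Real.sqrt_le_sqrt (ENNReal.toReal_le_of_le_ofReal (by positivity) (hbound ρ hρ hE))
  have h1 : √(trConj ⟨(sqrtOp G hG).domain, A.1⟩ ρ).toReal ≤ eNorm G hG E A :=
    le_csSup hbdd ⟨ρ, hρ, hE, rfl⟩
  rw [ENNReal.le_ofReal_iff_toReal_le
    (ne_top_of_le_ne_top ENNReal.ofReal_ne_top (hbound ρ hρ hE)) (by positivity)]
  rwa [Real.sqrt_le_left (eNorm_nonneg E A)] at h1

theorem eNorm_le {E C : ℝ} (hC : 0 ≤ C) (A : BG G hG)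
    (h : ∀ ρ : H →L[ℂ] H, IsState ρ → energy G hG ρ ≤ ENNReal.ofReal E →
      trConj ⟨(sqrtOp G hG).domain, A.1⟩ ρ ≤ ENNReal.ofReal (C ^ 2)) :
    eNorm G hG E A ≤ C := by
  refine Real.sSup_le ?_ hC
  rintro _ ⟨ρ, hρ, hE, rfl⟩
  rw [Real.sqrt_le_left hC]
  exact ENNReal.toReal_le_of_le_ofReal (by positivity) (h ρ hρ hE)

/-- `Tr A σ A*` is bounded by the operator `E`-norm also for operators `σ` of trace at most one. -/
theorem mul_trConj_le_eNorm_sq (hQ : IsResolventCompl (sqrtOp G hG) Q)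
    (hlow : ∀ δ > 0, ∃ φ : H, ‖φ‖ = 1 ∧ sqNorm (sqrtOp G hG) φ ≤ ENNReal.ofReal δ)
    (A : BG G hG) {σ : H →L[ℂ] H} (hσ : 0 ≤ σ) (htr : ptr σ 1 ≤ 1) {d E F : ℝ} (hd : 0 < d)
    (hd1 : d ≤ 1) (hE : 0 ≤ E) (hσE : energy G hG σ ≤ ENNReal.ofReal E) (hF : 0 < F)
    (hdF : d * E ≤ F) :
    ENNReal.ofReal d * trConj ⟨(sqrtOp G hG).domain, A.1⟩ σ ≤
      ENNReal.ofReal (eNorm G hG F A ^ 2) := by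
  have hEσ : trConj (sqrtOp G hG) σ ≠ ⊤ := ne_top_of_le_ne_top ENNReal.ofReal_ne_top hσE
  have hstep : ∀ c, 0 ≤ c → c < d → ENNReal.ofReal c * trConj ⟨(sqrtOp G hG).domain, A.1⟩ σ ≤
      ENNReal.ofReal (eNorm G hG F A ^ 2) := by
    intro c hc hcd
    have hcE : c * E < F := by
      rcases hE.eq_or_lt with h0 | h0
      · rw [← h0, mul_zero]; exact hF
      · exact (mul_lt_mul_of_pos_right hcd h0).trans_le hdF
    obtain ⟨ρ, hρ, hle, hρE⟩ := hQ.exists_state_ge hlow hσ htr hc (hcd.le.trans hd1) hE hσE hcE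
    exact (hQ.mul_trConj_le hσ (isState_iff.1 hρ).1 hEσ
      (ne_top_of_le_ne_top ENNReal.ofReal_ne_top hρE) hc hle A).trans
      (trConj_le_eNorm_sq hF.le A hρ hρE)
  have hfin : trConj ⟨(sqrtOp G hG).domain, A.1⟩ σ ≠ ⊤ := by
    obtain ⟨a, b, ha, hb, hA⟩ := A.2
    refine ne_top_of_le_ne_top ?_ (trConj_le_of_relBoundedWith hEσ hA)
    exact ENNReal.add_ne_top.2 ⟨ENNReal.mul_ne_top ENNReal.ofReal_ne_top
      (ne_top_of_le_ne_top ENNReal.one_ne_top htr),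
      ENNReal.mul_ne_top ENNReal.ofReal_ne_top hEσ⟩
  have h := mul_le_of_forall_mul_le hd (ENNReal.toReal_nonneg
    (a := trConj ⟨(sqrtOp G hG).domain, A.1⟩ σ)) (sq_nonneg (eNorm G hG F A)) fun c hc hcd => by
      have := ENNReal.toReal_le_of_le_ofReal (by positivity) (hstep c hc hcd)
      rwa [ENNReal.toReal_mul, ENNReal.toReal_ofReal hc] at this
  rw [← ENNReal.ofReal_toReal hfin, ← ENNReal.ofReal_mul hd.le]
  exact ENNReal.ofReal_le_ofReal h

/-- Φ_* may lower the trace and Y_Φ(E) may vanish. At E = 0 mixing could exceed the energy budget,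
so a nonzero σ is normalised instead; this keeps its energy 0 and increases it as an operator. -/
theorem trConj_le_eNorm_sq_of_trace_le_one (hQ : IsResolventCompl (sqrtOp G hG) Q)
    (hlow : ∀ δ > 0, ∃ φ : H, ‖φ‖ = 1 ∧ sqNorm (sqrtOp G hG) φ ≤ ENNReal.ofReal δ)
    (A : BG G hG) {σ : H →L[ℂ] H} (hσ : 0 ≤ σ) (htr : ptr σ 1 ≤ 1) {E : ℝ} (hE : 0 ≤ E)
    (hσE : energy G hG σ ≤ ENNReal.ofReal E) :
    trConj ⟨(sqrtOp G hG).domain, A.1⟩ σ ≤ ENNReal.ofReal (eNorm G hG E A ^ 2) := by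
  rcases hE.eq_or_lt with h0 | h0
  · have hE0 : trConj (sqrtOp G hG) σ = 0 := by
      rw [← h0, ENNReal.ofReal_zero] at hσE
      exact le_antisymm hσE zero_le
    have hEσ : trConj (sqrtOp G hG) σ ≠ ⊤ := by rw [hE0]; exact ENNReal.zero_ne_top
    have htop : ptr σ 1 ≠ ⊤ := ne_top_of_le_ne_top ENNReal.one_ne_top htr
    by_cases ht : ptr σ 1 = 0
    · obtain ⟨a, b, ha, hb, hA⟩ := A.2
      refine (trConj_le_of_relBoundedWith hEσ hA).trans ?_
      rw [ht, hE0]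
      simp
    · set t := (ptr σ 1).toReal with ht'
      have htp : 0 < t := ENNReal.toReal_pos ht htop
      have ht1 : t ≤ 1 := by simpa using ENNReal.toReal_mono ENNReal.one_ne_top htr
      have hi : 0 ≤ t⁻¹ := by positivity
      have hst : IsState (((t⁻¹ : ℝ) : ℂ) • σ) := by
        rw [isState_iff]
        refine ⟨smul_nonneg_of_real hi hσ, ?_⟩
        rw [ptr_smul_left hi hσ zero_le_one, ← ENNReal.ofReal_toReal htop, ← ht',
          ← ENNReal.ofReal_mul hi, inv_mul_cancel₀ htp.ne', ENNReal.ofReal_one]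
      have hen : trConj (sqrtOp G hG) (((t⁻¹ : ℝ) : ℂ) • σ) = 0 := by
        rw [hQ.trConj_smul hi hσ, hE0, mul_zero]
      have hle : ((1 : ℝ) : ℂ) • σ ≤ ((t⁻¹ : ℝ) : ℂ) • σ := by
        rw [← sub_nonneg, ← sub_smul, ← Complex.ofReal_sub]
        exact smul_nonneg_of_real (sub_nonneg.2 ((one_le_inv₀ htp).2 ht1)) hσ
      have h1 := hQ.mul_trConj_le hσ hst.1.1 hEσ (by rw [hen]; exact ENNReal.zero_ne_top)
        zero_le_one hle A
      rw [ENNReal.ofReal_one, one_mul] at h1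
      refine h1.trans (trConj_le_eNorm_sq hE A hst ?_)
      rw [energy, hen]
      exact zero_le
  · have h := mul_trConj_le_eNorm_sq hQ hlow A hσ htr one_pos le_rfl hE hσE h0 (by rw [one_mul])
    rwa [ENNReal.ofReal_one, one_mul] at h

theorem eNorm_le_sqrt_max_mul (hQ : IsResolventCompl (sqrtOp G hG) Q)
    (hlow : ∀ δ > 0, ∃ φ : H, ‖φ‖ = 1 ∧ sqNorm (sqrtOp G hG) φ ≤ ENNReal.ofReal δ)
    (A : BG G hG) {E F : ℝ} (hE : 0 < E) (hF : 0 ≤ F) :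
    eNorm G hG F A ≤ √(max 1 (F / E)) * eNorm G hG E A := by
  refine eNorm_le (mul_nonneg (Real.sqrt_nonneg _) (eNorm_nonneg E A)) A fun ρ hρ hρF => ?_
  rw [mul_pow, Real.sq_sqrt (le_max_of_le_left zero_le_one)]
  rcases le_total F E with h | h
  · refine (trConj_le_eNorm_sq hE.le A hρ (hρF.trans (ENNReal.ofReal_le_ofReal h))).trans ?_
    refine ENNReal.ofReal_le_ofReal ?_
    exact le_mul_of_one_le_left (sq_nonneg _) (le_max_left _ _)
  -- A state at level F scaled by E/F has energy at most E, so it is controlled by the norm at level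
  -- E; the factor F/E undoes the scaling.
  · have hFp : 0 < F := hE.trans_le h
    obtain ⟨hρ0, hρ1⟩ := isState_iff.1 hρ
    have h1 := mul_trConj_le_eNorm_sq hQ hlow A hρ0 hρ1.le (d := E / F) (by positivity)
      ((div_le_one hFp).2 h) hF hρF hE (by rw [div_mul_cancel₀ _ hFp.ne'])
    have h2 := mul_le_mul_right h1 (ENNReal.ofReal (F / E))
    rw [← mul_assoc, ← ENNReal.ofReal_mul (by positivity), ← ENNReal.ofReal_mul (by positivity),
      div_mul_div_cancel₀ hE.ne', div_self hFp.ne', ENNReal.ofReal_one, one_mul] at h2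
    refine h2.trans (ENNReal.ofReal_le_ofReal ?_)
    exact mul_le_mul_of_nonneg_right (le_max_right _ _) (sq_nonneg _)

/-- A relative bound for the extension of `Φ`. -/
theorem relBoundedWith_extend (hΦ : IsNormalMap Φ) (hsub : Φ 1 ≤ 1)
    (hQ : IsResolventCompl (sqrtOp G hG) Q)
    (hlow : ∀ δ > 0, ∃ φ : H, ‖φ‖ = 1 ∧ sqNorm (sqrtOp G hG) φ ≤ ENNReal.ofReal δ)
    (hfin : ∀ E, maxEnergy Φ G hG E < ⊤) (hpres : PreservesFiniteEnergy Φ (sqrtOp G hG))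
    (A : BG G hG) {a b : ℝ} (hA : RelBoundedWith (sqrtOp G hG) A.1 a b) {E : ℝ} (hE : 0 < E) :
    RelBoundedWith (sqrtOp G hG) (hQ.extend hΦ hpres A)
      (√(‖Φ 1‖ * (a ^ 2 + b ^ 2 * (maxEnergy Φ G hG E).toReal)))
      (√((maxEnergy Φ G hG E).toReal / E * ‖Φ 1‖) * b) := by
  set y := (maxEnergy Φ G hG E).toReal with hy
  have hy0 : 0 ≤ y := ENNReal.toReal_nonneg
  have hunit : ∀ φ : (sqrtOp G hG).domain, ‖(φ : H)‖ = 1 →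
      ‖hQ.extend hΦ hpres A φ‖ ^ 2 ≤
        ‖Φ 1‖ * (a ^ 2 + b ^ 2 * y) + y / E * ‖Φ 1‖ * b ^ 2 * ‖sqrtOp G hG φ‖ ^ 2 := by
    intro φ hφ
    have hst := isState_pure hφ
    have hEφ := hQ.trConj_pure_ne_top φ
    have h1 := hQ.trConj_extend_le hΦ hpres A hst.1 hEφ
    rw [trConj_pure_of_mem (T := ⟨(sqrtOp G hG).domain, hQ.extend hΦ hpres A⟩) hφ φ.2] at h1
    -- F is at least the energy of φ, so the pure state is admissible, and at least E, so that
    -- Y_Φ(F) ≤ (F/E)Y_Φ(E) applies. Since F ≤ ‖Sφ‖² + E, the result is affine in ‖Sφ‖² with slope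
    -- Y_Φ(E)/E.
    set F := max (‖sqrtOp G hG φ‖ ^ 2) E with hF
    have hEF : E ≤ F := le_max_right _ _
    have hFle : F ≤ ‖sqrtOp G hG φ‖ ^ 2 + E :=
      max_le (le_add_of_nonneg_right hE.le) (le_add_of_nonneg_left (sq_nonneg _))
    have hen : energy G hG (pure (φ : H)) ≤ ENNReal.ofReal F := by
      rw [energy, hQ.trConj_pure, sqNorm_of_mem φ.2, enorm_sq_eq_ofReal]
      exact ENNReal.ofReal_le_ofReal (le_max_left _ _)
    have h2 : trConj (sqrtOp G hG) (predual Φ (pure (φ : H))) ≤ ENNReal.ofReal (F / E * y) := by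
      refine (energy_predual_le_maxEnergy hst hen).trans ?_
      rw [← ENNReal.ofReal_toReal (hfin F).ne]
      exact ENNReal.ofReal_le_ofReal (maxEnergy_le_mul hΦ hQ hlow hfin hE hEF)
    have h3 := trConj_le_of_relBoundedWith (hpres _ hst.1 hEφ) hA
    have h4 : ptr (predual Φ (pure (φ : H))) 1 ≤ 1 :=
      (ptr_predual_one_le hΦ hsub hst.1).trans_eq (isState_iff.1 hst).2
    have h5 : ENNReal.ofReal (‖hQ.extend hΦ hpres A φ‖ ^ 2) ≤
        ENNReal.ofReal (‖Φ 1‖ * (a ^ 2 + b ^ 2 * (F / E * y))) := by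
      rw [← enorm_sq_eq_ofReal]
      refine h1.trans ?_
      rw [ENNReal.ofReal_mul (norm_nonneg _), ofReal_norm]
      refine mul_le_mul_right (h3.trans ?_) _
      rw [ENNReal.ofReal_add (by positivity) (by positivity),
        ENNReal.ofReal_mul (p := b ^ 2) (by positivity)]
      exact add_le_add (mul_le_of_le_one_right zero_le h4) (mul_le_mul_right h2 _)
    refine ((ENNReal.ofReal_le_ofReal_iff (by positivity)).1 h5).trans ?_
    have h6 : F / E * y ≤ y + y / E * ‖sqrtOp G hG φ‖ ^ 2 := by
      have : (‖sqrtOp G hG φ‖ ^ 2 + E) / E * y = y + y / E * ‖sqrtOp G hG φ‖ ^ 2 := by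
        field_simp; ring
      rw [← this]
      gcongr
    calc ‖Φ 1‖ * (a ^ 2 + b ^ 2 * (F / E * y))
        ≤ ‖Φ 1‖ * (a ^ 2 + b ^ 2 * (y + y / E * ‖sqrtOp G hG φ‖ ^ 2)) := by gcongr
      _ = _ := by ring
  intro φ
  rw [mul_pow, Real.sq_sqrt (by positivity), Real.sq_sqrt (by positivity)]
  by_cases h0 : φ = 0
  · simp [h0]
  have hn : ‖(φ : H)‖ ≠ 0 := by
    rw [norm_ne_zero_iff]
    exact fun h => h0 (Subtype.ext h)
  have hu := hunit ((‖(φ : H)‖ : ℂ)⁻¹ • φ) (by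
    rw [Submodule.coe_smul, norm_smul, norm_inv, Complex.norm_real, norm_norm,
      inv_mul_cancel₀ hn])
  rw [map_smul, LinearPMap.map_smul, norm_smul, norm_smul, norm_inv, Complex.norm_real,
    norm_norm, mul_pow, mul_pow] at hu
  have h7 := mul_le_mul_of_nonneg_left hu (sq_nonneg ‖(φ : H)‖)
  have h8 : ‖(φ : H)‖ ^ 2 * (‖(φ : H)‖⁻¹ ^ 2 * ‖hQ.extend hΦ hpres A φ‖ ^ 2) =
      ‖hQ.extend hΦ hpres A φ‖ ^ 2 := by field_simp
  rw [h8] at h7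
  refine h7.trans_eq ?_
  field_simp

/-- The extension of `Φ` to the space of `√G`-bounded operators. -/
noncomputable def extendBG (hΦ : IsNormalMap Φ) (hsub : Φ 1 ≤ 1)
    (hQ : IsResolventCompl (sqrtOp G hG) Q)
    (hlow : ∀ δ > 0, ∃ φ : H, ‖φ‖ = 1 ∧ sqNorm (sqrtOp G hG) φ ≤ ENNReal.ofReal δ)
    (hfin : ∀ E, maxEnergy Φ G hG E < ⊤) (hpres : PreservesFiniteEnergy Φ (sqrtOp G hG)) :
    BG G hG →ₗ[ℂ] BG G hG where
  toFun A := ⟨hQ.extend hΦ hpres A, by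
    obtain ⟨a, b, ha, hb, hA⟩ := A.2
    exact ⟨_, _, Real.sqrt_nonneg _, mul_nonneg (Real.sqrt_nonneg _) hb,
      -- Any positive energy level would serve here.
      relBoundedWith_extend hΦ hsub hQ hlow hfin hpres A hA one_pos⟩⟩
  map_add' A B := Subtype.ext (hQ.extend_add hΦ hpres A B)
  map_smul' c A := Subtype.ext (hQ.extend_smul hΦ hpres c A)

theorem relBound_nonneg {S : H →ₗ.[ℂ] H} (A : relBounded S) : 0 ≤ relBound S A :=
  Real.sInf_nonneg fun _ hb => hb.1

theorem exists_tendsto_maxEnergy_div (hΦ : IsNormalMap Φ)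
    (hQ : IsResolventCompl (sqrtOp G hG) Q)
    (hlow : ∀ δ > 0, ∃ φ : H, ‖φ‖ = 1 ∧ sqNorm (sqrtOp G hG) φ ≤ ENNReal.ofReal δ)
    (hfin : ∀ E, maxEnergy Φ G hG E < ⊤) :
    ∃ k, 0 ≤ k ∧
      Filter.Tendsto (fun E : ℝ => (maxEnergy Φ G hG E).toReal / E) Filter.atTop (𝓝 k) := by
  -- Truncating the argument at 1 makes the quotient antitone on the whole line, so it converges to
  -- its infimum.
  let f : ℝ → ℝ := fun E => (maxEnergy Φ G hG (max E 1)).toReal / max E 1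
  have hpos : ∀ E : ℝ, 0 < max E 1 := fun E => lt_max_of_lt_right one_pos
  have hf0 : ∀ E, 0 ≤ f E := fun E => div_nonneg ENNReal.toReal_nonneg (hpos E).le
  have hanti : Antitone f := by
    intro E F hEF
    have h := maxEnergy_le_mul hΦ hQ hlow hfin (hpos E) (max_le_max_right 1 hEF)
    simp only [f]
    rw [div_le_iff₀ (hpos F)]
    refine h.trans_eq ?_
    ring
  have ht := tendsto_atTop_ciInf hanti ⟨0, by rintro _ ⟨E, rfl⟩; exact hf0 E⟩
  refine ⟨⨅ E, f E, Real.iInf_nonneg hf0, ht.congr' ?_⟩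
  filter_upwards [Filter.eventually_ge_atTop 1] with E hE
  simp only [f, max_eq_left hE]

/-- For fixed b the coefficient of ‖Sφ‖ is √(Y_Φ(E)‖Φ(I)‖/E) b, which tends to √(k‖Φ(I)‖) b as E →
∞; the other coefficient may grow without affecting the relative bound. It remains to take the
infimum over b. -/
theorem relBound_extendBG_le (hΦ : IsNormalMap Φ) (hsub : Φ 1 ≤ 1)
    (hQ : IsResolventCompl (sqrtOp G hG) Q)
    (hlow : ∀ δ > 0, ∃ φ : H, ‖φ‖ = 1 ∧ sqNorm (sqrtOp G hG) φ ≤ ENNReal.ofReal δ)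
    (hfin : ∀ E, maxEnergy Φ G hG E < ⊤) (hpres : PreservesFiniteEnergy Φ (sqrtOp G hG)) {k : ℝ}
    (hk : Filter.Tendsto (fun E : ℝ => (maxEnergy Φ G hG E).toReal / E) Filter.atTop (𝓝 k))
    (A : BG G hG) :
    relBound (sqrtOp G hG) (extendBG hΦ hsub hQ hlow hfin hpres A) ≤
      √(k * ‖Φ 1‖) * relBound (sqrtOp G hG) A := by
  have hne : {b | 0 ≤ b ∧ ∃ a, 0 ≤ a ∧ RelBoundedWith (sqrtOp G hG) A.1 a b}.Nonempty := by
    obtain ⟨a, b, ha, hb, hA⟩ := A.2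
    exact ⟨b, hb, a, ha, hA⟩
  have hb : ∀ b ∈ {b | 0 ≤ b ∧ ∃ a, 0 ≤ a ∧ RelBoundedWith (sqrtOp G hG) A.1 a b},
      relBound (sqrtOp G hG) (extendBG hΦ hsub hQ hlow hfin hpres A) ≤ √(k * ‖Φ 1‖) * b := by
    rintro b ⟨hb0, a, ha, hA⟩
    have hlim : Filter.Tendsto
        (fun E : ℝ => √((maxEnergy Φ G hG E).toReal / E * ‖Φ 1‖) * b) Filter.atTop
        (𝓝 (√(k * ‖Φ 1‖) * b)) :=
      ((Real.continuous_sqrt.tendsto _).comp (hk.mul_const _)).mul_const _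
    refine ge_of_tendsto hlim ?_
    filter_upwards [Filter.eventually_gt_atTop 0] with E hE
    exact csInf_le ⟨0, fun _ h => h.1⟩ ⟨by positivity, _, Real.sqrt_nonneg _,
      relBoundedWith_extend hΦ hsub hQ hlow hfin hpres A hA hE⟩
  have h0 : 0 ≤ √(k * ‖Φ 1‖) := Real.sqrt_nonneg _
  rcases h0.eq_or_lt with h1 | h1
  · obtain ⟨b, hbm⟩ := hne
    have := hb b hbm
    rw [← h1, zero_mul] at this ⊢
    exact this
  · rw [← div_le_iff₀' h1]
    refine le_csInf hne fun b hbm => ?_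
    rw [div_le_iff₀' h1]
    exact hb b hbm

theorem eNorm_extendBG_le (hΦ : IsNormalMap Φ) (hsub : Φ 1 ≤ 1)
    (hQ : IsResolventCompl (sqrtOp G hG) Q)
    (hlow : ∀ δ > 0, ∃ φ : H, ‖φ‖ = 1 ∧ sqNorm (sqrtOp G hG) φ ≤ ENNReal.ofReal δ)
    (hfin : ∀ E, maxEnergy Φ G hG E < ⊤) (hpres : PreservesFiniteEnergy Φ (sqrtOp G hG))
    (E : ℝ) (A : BG G hG) :
    eNorm G hG E (extendBG hΦ hsub hQ hlow hfin hpres A) ≤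
      √‖Φ 1‖ * eNorm G hG (maxEnergy Φ G hG E).toReal A := by
  refine eNorm_le (mul_nonneg (Real.sqrt_nonneg _) (eNorm_nonneg _ _)) _ fun ρ hρ hρE => ?_
  refine (hQ.trConj_extend_le hΦ hpres A hρ.1
    (ne_top_of_le_ne_top ENNReal.ofReal_ne_top hρE)).trans ?_
  rw [mul_pow, Real.sq_sqrt (norm_nonneg _), ENNReal.ofReal_mul (norm_nonneg _), ofReal_norm]
  refine mul_le_mul_right ?_ _
  refine trConj_le_eNorm_sq_of_trace_le_one hQ hlow A (hΦ.predual_spec hρ.1).1.1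
    ((ptr_predual_one_le hΦ hsub hρ.1).trans_eq (isState_iff.1 hρ).2) ENNReal.toReal_nonneg ?_
  rw [ENNReal.ofReal_toReal (hfin E).ne]
  exact energy_predual_le_maxEnergy hρ hρE

end Estimates

end EnergyOp

namespace EnergyOp

/-! ### Bounded amplifications A ⊗ I on the Hilbert space tensor product. -/

section Amplification

variable {H : Type*} [NormedAddCommGroup H] [InnerProductSpace ℂ H]
  {K : Type*} [NormedAddCommGroup K] [InnerProductSpace ℂ K]

theorem denseRange_toComplL :
    DenseRange (UniformSpace.Completion.toComplL : H ⊗[ℂ] K →L[ℂ] HTensor H K) :=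
  UniformSpace.Completion.denseRange_coe

/-- The bounded operator `φ ↦ φ ⊗ ψ`. -/
noncomputable def tensorRight (H : Type*) [NormedAddCommGroup H] [InnerProductSpace ℂ H] (ψ : K) :
    H →L[ℂ] HTensor H K :=
  UniformSpace.Completion.toComplL ∘L (TensorProduct.mkL ℂ H K).flip ψ

theorem tensorRight_apply (φ : H) (ψ : K) : tensorRight H ψ φ = pureTensor φ ψ := rfl

theorem inner_pureTensor (φ φ' : H) (ψ ψ' : K) :
    ⟪pureTensor φ ψ, pureTensor φ' ψ'⟫_ℂ = ⟪φ, φ'⟫_ℂ * ⟪ψ, ψ'⟫_ℂ := by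
  rw [pureTensor, pureTensor, UniformSpace.Completion.inner_coe, TensorProduct.inner_tmul]

theorem ampl_pureTensor (A : H →L[ℂ] H) (φ : H) (ψ : K) :
    ampl K A (pureTensor φ ψ) = pureTensor (A φ) ψ := by
  rw [ampl, pureTensor]
  have h := ContinuousLinearMap.extend_eq
    (UniformSpace.Completion.toComplL.comp (A.rTensor K))
    (e := (UniformSpace.Completion.toComplL : H ⊗[ℂ] K →L[ℂ] HTensor H K))
    denseRange_toComplL (UniformSpace.Completion.isUniformInducing_coe _) (φ ⊗ₜ[ℂ] ψ)
  exact h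

theorem htensor_ext {F : Type*} [NormedAddCommGroup F] [NormedSpace ℂ F]
    {T T' : HTensor H K →L[ℂ] F}
    (h : ∀ φ ψ, T (pureTensor φ ψ) = T' (pureTensor φ ψ)) : T = T' := by
  refine ContinuousLinearMap.ext fun x => ?_
  refine congrFun (denseRange_toComplL.equalizer T.continuous T'.continuous (funext fun u => ?_)) x
  change T.toLinearMap.comp
    (UniformSpace.Completion.toComplL : H ⊗[ℂ] K →L[ℂ] HTensor H K).toLinearMap u =
    T'.toLinearMap.comp
    (UniformSpace.Completion.toComplL : H ⊗[ℂ] K →L[ℂ] HTensor H K).toLinearMap u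
  congr 1
  exact TensorProduct.ext' h

theorem eq_zero_of_inner_pureTensor {x : HTensor H K} (h : ∀ φ ψ, ⟪x, pureTensor φ ψ⟫_ℂ = 0) :
    x = 0 := by
  have h2 : innerSL ℂ x = 0 := htensor_ext fun φ ψ => by
    rw [innerSL_apply_apply, h, zero_apply]
  rw [← inner_self_eq_zero (𝕜 := ℂ), ← innerSL_apply_apply, h2, zero_apply]

theorem dense_span_pureTensor :
    Dense (Submodule.span ℂ {x : HTensor H K | ∃ φ ψ, x = pureTensor φ ψ} : Set (HTensor H K)) := by
  rw [Submodule.dense_iff_topologicalClosure_eq_top, Submodule.topologicalClosure_eq_top_iff,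
    Submodule.eq_bot_iff]
  intro x hx
  rw [Submodule.mem_orthogonal'] at hx
  exact eq_zero_of_inner_pureTensor fun φ ψ => hx _ (Submodule.subset_span ⟨φ, ψ, rfl⟩)

theorem ampl_mul (A B : H →L[ℂ] H) : ampl K (A * B) = ampl K A * ampl K B :=
  htensor_ext fun φ ψ => by
    rw [mul_apply_eq_comp, ampl_pureTensor, ampl_pureTensor, ampl_pureTensor]; rfl

theorem ampl_one : ampl K (1 : H →L[ℂ] H) = 1 :=
  htensor_ext fun φ ψ => by rw [ampl_pureTensor]; rfl

theorem ampl_sub (A B : H →L[ℂ] H) : ampl K (A - B) = ampl K A - ampl K B :=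
  htensor_ext fun φ ψ => by
    rw [sub_apply, ampl_pureTensor, ampl_pureTensor, ampl_pureTensor, sub_apply,
      ← tensorRight_apply, map_sub]
    rfl

theorem ampl_pow (A : H →L[ℂ] H) (n : ℕ) : ampl K (A ^ n) = ampl K A ^ n := by
  induction n with
  | zero => rw [pow_zero, pow_zero, ampl_one]
  | succ n ih => rw [pow_succ, pow_succ, ampl_mul, ih]

variable [CompleteSpace H]

theorem star_ampl (A : H →L[ℂ] H) : star (ampl K A) = ampl K (star A) := by
  refine htensor_ext fun φ ψ => ?_
  rw [← sub_eq_zero]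
  refine eq_zero_of_inner_pureTensor fun φ' ψ' => ?_
  rw [inner_sub_left, ContinuousLinearMap.star_eq_adjoint, ContinuousLinearMap.adjoint_inner_left,
    ampl_pureTensor, ampl_pureTensor, inner_pureTensor, inner_pureTensor,
    ContinuousLinearMap.star_eq_adjoint, ContinuousLinearMap.adjoint_inner_left, sub_self]

theorem ampl_nonneg {A : H →L[ℂ] H} (hA : 0 ≤ A) : 0 ≤ ampl K A := by
  have h : ampl K A = star (ampl K (CFC.sqrt A)) * ampl K (CFC.sqrt A) := by
    rw [star_ampl, ← ampl_mul, star_sqrt, CFC.sqrt_mul_sqrt_self A hA]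
  rw [h]
  exact star_mul_self_nonneg (ampl K (CFC.sqrt A))

theorem ampl_le_one {A : H →L[ℂ] H} (hA : A ≤ 1) : ampl K A ≤ 1 := by
  rw [← sub_nonneg, ← ampl_one, ← ampl_sub]
  exact ampl_nonneg (sub_nonneg.2 hA)

/-- A vector in the kernel is orthogonal to every Ry ⊗ ψ, hence to all pure tensors because R has
dense range. -/
theorem ampl_injective {R : H →L[ℂ] H} (hR : 0 ≤ R) (hinj : Function.Injective R) :
    Function.Injective (ampl K R) := by
  rw [injective_iff_map_eq_zero]
  intro x hx
  refine eq_zero_of_inner_pureTensor fun φ ψ => ?_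
  have hcl : IsClosed {φ : H | ⟪x, tensorRight H ψ φ⟫_ℂ = 0} :=
    isClosed_eq (by fun_prop) continuous_const
  refine (denseRange_of_nonneg_of_injective hR hinj).induction_on
    (p := fun φ => ⟪x, tensorRight H ψ φ⟫_ℂ = 0) φ hcl fun y => ?_
  rw [tensorRight_apply, ← ampl_pureTensor, ← inner_symm_of_nonneg (ampl_nonneg hR), hx,
    inner_zero_left]

end Amplification

end EnergyOp

namespace EnergyOp

/-! ### Amplifications of unbounded operators and the Stinespring formula. -/

section RelativeAmplification

variable {H : Type*} [NormedAddCommGroup H] [InnerProductSpace ℂ H] [CompleteSpace H]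
  {S : H →ₗ.[ℂ] H} {Q : H →L[ℂ] H}

theorem IsResolventCompl.lift_add_apply (hQ : IsResolventCompl S Q) (A : relBounded S)
    (x : S.domain) : hQ.lift A (x + S x) = A.1 x :=
  (hQ.apply_eq_lift A (hQ.left_inv x).symm).symm

theorem IsResolventCompl.lift_injective (hQ : IsResolventCompl S Q) :
    Function.Injective hQ.lift := by
  intro A B h
  refine Subtype.ext (LinearMap.ext fun x => ?_)
  rw [← hQ.lift_add_apply, h, hQ.lift_add_apply]

/-- The preimage of a bounded C is C(1 + S). With injectivity, questions about S-bounded operators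
become questions about bounded ones. -/
theorem IsResolventCompl.lift_surjective (hQ : IsResolventCompl S Q) :
    Function.Surjective hQ.lift := by
  intro C
  let B : S.domain →ₗ[ℂ] H := C.toLinearMap ∘ₗ (S.domain.subtype + S.toFun)
  have hB : ∀ x : S.domain, B x = C (x + S x) := fun x => rfl
  refine ⟨⟨B, 2 * ‖C‖, 2 * ‖C‖, by positivity, by positivity, fun x => ?_⟩, ?_⟩
  · have h1 : ‖B x‖ ≤ ‖C‖ * (‖(x : H)‖ + ‖S x‖) := by
      rw [hB]
      exact (C.le_opNorm _).trans
        (mul_le_mul_of_nonneg_left (norm_add_le _ _) (norm_nonneg _))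
    have h2 := pow_le_pow_left₀ (norm_nonneg _) h1 2
    nlinarith [mul_nonneg (sq_nonneg ‖C‖) (sq_nonneg (‖(x : H)‖ - ‖S x‖)),
      mul_nonneg (sq_nonneg ‖C‖) (sq_nonneg ‖(x : H)‖), mul_nonneg (sq_nonneg ‖C‖)
      (sq_nonneg ‖S x‖)]
  · ext y
    rw [hQ.lift_apply]
    change B _ = _
    rw [hB, hQ.apply_eq]
    change C ((1 - Q : H →L[ℂ] H) y + Q y) = C y
    rw [sub_apply]
    change C (y - Q y + Q y) = C y
    rw [sub_add_cancel]

theorem toFun_mem_relBounded (S : H →ₗ.[ℂ] H) : S.toFun ∈ relBounded S :=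
  ⟨0, 1, le_rfl, zero_le_one, fun φ => by
    rw [one_pow, one_mul, zero_pow two_ne_zero, zero_mul, zero_add]; exact le_rfl⟩

theorem IsResolventCompl.lift_toFun (hQ : IsResolventCompl S Q) :
    hQ.lift ⟨S.toFun, toFun_mem_relBounded S⟩ = Q := by
  ext y
  rw [hQ.lift_apply]
  exact hQ.apply_eq y

variable {K : Type*} [NormedAddCommGroup K] [InnerProductSpace ℂ K]

/-- Writing φ = (1 - Q)y parametrises the span of the pairs φ ⊗ ψ, Aφ ⊗ ψ by bounded operators.
Injectivity of (1 - Q) ⊗ I then shows that this span is single-valued, so that it is the graph of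
the associated partial map. -/
theorem IsResolventCompl.graph_algAmpl (hQ : IsResolventCompl S Q) (A : relBounded S) :
    (algAmpl K ⟨S.domain, A.1⟩).graph =
      (Submodule.span ℂ {x : HTensor H K | ∃ φ ψ, x = pureTensor φ ψ}).map
        ((ampl K (1 - Q)).prod (ampl K (hQ.lift A))).toLinearMap := by
  have hspan : Submodule.span ℂ {p : HTensor H K × HTensor H K |
      ∃ (φ : S.domain) (ψ : K), p = (pureTensor (φ : H) ψ, pureTensor (A.1 φ) ψ)} =
      (Submodule.span ℂ {x : HTensor H K | ∃ φ ψ, x = pureTensor φ ψ}).map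
        ((ampl K (1 - Q)).prod (ampl K (hQ.lift A))).toLinearMap := by
    rw [Submodule.map_span]
    congr 1
    have hval : ∀ (y : H) (ψ : K), ((ampl K (1 - Q)).prod (ampl K (hQ.lift A))).toLinearMap
        (pureTensor y ψ) = (pureTensor ((1 - Q : H →L[ℂ] H) y) ψ, pureTensor (hQ.lift A y) ψ) := by
      intro y ψ
      refine Prod.ext ?_ ?_
      · exact ampl_pureTensor _ _ _
      · exact ampl_pureTensor _ _ _
    ext p
    constructor
    · rintro ⟨φ, ψ, rfl⟩
      refine ⟨pureTensor (φ + S φ) ψ, ⟨_, _, rfl⟩, ?_⟩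
      rw [hval, hQ.left_inv, hQ.lift_add_apply]
    · rintro ⟨_, ⟨y, ψ, rfl⟩, rfl⟩
      exact ⟨⟨_, hQ.mem y⟩, ψ, hval y ψ⟩
  change (Submodule.toLinearPMap _).graph = _
  rw [Submodule.toLinearPMap_graph_eq]
  · exact hspan
  · intro x hx hx0
    have hx' := hspan.le hx
    obtain ⟨u, -, rfl⟩ := hx'
    have hu : u = 0 := ampl_injective (sub_nonneg.2 hQ.le_one) hQ.injective
      ((show ampl K (1 - Q) u = 0 from hx0).trans (map_zero _).symm)
    rw [hu, map_zero]
    rfl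

theorem ampl_one_sub (Q : H →L[ℂ] H) : ampl K (1 - Q) = 1 - ampl K Q := by
  rw [ampl_sub, ampl_one]

/-- The map u ↦ ((1 - Q) ⊗ I u, Q ⊗ I u) is inverted from the left by addition, so it is a closed
embedding, and the closure of the image of a dense subspace is its whole range. -/
theorem IsResolventCompl.graph_closedAmpl (hQ : IsResolventCompl S Q) :
    (closedAmpl K S).graph =
      LinearMap.range ((ampl K (1 - Q)).prod (ampl K Q)).toLinearMap := by
  set f := (ampl K (1 - Q)).prod (ampl K Q) with hf
  have hleft : Function.LeftInverse (fun p : HTensor H K × HTensor H K => p.1 + p.2) f := by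
    intro u
    change ampl K (1 - Q) u + ampl K Q u = u
    rw [ampl_one_sub, sub_apply]
    exact sub_add_cancel _ _
  have hemb : Topology.IsClosedEmbedding f :=
    hleft.isClosedEmbedding (continuous_fst.add continuous_snd) f.continuous
  have hgraph : (algAmpl K S).graph =
      (Submodule.span ℂ {x : HTensor H K | ∃ φ ψ, x = pureTensor φ ψ}).map f.toLinearMap := by
    have h := hQ.graph_algAmpl (K := K) ⟨S.toFun, toFun_mem_relBounded S⟩
    rw [hQ.lift_toFun] at h
    exact h
  have hcl : (algAmpl K S).graph.topologicalClosure = LinearMap.range f.toLinearMap := by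
    rw [hgraph]
    apply SetLike.coe_injective
    rw [Submodule.topologicalClosure_coe, Submodule.map_coe]
    refine (hemb.isClosedMap.closure_image_eq_of_continuous f.continuous _).trans ?_
    rw [dense_span_pureTensor.closure_eq, Set.image_univ]
    rfl
  -- The graph of the closure is the closure of the graph only for a closable operator; again
  -- injectivity of (1 - Q) ⊗ I makes the closure single-valued.
  have hclosable : (algAmpl K S).IsClosable := by
    refine ⟨(LinearMap.range f.toLinearMap).toLinearPMap, ?_⟩
    rw [hcl, Submodule.toLinearPMap_graph_eq]
    rintro _ ⟨u, rfl⟩ hx0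
    have hu : u = 0 := ampl_injective (sub_nonneg.2 hQ.le_one) hQ.injective
      ((show ampl K (1 - Q) u = 0 from hx0).trans (map_zero _).symm)
    rw [hu, map_zero]
    rfl
  rw [closedAmpl, ← hclosable.graph_closure_eq_closure_graph, hcl]

/-- It makes all results proved for the pair S, Q available for S ⊗ I and Q ⊗ I. -/
theorem IsResolventCompl.closedAmpl (hQ : IsResolventCompl S Q) :
    IsResolventCompl (closedAmpl K S) (ampl K Q) := by
  have hmem : ∀ y, ∃ x : (EnergyOp.closedAmpl K S).domain,
      (x : HTensor H K) = (1 - ampl K Q : HTensor H K →L[ℂ] HTensor H K) y ∧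
        EnergyOp.closedAmpl K S x = ampl K Q y := by
    intro y
    have h : (ampl K (1 - Q) y, ampl K Q y) ∈ (EnergyOp.closedAmpl K S).graph := by
      rw [hQ.graph_closedAmpl]
      exact ⟨y, rfl⟩
    rw [ampl_one_sub] at h
    exact (LinearPMap.mem_graph_iff _).1 h
  refine ⟨ampl_nonneg hQ.nonneg, ampl_le_one hQ.le_one, ?_, fun y => ?_, fun y => ?_, fun x => ?_⟩
  · rw [← ampl_one_sub]
    exact ampl_injective (sub_nonneg.2 hQ.le_one) hQ.injective
  · obtain ⟨x, hx, -⟩ := hmem y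
    exact hx ▸ x.2
  · obtain ⟨x, hx, hx2⟩ := hmem y
    refine Eq.trans ?_ hx2
    congr 1
    exact Subtype.ext hx.symm
  · have h := (EnergyOp.closedAmpl K S).mem_graph x
    rw [hQ.graph_closedAmpl] at h
    obtain ⟨u, hu⟩ := h
    have h1 : ampl K (1 - Q) u = x := congrArg Prod.fst hu
    have h2 : ampl K Q u = EnergyOp.closedAmpl K S x := congrArg Prod.snd hu
    have h3 : ampl K (1 - Q) u + ampl K Q u = u := by
      rw [ampl_one_sub, sub_apply]
      exact sub_add_cancel _ _
    rw [← h2, ← h1, h3, ampl_one_sub]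

/-- Both graphs are parametrised by bounded operators with the same first component, so the
extension property only compares the second components on pure tensors. Existence and uniqueness of
the extension then follow from the bijectivity of `lift`. -/
theorem IsResolventCompl.algAmpl_le_iff (hQ : IsResolventCompl S Q) (A : relBounded S)
    (B : relBounded (EnergyOp.closedAmpl K S)) :
    algAmpl K ⟨S.domain, A.1⟩ ≤ ⟨(EnergyOp.closedAmpl K S).domain, B.1⟩ ↔
      hQ.closedAmpl.lift B = ampl K (hQ.lift A) := by
  have hB : ∀ u, (ampl K (1 - Q) u, hQ.closedAmpl.lift B u) ∈
      LinearPMap.graph ⟨(EnergyOp.closedAmpl K S).domain, B.1⟩ := by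
    intro u
    rw [ampl_one_sub]
    exact LinearPMap.mem_graph (⟨(EnergyOp.closedAmpl K S).domain, B.1⟩ :
      HTensor H K →ₗ.[ℂ] HTensor H K) ⟨_, hQ.closedAmpl.mem u⟩
  constructor
  · intro h
    have hgr := LinearPMap.le_graph_of_le h
    rw [hQ.graph_algAmpl] at hgr
    refine htensor_ext fun y ψ => ?_
    have h1 := hgr ⟨pureTensor y ψ, Submodule.subset_span ⟨y, ψ, rfl⟩, rfl⟩
    exact LinearPMap.mem_graph_snd_inj _ (hB (pureTensor y ψ)) h1 rfl
  · intro h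
    refine LinearPMap.le_of_le_graph ?_
    rw [hQ.graph_algAmpl]
    rintro _ ⟨u, -, rfl⟩
    have h1 := hB u
    rw [h] at h1
    exact h1

theorem IsResolventCompl.existsUnique_isRelAmpl (hQ : IsResolventCompl S Q) (A : relBounded S) :
    ∃! B, IsRelAmpl K S A.1 B := by
  obtain ⟨B, hB⟩ := hQ.closedAmpl.lift_surjective (ampl K (hQ.lift A))
  refine ⟨B.1, ⟨B.2, (hQ.algAmpl_le_iff A B).2 hB⟩, ?_⟩
  rintro C ⟨hC, hC2⟩
  have h := (hQ.algAmpl_le_iff A ⟨C, hC⟩).1 hC2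
  exact congrArg Subtype.val (hQ.closedAmpl.lift_injective (h.trans hB.symm))

variable {Φ : (H →L[ℂ] H) →CP (H →L[ℂ] H)} {V : H →L[ℂ] HTensor H K}

theorem IsStinespring.quad_apply (hV : IsStinespring Φ V) (A : H →L[ℂ] H) (φ : H) :
    quad (Φ A) φ = quad (ampl K A) (V φ) := by
  rw [quad, quad, hV A, ← ContinuousLinearMap.adjoint_inner_right]
  rfl

/-- Both sides are the same series of forms of Φ(Q^(i+j+2)). Preservation of finite energy thus says
that V maps D(S) into D(S ⊗ I). -/
theorem IsStinespring.sqNorm_closedAmpl (hV : IsStinespring Φ V) (hΦ : IsNormalMap Φ)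
    (hQ : IsResolventCompl S Q) (φ : H) :
    sqNorm (EnergyOp.closedAmpl K S) (V φ) = trConj S (predual Φ (pure φ)) := by
  rw [hQ.trConj_predual hΦ (isPosTraceClass_pure φ), hQ.closedAmpl.sqNorm_eq]
  refine tsum_congr fun p => ?_
  rw [ptr_pure φ (CompletelyPositiveMap.nonneg Φ (CStarAlgebra.pow_nonneg hQ.nonneg _)),
    hV.quad_apply, ampl_pow]

theorem IsStinespring.extend_apply (hV : IsStinespring Φ V) (hΦ : IsNormalMap Φ)
    (hQ : IsResolventCompl S Q) (hpres : PreservesFiniteEnergy Φ S) (A : relBounded S)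
    {B : (EnergyOp.closedAmpl K S).domain →ₗ[ℂ] HTensor H K} (hB : IsRelAmpl K S A.1 B)
    (φ : S.domain) :
    ∃ h : V φ ∈ (EnergyOp.closedAmpl K S).domain,
      hQ.extend hΦ hpres A φ = V.adjoint (B ⟨V φ, h⟩) := by
  have hmem : V φ ∈ (EnergyOp.closedAmpl K S).domain := by
    refine mem_of_sqNorm_ne_top ?_
    rw [hV.sqNorm_closedAmpl hΦ hQ]
    exact hpres _ (isPosTraceClass_pure _) (hQ.trConj_pure_ne_top φ)
  refine ⟨hmem, ?_⟩
  have hlift := (hQ.algAmpl_le_iff A ⟨B, hB.1⟩).1 hB.2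
  -- With Vφ = (1 - Q ⊗ I)u, the n-th approximant applied to Vφ is (AR ⊗ I)(u - (Q ⊗ I)ⁿu), which
  -- tends to (AR ⊗ I)u = BVφ.
  set u := V φ + EnergyOp.closedAmpl K S ⟨V φ, hmem⟩ with hu
  have hVu : (1 - ampl K Q : HTensor H K →L[ℂ] HTensor H K) u = V φ :=
    hQ.closedAmpl.left_inv ⟨V φ, hmem⟩
  have hBu : B ⟨V φ, hmem⟩ = ampl K (hQ.lift A) u := by
    rw [← hlift]
    exact (hQ.closedAmpl.lift_add_apply ⟨B, hB.1⟩ ⟨V φ, hmem⟩).symm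
  refine tendsto_nhds_unique (hQ.tendsto_extend hΦ hpres A φ) ?_
  have h0 := tendsto_pow_apply_zero hQ.closedAmpl.nonneg hQ.closedAmpl.le_one
    hQ.closedAmpl.injective u
  have h1 := ((V.adjoint ∘L ampl K (hQ.lift A)).continuous.tendsto _).comp
    ((tendsto_const_nhds (x := u)).sub h0)
  rw [sub_zero] at h1
  rw [hBu]
  refine h1.congr fun n => ?_
  have h2 : ampl K (hQ.approx A n) (V φ) = ampl K (hQ.lift A) (u - (ampl K Q ^ n) u) := by
    rw [← hVu, ← ampl_one_sub, ← mul_apply_eq_comp, ← ampl_mul, IsResolventCompl.approx, mul_assoc,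
      neumann_mul_one_sub, ampl_mul, ampl_one_sub, ampl_pow]
    rfl
  rw [hV]
  change V.adjoint (ampl K (hQ.lift A) (u - (ampl K Q ^ n) u)) =
    V.adjoint (ampl K (hQ.approx A n) (V φ))
  rw [h2]

theorem IsGivenBy.unique {Ψ Ψ' : relBounded S →ₗ[ℂ] relBounded S} (h : IsGivenBy S V Ψ)
    (h' : IsGivenBy S V Ψ') : Ψ' = Ψ := by
  refine LinearMap.ext fun A => Subtype.ext (LinearMap.ext fun φ => ?_)
  obtain ⟨B, hB, -⟩ := (h A).1
  obtain ⟨h1, h2⟩ := (h A).2 B hB φ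
  obtain ⟨h3, h4⟩ := (h' A).2 B hB φ
  rw [h2, h4]

end RelativeAmplification

end EnergyOp

namespace EnergyOp

/-! ### Finite-rank outputs of the predual map. -/

section FiniteRank

variable {H : Type*} [NormedAddCommGroup H] [InnerProductSpace ℂ H] [CompleteSpace H]
  {S : H →ₗ.[ℂ] H} {Q : H →L[ℂ] H} {Φ : (H →L[ℂ] H) →CP (H →L[ℂ] H)}

theorem opTrace_rankOne (x y : H) : opTrace (InnerProductSpace.rankOne ℂ x y) = ⟪y, x⟫_ℂ := by
  rw [opTrace, ← (stdBasis H).tsum_inner_mul_inner y x]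
  refine tsum_congr fun i => ?_
  rw [InnerProductSpace.rankOne_apply, inner_smul_right]

theorem IsNormalMap.inner_predual_pure (hΦ : IsNormalMap Φ) (φ ψ w : H) :
    ⟪w, predual Φ (pure φ) ψ⟫_ℂ = ⟪φ, Φ (InnerProductSpace.rankOne ℂ ψ w) φ⟫_ℂ := by
  have h := (hΦ.predual_spec (isPosTraceClass_pure φ)).2 (InnerProductSpace.rankOne ℂ ψ w)
  have h1 : predual Φ (pure φ) * InnerProductSpace.rankOne ℂ ψ w =
      InnerProductSpace.rankOne ℂ (predual Φ (pure φ) ψ) w := by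
    ext x
    simp [InnerProductSpace.rankOne_apply, mul_apply_eq_comp]
  have h2 : Φ (InnerProductSpace.rankOne ℂ ψ w) * pure φ =
      InnerProductSpace.rankOne ℂ (Φ (InnerProductSpace.rankOne ℂ ψ w) φ) φ := by
    ext x
    simp [pure, InnerProductSpace.rankOne_apply, mul_apply_eq_comp]
  rwa [h1, h2, opTrace_rankOne, opTrace_rankOne] at h

/-- A vector y orthogonal to the range satisfies ‖√σ y‖² = ⟨y, σy⟩ = 0, so the range of √σ lies in
the double complement, which is the range of σ by finite dimensionality. -/
theorem sqrt_apply_mem_range {σ : H →L[ℂ] H} (hσ : 0 ≤ σ)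
    [FiniteDimensional ℂ (LinearMap.range σ.toLinearMap)] (x : H) :
    CFC.sqrt σ x ∈ LinearMap.range σ.toLinearMap := by
  rw [← Submodule.orthogonal_orthogonal (LinearMap.range σ.toLinearMap)]
  rw [Submodule.mem_orthogonal]
  intro y hy
  rw [Submodule.mem_orthogonal'] at hy
  have h1 : ⟪y, σ y⟫_ℂ = 0 := hy _ ⟨y, rfl⟩
  have h2 : CFC.sqrt σ y = 0 := by
    rw [← inner_self_eq_zero (𝕜 := ℂ), inner_sqrt, sqrt_sqrt_apply hσ, h1]
  rw [← inner_sqrt, h2, inner_zero_left]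

/-- A finite-rank operator whose range consists of vectors of finite energy has finite energy. -/
theorem trConj_ne_top_of_finite_rank {σ : H →L[ℂ] H} (hσ : IsPosTraceClass σ)
    [FiniteDimensional ℂ (LinearMap.range σ.toLinearMap)] (h : ∀ x, σ x ∈ S.domain) :
    trConj S σ ≠ ⊤ := by
  obtain ⟨hσ0, hσ1⟩ := isPosTraceClass_iff.1 hσ
  have hle : LinearMap.range σ.toLinearMap ≤ S.domain := by
    rintro _ ⟨x, rfl⟩
    exact h x
  -- S restricted to the finite-dimensional range of σ is automatically bounded.
  let T := (S.toFun ∘ₗ Submodule.inclusion hle).toContinuousLinearMap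
  have hT : ∀ w : LinearMap.range σ.toLinearMap, T w = S ⟨w, hle w.2⟩ := fun w => rfl
  refine ne_top_of_le_ne_top (ENNReal.mul_ne_top (a := ‖T‖ₑ ^ 2)
    (ENNReal.pow_ne_top enorm_ne_top) hσ1) ?_
  rw [trConj, hsq, ← ENNReal.tsum_mul_left]
  refine ENNReal.tsum_le_tsum fun i => ?_
  have hi := sqrt_apply_mem_range hσ0 (stdBasis H i)
  rw [sqNorm_of_mem (hle hi), ← hT ⟨_, hi⟩, ← mul_pow]
  exact pow_le_pow_left' (T.le_opENorm _) 2

/-- The trace of Φ_*(ρ)(1 - P) equals that of ρΦ(1 - P) = 0, so Φ_*(ρ) is supported in the range of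
P. -/
theorem finiteDimensional_range_predual (hΦ : IsNormalMap Φ) {P : H →L[ℂ] H}
    (hP : IsStarProjection P) [FiniteDimensional ℂ (LinearMap.range P.toLinearMap)]
    (h : Φ 1 = Φ P) {ρ : H →L[ℂ] H} (hρ : IsPosTraceClass ρ) :
    FiniteDimensional ℂ (LinearMap.range (predual Φ ρ).toLinearMap) := by
  have hσ := (hΦ.predual_spec hρ).1
  have hP1 : IsStarProjection (1 - P) := hP.one_sub
  have h1 : ptr (predual Φ ρ) (1 - P) = 0 := by
    rw [hΦ.ptr_predual hρ hP1.nonneg, map_sub, h, sub_self]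
    simp [ptr, quad]
  have h2 : hsq ((1 - P) * CFC.sqrt (predual Φ ρ)) = 0 := by
    rw [← ptr_star_mul_self, hP1.isSelfAdjoint.star_eq, hP1.isIdempotentElem.eq, h1]
  have h3 : ∀ x, (1 - P : H →L[ℂ] H) (CFC.sqrt (predual Φ ρ) x) = 0 := by
    intro x
    have h4 := enorm_apply_sq_le_hsq ((1 - P) * CFC.sqrt (predual Φ ρ)) x
    rw [h2, zero_mul, nonpos_iff_eq_zero, pow_eq_zero_iff two_ne_zero, enorm_eq_zero] at h4
    exact h4
  refine Submodule.finiteDimensional_of_le (S₂ := LinearMap.range P.toLinearMap) ?_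
  rintro _ ⟨x, rfl⟩
  refine ⟨predual Φ ρ x, ?_⟩
  have h5 := h3 (CFC.sqrt (predual Φ ρ) x)
  rw [sqrt_sqrt_apply hσ.1, sub_apply, sub_eq_zero] at h5
  exact h5.symm

variable {K : Type*} [NormedAddCommGroup K] [InnerProductSpace ℂ K]

theorem adjoint_tensorRight_pureTensor (k : K) (x : H) (ψ : K) :
    (tensorRight H k).adjoint (pureTensor x ψ) = ⟪k, ψ⟫_ℂ • x := by
  refine ext_inner_left ℂ fun y => ?_
  rw [ContinuousLinearMap.adjoint_inner_right, tensorRight_apply, inner_pureTensor,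
    inner_smul_right, mul_comm]

theorem ampl_eq_sum {ι : Type*} [Fintype ι] (b : OrthonormalBasis ι ℂ K) (A : H →L[ℂ] H) :
    ampl K A = ∑ j, tensorRight H (b j) ∘L A ∘L (tensorRight H (b j)).adjoint := by
  refine htensor_ext fun x ψ => ?_
  rw [ampl_pureTensor, sum_apply]
  let L : K →L[ℂ] HTensor H K :=
    UniformSpace.Completion.toComplL ∘L TensorProduct.mkL ℂ H K (A x)
  have h : ∀ j, (tensorRight H (b j) ∘L A ∘L (tensorRight H (b j)).adjoint) (pureTensor x ψ) =
      L (⟪b j, ψ⟫_ℂ • b j) := by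
    intro j
    rw [ContinuousLinearMap.comp_apply, ContinuousLinearMap.comp_apply,
      adjoint_tensorRight_pureTensor, map_smul, map_smul, map_smul]
    rfl
  simp only [h]
  rw [← map_sum, b.sum_repr' ψ]
  rfl

/-- Kraus form: an orthonormal basis bⱼ of K gives Φ_*(|φ⟩⟨φ|) = ∑ⱼ |vⱼ⟩⟨vⱼ|, where vⱼ is the
component of Vφ along bⱼ. -/
theorem IsStinespring.predual_pure_apply {V : H →L[ℂ] HTensor H K} (hV : IsStinespring Φ V)
    (hΦ : IsNormalMap Φ) {ι : Type*} [Fintype ι] (b : OrthonormalBasis ι ℂ K) (φ ψ : H) :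
    predual Φ (pure φ) ψ =
      ∑ j, ⟪(tensorRight H (b j)).adjoint (V φ), ψ⟫_ℂ • (tensorRight H (b j)).adjoint (V φ) := by
  refine ext_inner_left ℂ fun w => ?_
  rw [hΦ.inner_predual_pure, hV, ContinuousLinearMap.comp_apply,
    ContinuousLinearMap.adjoint_inner_right, ContinuousLinearMap.comp_apply, ampl_eq_sum b,
    sum_apply, inner_sum, inner_sum]
  refine Finset.sum_congr rfl fun j _ => ?_
  rw [ContinuousLinearMap.comp_apply, ContinuousLinearMap.comp_apply,
    ← ContinuousLinearMap.adjoint_inner_left, InnerProductSpace.rankOne_apply, inner_smul_right,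
    inner_smul_right, mul_comm]

theorem IsStinespring.finiteDimensional_range_predual [FiniteDimensional ℂ K]
    {V : H →L[ℂ] HTensor H K} (hV : IsStinespring Φ V) (hΦ : IsNormalMap Φ) (φ : H) :
    FiniteDimensional ℂ (LinearMap.range (predual Φ (pure φ)).toLinearMap) := by
  let b := stdOrthonormalBasis ℂ K
  let v := fun j => (tensorRight H (b j)).adjoint (V φ)
  have : FiniteDimensional ℂ (Submodule.span ℂ (Set.range v)) :=
    FiniteDimensional.span_of_finite ℂ (Set.finite_range v)
  refine Submodule.finiteDimensional_of_le (S₂ := Submodule.span ℂ (Set.range v)) ?_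
  rintro _ ⟨x, rfl⟩
  change predual Φ (pure φ) x ∈ _
  rw [hV.predual_pure_apply hΦ b]
  exact Submodule.sum_mem _ fun j _ =>
    Submodule.smul_mem _ _ (Submodule.subset_span ⟨j, rfl⟩)

end FiniteRank

/-! ### From E-norm continuity to finite output energy. -/

section Converse

variable {H : Type*} [NormedAddCommGroup H] [InnerProductSpace ℂ H] [CompleteSpace H]
  {G : H →ₗ.[ℂ] H} {hG : IsPosSelfAdjoint G} {Q : H →L[ℂ] H}
  {Φ : (H →L[ℂ] H) →CP (H →L[ℂ] H)}

/-- √ρ S is a restriction of the adjoint of S√ρ, whose norm is at most √E by the energy bound. -/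
theorem IsPosSelfAdjoint.norm_sqrt_apply_le {S : H →ₗ.[ℂ] H} (hS : IsPosSelfAdjoint S)
    (hQ : IsResolventCompl S Q) {ρ : H →L[ℂ] H} {E : ℝ} (hE0 : 0 ≤ E)
    (hE : trConj S ρ ≤ ENNReal.ofReal E) (χ : S.domain) :
    ‖CFC.sqrt ρ (S χ)‖ ≤ √E * ‖(χ : H)‖ := by
  set x := CFC.sqrt ρ (S χ) with hx
  have h1 := (hQ.sqNorm_sqrt_le ρ x).trans (mul_le_mul_left hE _)
  have hmem : CFC.sqrt ρ x ∈ S.domain := mem_of_sqNorm_ne_top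
    (ne_top_of_le_ne_top (ENNReal.mul_ne_top ENNReal.ofReal_ne_top
      (ENNReal.pow_ne_top enorm_ne_top)) h1)
  rw [sqNorm_of_mem hmem, enorm_sq_eq_ofReal, enorm_sq_eq_ofReal, ← ENNReal.ofReal_mul hE0,
    ENNReal.ofReal_le_ofReal_iff (by positivity)] at h1
  have h2 : ‖S ⟨_, hmem⟩‖ ≤ √E * ‖x‖ := by
    refine le_of_sq_le_sq ?_ (by positivity)
    rwa [mul_pow, Real.sq_sqrt hE0]
  have h3 : ‖x‖ ^ 2 = (⟪(χ : H), S ⟨_, hmem⟩⟫_ℂ).re := by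
    rw [← re_inner_self_eq]
    conv_lhs => rw [hx]
    rw [inner_sqrt]
    exact congrArg Complex.re (hS.inner_symm χ ⟨_, hmem⟩)
  have h4 : ‖x‖ ^ 2 ≤ ‖(χ : H)‖ * (√E * ‖x‖) := by
    rw [h3]
    refine (Complex.re_le_norm _).trans ((norm_inner_le_norm _ _).trans ?_)
    exact mul_le_mul_of_nonneg_left h2 (norm_nonneg _)
  rcases (norm_nonneg x).eq_or_lt with h0 | h0
  · rw [← h0]; positivity
  · nlinarith

/-- These are the test operators of the converse: their operator norm involves ‖Sχ‖, but their
E-norm is controlled by ‖χ‖ alone. -/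
theorem eNorm_rankOne_le (hQ : IsResolventCompl (sqrtOp G hG) Q) {E : ℝ} (hE : 0 ≤ E) (ψ : H)
    (χ : (sqrtOp G hG).domain) :
    eNorm G hG E (ofBounded _ (InnerProductSpace.rankOne ℂ ψ (sqrtOp G hG χ))) ≤
      √E * ‖(χ : H)‖ * ‖ψ‖ := by
  refine eNorm_le (by positivity) _ fun ρ hρ hρE => ?_
  have hρE' : trConj (sqrtOp G hG) ρ ≠ ⊤ := ne_top_of_le_ne_top ENNReal.ofReal_ne_top hρE
  have h1 : trConj ⟨(sqrtOp G hG).domain,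
      (ofBounded _ (InnerProductSpace.rankOne ℂ ψ (sqrtOp G hG χ))).1⟩ ρ =
      ‖CFC.sqrt ρ (sqrtOp G hG χ)‖ₑ ^ 2 * ‖ψ‖ₑ ^ 2 := by
    rw [← tsum_enorm_inner_sq (stdBasis H), ← ENNReal.tsum_mul_right, trConj]
    refine tsum_congr fun i => ?_
    have hmem : CFC.sqrt ρ (stdBasis H i) ∈ (sqrtOp G hG).domain :=
      mem_of_sqNorm_ne_top (ENNReal.ne_top_of_tsum_ne_top hρE' i)
    rw [sqNorm_of_mem (T := ⟨(sqrtOp G hG).domain,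
      (ofBounded _ (InnerProductSpace.rankOne ℂ ψ (sqrtOp G hG χ))).1⟩) hmem, ← inner_sqrt,
      enorm_inner_comm, ← mul_pow, ← enorm_smul]
    rfl
  rw [h1, enorm_sq_eq_ofReal, enorm_sq_eq_ofReal, ← ENNReal.ofReal_mul (by positivity), ← mul_pow]
  refine ENNReal.ofReal_le_ofReal (pow_le_pow_left₀ (by positivity) ?_ 2)
  exact mul_le_mul_of_nonneg_right
    ((sqrtOp_spec G hG).posSelfAdjoint.norm_sqrt_apply_le hQ hE hρE χ) (norm_nonneg _)

theorem norm_apply_le_eNorm (hQ : IsResolventCompl (sqrtOp G hG) Q)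
    (hlow : ∀ δ > 0, ∃ φ : H, ‖φ‖ = 1 ∧ sqNorm (sqrtOp G hG) φ ≤ ENNReal.ofReal δ) {E : ℝ}
    (hE : 0 < E) (A : BG G hG) (φ : (sqrtOp G hG).domain) (hφ : ‖(φ : H)‖ = 1) :
    ‖A.1 φ‖ ≤ √(max 1 (‖sqrtOp G hG φ‖ ^ 2 / E)) * eNorm G hG E A := by
  have h1 := trConj_le_eNorm_sq (E := ‖sqrtOp G hG φ‖ ^ 2) (by positivity) A (isState_pure hφ) (by
    rw [energy, trConj_pure_of_mem hφ φ.2, enorm_sq_eq_ofReal])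
  rw [trConj_pure_of_mem (T := ⟨(sqrtOp G hG).domain, A.1⟩) hφ φ.2, enorm_sq_eq_ofReal,
    ENNReal.ofReal_le_ofReal_iff (by positivity)] at h1
  exact (le_of_sq_le_sq h1 (eNorm_nonneg _ _)).trans
    (eNorm_le_sqrt_max_mul hQ hlow A hE (by positivity))

/-- If `Φ` is continuous with respect to an operator `E`-norm, then `Φ_*(|φ⟩⟨φ|)` maps into the
domain of `√G` for every `φ` in the domain of `√G`. -/
theorem IsENormContinuous.predual_pure_mem (hΦ : IsNormalMap Φ)
    (hQ : IsResolventCompl (sqrtOp G hG) Q)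
    (hlow : ∀ δ > 0, ∃ φ : H, ‖φ‖ = 1 ∧ sqNorm (sqrtOp G hG) φ ≤ ENNReal.ofReal δ) {E : ℝ}
    (hE : 0 < E) (hcont : IsENormContinuous Φ G hG E) (φ : (sqrtOp G hG).domain)
    (hφ : ‖(φ : H)‖ = 1) (ψ : H) :
    predual Φ (pure (φ : H)) ψ ∈ (sqrtOp G hG).domain := by
  have hsa := LinearPMap.isSelfAdjoint_def.1 (sqrtOp_spec G hG).posSelfAdjoint.isSelfAdjoint
  obtain ⟨δ, hδ, h⟩ := hcont 0 1 one_pos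
  set C := √(max 1 (‖sqrtOp G hG φ‖ ^ 2 / E)) with hC
  -- Boundedness of this functional on the domain puts Φ_*(|φ⟩⟨φ|)ψ into the domain of the adjoint
  -- of √G, which is √G itself.
  set f := (innerₛₗ ℂ (predual Φ (pure (φ : H)) ψ)).comp (sqrtOp G hG).toFun with hf
  -- The radius makes the E-norm of |ψ⟩⟨Sχ| smaller than δ; the summand 1 covers ψ = 0.
  have hr : 0 < δ / (√E * (‖ψ‖ + 1)) := by positivity
  have hball : ∀ χ ∈ Metric.ball (0 : (sqrtOp G hG).domain) (δ / (√E * (‖ψ‖ + 1))),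
      ‖f χ‖ ≤ C := by
    intro χ hχ
    rw [mem_ball_zero_iff, lt_div_iff₀ (by positivity)] at hχ
    set A := InnerProductSpace.rankOne ℂ ψ (sqrtOp G hG χ) with hA
    have h1 : eNorm G hG E (ofBounded _ A) < δ := by
      refine (eNorm_rankOne_le hQ hE.le ψ χ).trans_lt (lt_of_le_of_lt ?_ hχ)
      have h0 : 0 ≤ √E * ‖χ‖ := by positivity
      calc √E * ‖(χ : H)‖ * ‖ψ‖ ≤ √E * ‖χ‖ * (‖ψ‖ + 1) :=
            mul_le_mul_of_nonneg_left (by linarith) h0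
        _ = _ := by ring
    have h2 := h A (by rwa [sub_zero])
    rw [map_zero, sub_zero] at h2
    have h3 := norm_apply_le_eNorm hQ hlow hE (ofBounded _ (Φ A)) φ hφ
    have h4 : ‖Φ A (φ : H)‖ ≤ C := by
      refine h3.trans ((mul_le_mul_of_nonneg_left h2.le (Real.sqrt_nonneg _)).trans_eq ?_)
      rw [mul_one]
    have h5 : ‖f χ‖ = ‖⟪(φ : H), Φ A (φ : H)⟫_ℂ‖ := by
      rw [← hΦ.inner_predual_pure, norm_inner_symm]
      rfl
    rw [h5]
    refine (norm_inner_le_norm _ _).trans ?_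
    rw [hφ, one_mul]
    exact h4
  obtain ⟨M, hM⟩ := LinearMap.bound_of_ball_bound hr C f hball
  have hmem : predual Φ (pure (φ : H)) ψ ∈ (sqrtOp G hG).adjoint.domain := by
    rw [LinearPMap.mem_adjoint_domain_iff]
    exact AddMonoidHomClass.continuous_of_bound f M hM
  rwa [hsa] at hmem

theorem IsENormContinuous.isLimited (hΦ : IsNormalMap Φ)
    (hlow : ∀ δ > 0, ∃ φ : H, ‖φ‖ = 1 ∧ sqNorm (sqrtOp G hG) φ ≤ ENNReal.ofReal δ)
    (hfin : HasFiniteChoiRank Φ ∨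
      ∃ P : H →L[ℂ] H, IsStarProjection P ∧ FiniteDimensional ℂ (LinearMap.range P.toLinearMap) ∧
        Φ 1 = Φ P) {E : ℝ} (hE : 0 < E) (hcont : IsENormContinuous Φ G hG E) :
    IsLimited Φ G hG := by
  obtain ⟨Q, hQ⟩ := (sqrtOp_spec G hG).posSelfAdjoint.exists_isResolventCompl
  have hrank : ∀ φ : H, FiniteDimensional ℂ (LinearMap.range (predual Φ (pure φ)).toLinearMap) := by
    intro φ
    rcases hfin with ⟨K, _, _, V, _, hV⟩ | ⟨P, hP, _, hΦP⟩
    · exact hV.1.finiteDimensional_range_predual hΦ φ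
    · exact finiteDimensional_range_predual hΦ hP hΦP (isPosTraceClass_pure φ)
  -- Only pure states have to be checked: there the output has finite rank and range in the domain
  -- of √G, and the uniform boundedness argument covers all states.
  obtain ⟨C, hC, hbound⟩ := hQ.exists_energy_bound hΦ fun φ hφ hφ1 =>
    have := hrank φ
    trConj_ne_top_of_finite_rank (hΦ.predual_spec (isPosTraceClass_pure φ)).1
      (hcont.predual_pure_mem hΦ hQ hlow hE ⟨φ, hφ⟩ hφ1)
  intro ρ hρ hρE
  refine (hbound ρ hρ.1 hρE.ne).trans_lt (ENNReal.mul_lt_top hC.lt_top ?_)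
  rw [(isState_iff.1 hρ).2]
  exact ENNReal.add_lt_top.2 ⟨ENNReal.one_lt_top, hρE⟩

end Converse

end EnergyOp

/-! ### Assembly of both parts. -/

theorem theorem1 {H : Type*} [NormedAddCommGroup H] [InnerProductSpace ℂ H]
    [CompleteSpace H] [TopologicalSpace.SeparableSpace H] (hdim : ¬ FiniteDimensional ℂ H)
    (Φ : (H →L[ℂ] H) →CP (H →L[ℂ] H)) (hnormal : IsNormalMap Φ) (hsub : Φ 1 ≤ 1)
    (G : H →ₗ.[ℂ] H) (hG : IsPosSelfAdjoint G)
    (hG0 : sInf {r : ℝ | ∃ φ : G.domain, ‖(φ : H)‖ = 1 ∧ r = ‖G φ‖} = 0) :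
    -- Part A
    (IsLimited Φ G hG →
      (∀ E > 0, IsENormContinuous Φ G hG E) ∧
      (∀ E > 0, maxEnergy Φ G hG E < ⊤) ∧
      ∃ (Ψ : BG G hG →ₗ[ℂ] BG G hG) (k : ℝ),
        (∀ A : H →L[ℂ] H, Ψ (ofBounded _ A) = ofBounded _ (Φ A)) ∧
        (∀ (K : Type*) [NormedAddCommGroup K] [InnerProductSpace ℂ K] [CompleteSpace K]
          [TopologicalSpace.SeparableSpace K] (V : H →L[ℂ] HTensor H K), IsStinespring Φ V →
          IsGivenBy (sqrtOp G hG) V Ψ ∧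
            ∀ Ψ' : BG G hG →ₗ[ℂ] BG G hG, IsGivenBy (sqrtOp G hG) V Ψ' → Ψ' = Ψ) ∧
        (∀ E > 0, ∀ A : BG G hG,
          eNorm G hG E (Ψ A) ≤ √‖Φ 1‖ * eNorm G hG (maxEnergy Φ G hG E).toReal A ∧
          √‖Φ 1‖ * eNorm G hG (maxEnergy Φ G hG E).toReal A ≤
            √(max 1 ((maxEnergy Φ G hG E).toReal / E) * ‖Φ 1‖) * eNorm G hG E A) ∧
        Filter.Tendsto (fun E : ℝ => (maxEnergy Φ G hG E).toReal / E) Filter.atTop (𝓝 k) ∧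
        (∀ A : BG G hG, relBound (sqrtOp G hG) (Ψ A) ≤
          √(k * ‖Φ 1‖) * relBound (sqrtOp G hG) A) ∧
        ∀ A : BG G hG, relBound (sqrtOp G hG) A = 0 → relBound (sqrtOp G hG) (Ψ A) = 0) ∧
    -- Part B
    (IsDiscreteOp G →
      (HasFiniteChoiRank Φ ∨
        ∃ P : H →L[ℂ] H, IsStarProjection P ∧ FiniteDimensional ℂ (LinearMap.range P.toLinearMap) ∧
          Φ 1 = Φ P) →
      (∃ E > 0, IsENormContinuous Φ G hG E) → IsLimited Φ G hG) := by
  have hnt : Nontrivial H := by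
    by_contra h
    rw [not_nontrivial_iff_subsingleton] at h
    exact hdim inferInstance
  have hlow := exists_unit_sqNorm_le (hG := hG) hG0
  refine ⟨fun hlim => ?_, fun _ hfin ⟨E, hE, hcont⟩ => hcont.isLimited hnormal hlow hfin hE⟩
  obtain ⟨Q, hQ⟩ := (sqrtOp_spec G hG).posSelfAdjoint.exists_isResolventCompl
  have hfin := hlim.maxEnergy_lt_top hnormal
  have hpres := hlim.preservesFiniteEnergy hnormal hQ
  obtain ⟨k, -, hk⟩ := exists_tendsto_maxEnergy_div hnormal hQ hlow hfin
  let Ψ := extendBG hnormal hsub hQ hlow hfin hpres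
  have hΨ : ∀ A : H →L[ℂ] H, Ψ (ofBounded _ A) = ofBounded _ (Φ A) := fun A =>
    Subtype.ext (LinearMap.ext fun φ => hQ.extend_ofBounded hnormal hpres A φ)
  have hnorm : ∀ E > 0, ∀ A : BG G hG,
      eNorm G hG E (Ψ A) ≤ √‖Φ 1‖ * eNorm G hG (maxEnergy Φ G hG E).toReal A ∧
      √‖Φ 1‖ * eNorm G hG (maxEnergy Φ G hG E).toReal A ≤
        √(max 1 ((maxEnergy Φ G hG E).toReal / E) * ‖Φ 1‖) * eNorm G hG E A := by
    intro E hE A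
    refine ⟨eNorm_extendBG_le hnormal hsub hQ hlow hfin hpres E A, ?_⟩
    rw [Real.sqrt_mul (le_max_of_le_left zero_le_one), mul_comm (√(max _ _)), mul_assoc]
    exact mul_le_mul_of_nonneg_left (eNorm_le_sqrt_max_mul hQ hlow A hE ENNReal.toReal_nonneg)
      (Real.sqrt_nonneg _)
  have hbound := relBound_extendBG_le hnormal hsub hQ hlow hfin hpres hk
  refine ⟨fun E hE A₀ ε hε => ?_, fun E _ => hfin E, Ψ, k, hΨ, ?_, hnorm, hk, hbound,
    fun A hA => ?_⟩
  · set M := √(max 1 ((maxEnergy Φ G hG E).toReal / E) * ‖Φ 1‖)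
    have hM : 0 ≤ M := Real.sqrt_nonneg _
    -- Continuity follows from linearity and the norm bound with constant M; adding 1 avoids a
    -- division by zero when M = 0.
    refine ⟨ε / (M + 1), by positivity, fun A hA => ?_⟩
    rw [← map_sub, ← hΨ]
    refine ((hnorm E hE _).1.trans (hnorm E hE _).2).trans_lt ?_
    rw [lt_div_iff₀ (by positivity)] at hA
    have h0 := eNorm_nonneg (hG := hG) E (ofBounded _ (A - A₀))
    nlinarith
  · intro K _ _ _ _ V hV
    have h : IsGivenBy (sqrtOp G hG) V Ψ := fun A =>
      ⟨hQ.existsUnique_isRelAmpl A, fun B hB φ => hV.extend_apply hnormal hQ hpres A hB φ⟩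
    exact ⟨h, fun Ψ' h' => h.unique h'⟩
  · refine le_antisymm ((hbound A).trans_eq ?_) (relBound_nonneg _)
    rw [hA, mul_zero]
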